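/- Let $s\in(0,1)$ and let $N\ge 1$ be an integer with $N>2s$; put $2^*_s=\frac{2N}{N-2s}$. Let $f\in C([0,\infty))$ be real valued with $f(0)=0$ and (f1) $\lim_{t\to0^+}\frac{f(t)}{t}=0$, $\lim_{t\to\infty}\frac{f(t)}{t}=\infty$, and for some $\gamma\in(2,2^*_s)$ and $C_f>0$ the limit $\lim_{t\to\infty}\frac{f(t)}{t^{\gamma-1}}$ exists and is at most $C_f$; (f2) there is $R>0$ such that $t\mapsto \frac{f(t)}{t}$ is non-decreasing on $(R,\infty)$. Let $g\in L^1(\mathbb R^N)\cap L^\infty(\mathbb R^N)$ with $g\ge 0$ a.e. and $g$ not a.e. equal to $0$. For $a>0$ let $f_a(t)=f(t)-a$ for $t\ge0$, $f_a(t)=-a$ for $t\le 0$, and $F_a(t)=\int_0^t f_a(\tau)\,d\tau$. Let $[u]_{s,2}=\left(\iint_{\mathbb R^N\times\mathbb R^N}\frac{(u(x)-u(y))^2}{|x-y|^{N+2s}}\,dx\,dy\right)^{1/2}$, and let $\dot H^s(\mathbb R^N)$ be the closure of $C_c^1(\mathbb R^N)$ with respect to the norm $\|u\|_{\dot H^s}=[u]_{s,2}+\|u\|_{L^{2^*_s}}$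 (inside the space of all $u\in L^{2^*_s}(\mathbb R^N)$ with $[u]_{s,2}<\infty$). Consider $$(-\Delta)^s u=g\,f_a(u)\ \text{ in }\mathbb R^N,\qquad(\mathrm{SP})$$ whose weak solutions are the $u\in\dot H^s(\mathbb R^N)$ with $$\iint_{\mathbb R^N\times\mathbb R^N}\frac{(u(x)-u(y))(\varphi(x)-\varphi(y))}{|x-y|^{N+2s}}\,dx\,dy=\int_{\mathbb R^N} g f_a(u)\varphi\,dx\quad\text{for all }\varphi\in\dot H^s(\mathbb R^N)$$ (the right-hand integrals converging absolutely), and the energy $I_a(u)=\frac12[u]_{s,2}^2-\int_{\mathbb R^N} gF_a(u)\,dx$ on $\dot H^s(\mathbb R^N)$. A weak solution $u$ of (SP) is called a mountain pass solution if - $I_a$ is well defined (i.e. $gF_a(v)\in L^1(\mathbb R^N)$ for all $v\in\dot H^s(\mathbb R^N)$), $I_a\in C^1(\dot H^s(\mathbb R^N),\mathbb R)$, and $I_a'(u)=0$; - (Cerami condition) for every $c\in\mathbb R$: every bounded sequence $(w_n)$ in $\dot H^s(\mathbb R^N)$ with $I_a(w_n)\to c$ and $I_a'(w_n)\to0$ in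 the dual space has a convergent subsequence, and there are $\eta,\beta,\rho>0$ such that $\|I_a'(v)\|\,[v]_{s,2}\ge\beta$ whenever $I_a(v)\in[c-\eta,c+\eta]$ and $[v]_{s,2}\ge\rho$; - (mountain pass geometry and level) there are $\rho,\beta>0$ and $e\in\dot H^s(\mathbb R^N)$ such that $I_a(0)=0$, $I_a(v)\ge\beta$ whenever $[v]_{s,2}=\rho$, $[e]_{s,2}>\rho$, $I_a(e)<0$, and $$I_a(u)=\inf_{p}\max_{t\in[0,1]}I_a(p(t))\ge\beta,$$ where $p$ ranges over the continuous paths $p:[0,1]\to\dot H^s(\mathbb R^N)$ with $p(0)=0$ and $p(1)=e$. Then there is $a_1>0$ and, for every $a\in(0,a_1)$, a mountain pass solution $u_a$ of (SP), such that moreover, for some $a_2\in(0,a_1)$ and $C>0$, $\|u_a\|_{\dot H^s}\le C$ for all $a\in(0,a_2)$. -/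

import Mathlib

open MeasureTheory Set Filter Topology

noncomputable section

/-! ## The critical exponent and the Gagliardo seminorm -/

/-- The critical fractional exponent `2N / (N - 2s)`. -/
def critExp (N : ℕ) (s : ℝ) : ℝ := 2 * (N : ℝ) / ((N : ℝ) - 2 * s)

/-- The integrand `(u(x) - u(y)) (v(x) - v(y)) / |x - y|^(N + 2s)` at `z = (x, y)`. -/
def gagliardoIntegrand (N : ℕ) (s : ℝ) (u v : EuclideanSpace ℝ (Fin N) → ℝ)
    (z : EuclideanSpace ℝ (Fin N) × EuclideanSpace ℝ (Fin N)) : ℝ :=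
  (u z.1 - u z.2) * (v z.1 - v z.2) / ‖z.1 - z.2‖ ^ ((N : ℝ) + 2 * s)

/-- The bilinear form
`∬ (u(x) - u(y)) (v(x) - v(y)) / |x - y|^(N + 2s) dx dy` over `ℝ^N × ℝ^N`. -/
def gagliardoForm (N : ℕ) (s : ℝ) (u v : EuclideanSpace ℝ (Fin N) → ℝ) : ℝ :=
  ∫ z, gagliardoIntegrand N s u v z

/-- The Gagliardo seminorm `[u]_{s,2}`. It is used only for functions for which the double
integral converges. -/
def gagliardoSeminorm (N : ℕ) (s : ℝ) (u : EuclideanSpace ℝ (Fin N) → ℝ) : ℝ :=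
  Real.sqrt (gagliardoForm N s u u)

/-! ### Auxiliary facts: the seminorm is the `L²` norm of a difference quotient -/

lemma one_le_ofReal_critExp {N : ℕ} {s : ℝ} (hs : 0 < s) (hN : 2 * s < N) :
    1 ≤ ENNReal.ofReal (critExp N s) := by
  rw [ENNReal.one_le_ofReal, critExp, le_div_iff₀ (by linarith)]
  linarith

/-- The difference quotient `(u(x) - u(y)) / |x - y|^((N + 2s)/2)`. -/
def diffQuot (N : ℕ) (s : ℝ) (u : EuclideanSpace ℝ (Fin N) → ℝ)
    (z : EuclideanSpace ℝ (Fin N) × EuclideanSpace ℝ (Fin N)) : ℝ :=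
  (u z.1 - u z.2) / ‖z.1 - z.2‖ ^ (((N : ℝ) + 2 * s) / 2)

lemma gagliardoIntegrand_self (N : ℕ) (s : ℝ) (u : EuclideanSpace ℝ (Fin N) → ℝ) :
    gagliardoIntegrand N s u u = fun z => diffQuot N s u z ^ 2 := by
  funext z
  simp only [gagliardoIntegrand, diffQuot, div_pow]
  rw [← Real.rpow_natCast (‖z.1 - z.2‖ ^ _), ← Real.rpow_mul (norm_nonneg _)]
  congr 1
  · ring
  · congr 1
    push_cast
    ring

lemma aestronglyMeasurable_diffQuot (N : ℕ) (s : ℝ) {u : EuclideanSpace ℝ (Fin N) → ℝ}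
    (hu : AEStronglyMeasurable u volume) : AEStronglyMeasurable (diffQuot N s u) volume := by
  have h1 : AEStronglyMeasurable
      (fun z : EuclideanSpace ℝ (Fin N) × EuclideanSpace ℝ (Fin N) => u z.1) volume :=
    hu.comp_quasiMeasurePreserving Measure.quasiMeasurePreserving_fst
  have h2 : AEStronglyMeasurable
      (fun z : EuclideanSpace ℝ (Fin N) × EuclideanSpace ℝ (Fin N) => u z.2) volume :=
    hu.comp_quasiMeasurePreserving Measure.quasiMeasurePreserving_snd
  have h3 : Measurable (fun z : EuclideanSpace ℝ (Fin N) × EuclideanSpace ℝ (Fin N) =>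
      ‖z.1 - z.2‖ ^ (((N : ℝ) + 2 * s) / 2)) := by
    fun_prop
  exact ((h1.sub h2).aemeasurable.div h3.aemeasurable).aestronglyMeasurable

lemma memLp_diffQuot_iff (N : ℕ) (s : ℝ) {u : EuclideanSpace ℝ (Fin N) → ℝ}
    (hu : AEStronglyMeasurable u volume) :
    MemLp (diffQuot N s u) 2 volume ↔ Integrable (gagliardoIntegrand N s u u) volume := by
  rw [gagliardoIntegrand_self]
  exact memLp_two_iff_integrable_sq (aestronglyMeasurable_diffQuot N s hu)

lemma gagliardoSeminorm_eq_lpNorm (N : ℕ) (s : ℝ) {u : EuclideanSpace ℝ (Fin N) → ℝ}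
    (hu : AEStronglyMeasurable u volume) :
    gagliardoSeminorm N s u = lpNorm (diffQuot N s u) 2 volume := by
  rw [lpNorm_eq_integral_norm_rpow_toReal (by norm_num) (by norm_num)
    (aestronglyMeasurable_diffQuot N s hu), gagliardoSeminorm, gagliardoForm,
    gagliardoIntegrand_self, Real.sqrt_eq_rpow]
  simp

lemma diffQuot_congr (N : ℕ) (s : ℝ) {u v : EuclideanSpace ℝ (Fin N) → ℝ}
    (h : u =ᵐ[volume] v) : diffQuot N s u =ᵐ[volume] diffQuot N s v := by
  have h1 : ∀ᵐ z : EuclideanSpace ℝ (Fin N) × EuclideanSpace ℝ (Fin N), u z.1 = v z.1 :=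
    Measure.quasiMeasurePreserving_fst.ae h
  have h2 : ∀ᵐ z : EuclideanSpace ℝ (Fin N) × EuclideanSpace ℝ (Fin N), u z.2 = v z.2 :=
    Measure.quasiMeasurePreserving_snd.ae h
  filter_upwards [h1, h2] with z hz1 hz2
  simp [diffQuot, hz1, hz2]

lemma lpNorm_diffQuot_congr (N : ℕ) (s : ℝ) {u v : EuclideanSpace ℝ (Fin N) → ℝ}
    (h : u =ᵐ[volume] v) :
    lpNorm (diffQuot N s u) 2 volume = lpNorm (diffQuot N s v) 2 volume := by
  have h' := diffQuot_congr N s h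
  have hiff : AEStronglyMeasurable (diffQuot N s u) volume ↔
      AEStronglyMeasurable (diffQuot N s v) volume := aestronglyMeasurable_congr h'
  by_cases hu : AEStronglyMeasurable (diffQuot N s u) volume
  · rw [← toReal_eLpNorm hu, ← toReal_eLpNorm (hiff.1 hu), eLpNorm_congr_ae h']
  · rw [lpNorm_of_not_aestronglyMeasurable hu,
      lpNorm_of_not_aestronglyMeasurable (fun hv => hu (hiff.2 hv))]

lemma diffQuot_add (N : ℕ) (s : ℝ) (u v : EuclideanSpace ℝ (Fin N) → ℝ) :
    diffQuot N s (u + v) = diffQuot N s u + diffQuot N s v := by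
  funext z
  simp only [diffQuot, Pi.add_apply]
  ring

lemma diffQuot_smul (N : ℕ) (s : ℝ) (c : ℝ) (u : EuclideanSpace ℝ (Fin N) → ℝ) :
    diffQuot N s (c • u) = c • diffQuot N s u := by
  funext z
  simp only [diffQuot, Pi.smul_apply, smul_eq_mul]
  ring

/-! ## The homogeneous fractional Sobolev space -/

/-- The (classes of) functions `u ∈ L^{2N/(N-2s)}(ℝ^N)` with `[u]_{s,2} < ∞`. -/
def gagliardoSubmodule (N : ℕ) (s : ℝ) :
    Submodule ℝ (Lp ℝ (ENNReal.ofReal (critExp N s))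
      (volume : Measure (EuclideanSpace ℝ (Fin N)))) where
  carrier := {u | Integrable (gagliardoIntegrand N s u u) volume}
  zero_mem' := by
    rw [mem_ofPred_eq, ← memLp_diffQuot_iff N s (Lp.aestronglyMeasurable _)]
    refine (memLp_congr_ae (diffQuot_congr N s (Lp.coeFn_zero _ _ _))).2 ?_
    have : diffQuot N s (0 : EuclideanSpace ℝ (Fin N) → ℝ) = 0 := by
      funext z; simp [diffQuot]
    rw [this]
    exact MemLp.zero
  add_mem' := by
    intro u v hu hv
    rw [mem_ofPred_eq, ← memLp_diffQuot_iff N s (Lp.aestronglyMeasurable _)] at hu hv ⊢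
    refine (memLp_congr_ae (diffQuot_congr N s (Lp.coeFn_add u v))).2 ?_
    rw [diffQuot_add]
    exact hu.add hv
  smul_mem' := by
    intro c u hu
    rw [mem_ofPred_eq, ← memLp_diffQuot_iff N s (Lp.aestronglyMeasurable _)] at hu ⊢
    refine (memLp_congr_ae (diffQuot_congr N s (Lp.coeFn_smul c u))).2 ?_
    rw [diffQuot_smul]
    exact hu.const_smul c

/-- The space `{u ∈ L^{2N/(N-2s)}(ℝ^N) : [u]_{s,2} < ∞}`, to be normed by
`[u]_{s,2} + ‖u‖_{2N/(N-2s)}`. -/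
def GagliardoSpace {N : ℕ} {s : ℝ} (_hs : 0 < s) (_hN : 2 * s < N) : Type :=
  ↥(gagliardoSubmodule N s)

namespace GagliardoSpace

variable {N : ℕ} {s : ℝ} {hs : 0 < s} {hN : 2 * s < N}

instance : AddCommGroup (GagliardoSpace hs hN) :=
  inferInstanceAs (AddCommGroup ↥(gagliardoSubmodule N s))

instance : Module ℝ (GagliardoSpace hs hN) :=
  inferInstanceAs (Module ℝ ↥(gagliardoSubmodule N s))

/-- The class in `L^{2N/(N-2s)}(ℝ^N)` of an element. -/
def toLp (u : GagliardoSpace hs hN) : Lp ℝ (ENNReal.ofReal (critExp N s))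
    (volume : Measure (EuclideanSpace ℝ (Fin N))) := Subtype.val u

/-- A representative of an element, as a function on `ℝ^N`. -/
instance : CoeFun (GagliardoSpace hs hN) (fun _ => EuclideanSpace ℝ (Fin N) → ℝ) :=
  ⟨fun u => toLp u⟩

instance : Norm (GagliardoSpace hs hN) := ⟨fun u => gagliardoSeminorm N s u + ‖toLp u‖⟩

lemma norm_def (u : GagliardoSpace hs hN) : ‖u‖ = gagliardoSeminorm N s u + ‖toLp u‖ := rfl

lemma memLp_diffQuot (u : GagliardoSpace hs hN) : MemLp (diffQuot N s u) 2 volume :=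
  (memLp_diffQuot_iff N s (Lp.aestronglyMeasurable _)).2 (Subtype.property u)

lemma seminorm_eq (u : GagliardoSpace hs hN) :
    gagliardoSeminorm N s u = lpNorm (diffQuot N s u) 2 volume :=
  gagliardoSeminorm_eq_lpNorm N s (Lp.aestronglyMeasurable _)

lemma coe_add (u v : GagliardoSpace hs hN) :
    (toLp (u + v) : EuclideanSpace ℝ (Fin N) → ℝ) =ᵐ[volume] toLp u + toLp v :=
  Lp.coeFn_add (toLp u) (toLp v)

lemma coe_smul (c : ℝ) (u : GagliardoSpace hs hN) :
    (toLp (c • u) : EuclideanSpace ℝ (Fin N) → ℝ) =ᵐ[volume] c • toLp u :=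
  Lp.coeFn_smul c (toLp u)

lemma seminorm_add_le (u v : GagliardoSpace hs hN) :
    gagliardoSeminorm N s (u + v : GagliardoSpace hs hN)
      ≤ gagliardoSeminorm N s u + gagliardoSeminorm N s v := by
  simp only [seminorm_eq]
  rw [lpNorm_diffQuot_congr N s (coe_add u v), diffQuot_add]
  exact lpNorm_add_le (memLp_diffQuot u) (by norm_num)

lemma seminorm_smul (c : ℝ) (u : GagliardoSpace hs hN) :
    gagliardoSeminorm N s (c • u : GagliardoSpace hs hN) = |c| * gagliardoSeminorm N s u := by
  simp only [seminorm_eq]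
  rw [lpNorm_diffQuot_congr N s (coe_smul c u), diffQuot_smul, lpNorm_const_smul]
  simp

lemma core : NormedSpace.Core ℝ (GagliardoSpace hs hN) := by
  have : Fact (1 ≤ ENNReal.ofReal (critExp N s)) := ⟨one_le_ofReal_critExp hs hN⟩
  refine ⟨⟨fun u => ?_, fun c u => ?_, fun u v => ?_⟩, fun u => ⟨fun h => ?_, fun h => ?_⟩⟩
  · exact add_nonneg (Real.sqrt_nonneg _) (norm_nonneg _)
  · have h : ‖toLp (c • u)‖ = ‖c‖ * ‖toLp u‖ := norm_smul c (toLp u)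
    rw [norm_def, norm_def, seminorm_smul, h, Real.norm_eq_abs]
    ring
  · have h : ‖toLp (u + v)‖ ≤ ‖toLp u‖ + ‖toLp v‖ := norm_add_le (toLp u) (toLp v)
    have := seminorm_add_le u v
    simp only [norm_def]
    linarith
  · rw [norm_def] at h
    have h1 : 0 ≤ gagliardoSeminorm N s u := Real.sqrt_nonneg _
    have h2 : ‖toLp u‖ = 0 := le_antisymm (by linarith) (norm_nonneg _)
    exact Subtype.ext (norm_eq_zero.1 h2)
  · subst h
    have h1 : ‖toLp (0 : GagliardoSpace hs hN)‖ = 0 :=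
      norm_zero (E := Lp ℝ (ENNReal.ofReal (critExp N s))
        (volume : Measure (EuclideanSpace ℝ (Fin N))))
    have h2 := seminorm_smul (0 : ℝ) (0 : GagliardoSpace hs hN)
    rw [zero_smul, abs_zero, zero_mul] at h2
    rw [norm_def, h1, h2, add_zero]

instance : NormedAddCommGroup (GagliardoSpace hs hN) := NormedAddCommGroup.ofCore core

instance : NormedSpace ℝ (GagliardoSpace hs hN) := NormedSpace.ofCore core

end GagliardoSpace

/-- The subspace of (classes of) functions in `C_c^1(ℝ^N)`. -/
def testFunctions {N : ℕ} {s : ℝ} (hs : 0 < s) (hN : 2 * s < N) :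
    Submodule ℝ (GagliardoSpace hs hN) where
  carrier := {u | ∃ φ : EuclideanSpace ℝ (Fin N) → ℝ,
    ContDiff ℝ 1 φ ∧ HasCompactSupport φ ∧ (u : EuclideanSpace ℝ (Fin N) → ℝ) =ᵐ[volume] φ}
  zero_mem' := ⟨0, contDiff_const, HasCompactSupport.zero, Lp.coeFn_zero _ _ _⟩
  add_mem' := by
    rintro u v ⟨φ, hφ, hφc, hu⟩ ⟨ψ, hψ, hψc, hv⟩
    exact ⟨φ + ψ, hφ.add hψ, hφc.add hψc, (GagliardoSpace.coe_add u v).trans (hu.add hv)⟩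
  smul_mem' := by
    rintro c u ⟨φ, hφ, hφc, hu⟩
    exact ⟨c • φ, hφ.const_smul c, hφc.smul_left (f := fun _ => c),
      (GagliardoSpace.coe_smul c u).trans (hu.const_smul c)⟩

/-- The homogeneous fractional Sobolev space: the closure of `C_c^1(ℝ^N)` with respect to the
norm `[u]_{s,2} + ‖u‖_{2N/(N-2s)}`; it carries this norm. -/
abbrev HDot {N : ℕ} {s : ℝ} (hs : 0 < s) (hN : 2 * s < N) : Type :=
  ↥(testFunctions hs hN).topologicalClosure

/-- A representative of an element of the homogeneous space, as a function on `ℝ^N`. -/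
def HDot.fn {N : ℕ} {s : ℝ} {hs : 0 < s} {hN : 2 * s < N} (u : HDot hs hN) :
    EuclideanSpace ℝ (Fin N) → ℝ :=
  GagliardoSpace.toLp (u : GagliardoSpace hs hN)

/-! ## The nonlinearity -/

/-- The growth hypothesis on `f` near `0` and near `∞` (superlinear and subcritical). -/
def HypF1 (N : ℕ) (s : ℝ) (f : ℝ → ℝ) : Prop :=
  Tendsto (fun t => f t / t) (𝓝[>] 0) (𝓝 0) ∧
  Tendsto (fun t => f t / t) atTop atTop ∧
  ∃ γ : ℝ, 2 < γ ∧ γ < critExp N s ∧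
    ∃ C > 0, ∃ L ≤ C, Tendsto (fun t => f t / t ^ (γ - 1)) atTop (𝓝 L)

/-- `f(t)/t` is (not necessarily strictly) increasing for large `t`. -/
def HypF2 (f : ℝ → ℝ) : Prop :=
  ∃ R > 0, MonotoneOn (fun t => f t / t) (Ioi R)

/-- `f_a(t) = f(t) - a` for `t ≥ 0` and `f_a(t) = -a` for `t ≤ 0` (the two agree at `0` when
`f(0) = 0`). -/
def fShift (f : ℝ → ℝ) (a t : ℝ) : ℝ := if 0 ≤ t then f t - a else -a

/-- The primitive `F_a(t) = ∫_0^t f_a`. -/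
def FShift (f : ℝ → ℝ) (a t : ℝ) : ℝ := ∫ τ in (0 : ℝ)..t, fShift f a τ

/-! ## Weak and mountain pass solutions of `(-Δ)^s u = g f_a(u)` -/

section Solutions

variable {N : ℕ} {s : ℝ} {hs : 0 < s} {hN : 2 * s < N}

/-- `u` is a weak solution of `(-Δ)^s u = g f_a(u)` in `ℝ^N`. -/
def IsWeakSolution (f : ℝ → ℝ) (g : EuclideanSpace ℝ (Fin N) → ℝ) (a : ℝ)
    (u : HDot hs hN) : Prop :=
  ∀ φ : HDot hs hN,
    Integrable (fun x => g x * fShift f a (u.fn x) * φ.fn x) volume ∧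
    gagliardoForm N s u.fn φ.fn = ∫ x, g x * fShift f a (u.fn x) * φ.fn x

/-- The energy `I_a(u) = [u]_{s,2}^2 / 2 - ∫ g F_a(u)`. -/
def energy (f : ℝ → ℝ) (g : EuclideanSpace ℝ (Fin N) → ℝ) (a : ℝ) (u : HDot hs hN) : ℝ :=
  gagliardoSeminorm N s u.fn ^ 2 / 2 - ∫ x, g x * FShift f a (u.fn x)

/-- The weakened Palais-Smale (Cerami) condition for a functional `I` on the homogeneous space,
at every level `c`: bounded Palais-Smale sequences have convergent subsequences, and
`‖I'(u)‖ [u]_{s,2}` is bounded away from `0` for `u` large with `I(u)` near `c`. -/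
def SatisfiesCerami (I : HDot hs hN → ℝ) : Prop :=
  ∀ c : ℝ,
    (∀ w : ℕ → HDot hs hN, Bornology.IsBounded (range w) →
      Tendsto (fun n => I (w n)) atTop (𝓝 c) →
      Tendsto (fun n => fderiv ℝ I (w n)) atTop (𝓝 0) →
      ∃ v : HDot hs hN, ∃ k : ℕ → ℕ, StrictMono k ∧ Tendsto (w ∘ k) atTop (𝓝 v)) ∧
    ∃ η > 0, ∃ β > 0, ∃ ρ > 0, ∀ v : HDot hs hN,
      I v ∈ Icc (c - η) (c + η) → ρ ≤ gagliardoSeminorm N s v.fn →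
        β ≤ ‖fderiv ℝ I v‖ * gagliardoSeminorm N s v.fn

/-- `u` is a mountain pass solution of `(-Δ)^s u = g f_a(u)`: a weak solution which is a critical
point of the `C¹` energy functional, where the energy satisfies the Cerami condition and has the
mountain pass geometry, and the energy of `u` is the mountain pass level. -/
def IsMountainPassSolution (f : ℝ → ℝ) (g : EuclideanSpace ℝ (Fin N) → ℝ) (a : ℝ)
    (u : HDot hs hN) : Prop :=
  IsWeakSolution f g a u ∧
  (∀ v : HDot hs hN, Integrable (fun x => g x * FShift f a (v.fn x)) volume) ∧
  ContDiff ℝ 1 (energy f g a : HDot hs hN → ℝ) ∧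
  fderiv ℝ (energy f g a) u = 0 ∧
  SatisfiesCerami (energy f g a : HDot hs hN → ℝ) ∧
  ∃ ρ > 0, ∃ β > 0, ∃ e : HDot hs hN,
    energy f g a (0 : HDot hs hN) = 0 ∧
    (∀ v : HDot hs hN, gagliardoSeminorm N s v.fn = ρ → β ≤ energy f g a v) ∧
    ρ < gagliardoSeminorm N s e.fn ∧ energy f g a e < 0 ∧
    β ≤ energy f g a u ∧
    -- the level is the infimum over continuous paths from `0` to `e` of the maximal energy
    IsGLB (range fun p : Path (0 : HDot hs hN) e => ⨆ t, energy f g a (p t)) (energy f g a u)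

end Solutions

end

open MeasureTheory Set Filter Topology

noncomputable section

set_option linter.unusedSectionVars false

/-! ## The mountain pass theorem with Cerami's weight -/

section MountainPass

variable {E : Type*} [NormedAddCommGroup E]

/-! Put μ = g dx, a finite measure with density at most ‖g‖_∞. Extending f by 0 to the negative
half-line turns f_a into f - a, so the energy becomes ½B(u,u) - ∫F(u)dμ + a∫u dμ with B the
Gagliardo form. Such functionals are studied on an abstract `EnergySpace`; the concrete space enters
only through coercivity of B, compactness in the sense of a.e. convergence, and a truncation.

Existence. For small a the energy is positive on a small sphere, and it is negative at some far
point e because F is superquadratic. `exists_almost_critical_of_mountainPass` yields Cerami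
sequences at the mountain pass level, that is, ‖I'(u)‖(1+‖u‖) → 0. Once such a sequence is bounded,
subcritical growth makes I' a compact perturbation of the coercive form, so a subsequence converges
(`exists_subseq_tendsto`) and its limit is the solution.

Boundedness (`exists_norm_bound`) is the crux, since no Ambrosetti-Rabinowitz condition is
available. If the norms of u_n blow up while I(u_n) and ‖I'(u_n)‖‖u_n‖ stay bounded, the normalised
w_n converge a.e. along a subsequence to some v. Superlinearity forces v ≤ 0, where F vanishes;
hence I(T w_n) is at least of order T² and exceeds any prescribed bound for suitable T and n. The
maximum of I on the segment [0,u_n] is then attained at an interior point θu_n, where I'(θu_n)(θu_n)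
= 0. By (f2), t f(t) - 2F(t) is nondecreasing up to a constant (Jeanjean's device), so 2I(θu_n) ≤
2I(u_n) - I'(u_n)u_n + const + a(1-θ)(-∫u_n dμ). The last term, the price of the shift by -a, is
controlled by testing I'(u_n) with a smooth substitute for the negative part of u_n (`neg_mass_le`).
This contradicts the largeness of the maximum. The constants depend on a only through an upper
bound, and the levels are bounded along one fixed path, so the same estimate gives the Cerami
condition and the uniform bound on u_a.

Concrete inputs. Comparing u(x) with averages over balls of radius r costs r^s times the square root
of a local energy. Optimising r gives the fractional Sobolev inequality (`exists_sobolev_const`),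
hence coercivity. Letting r → 0 gives compactness (`exists_subseq_ae_tendsto`), because ball
averages converge along a weakly convergent subsequence. The truncation is composition with a C¹
function, which preserves C_c^1. -/

lemma continuous_iSup_comp {I : E → ℝ} (hI : Continuous I) :
    Continuous fun p : C(unitInterval, E) => ⨆ t, I (p t) := by
  have h := isCompact_univ.continuous_sSup (K := (univ : Set unitInterval))
    (f := fun (p : C(unitInterval, E)) t => I (p t)) (by
      change Continuous fun z : C(unitInterval, E) × unitInterval => I (z.1 z.2)
      fun_prop)
  simpa [sSup_image, iSup_univ, image_univ, sSup_range] using h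

lemma bddAbove_range_comp {I : E → ℝ} (hI : Continuous I) (p : C(unitInterval, E)) :
    BddAbove (range fun t => I (p t)) :=
  (isCompact_range (by fun_prop)).bddAbove

variable [NormedSpace ℝ E]

/-- A path along whose upper part the derivative is bounded below (with the weight `1 + ‖·‖`)
can be pushed down at a definite rate, with fixed endpoints. -/
lemma exists_path_descent {I : E → ℝ} {I' : E → E →L[ℝ] ℝ}
    (hI : ∀ u, HasFDerivAt I (I' u) u) (hI' : Continuous I') {p : C(unitInterval, E)}
    {M κ δ : ℝ} (hκ : 0 < κ) (hδ : 0 < δ) (hle : ∀ t, I (p t) ≤ M)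
    (h0 : I (p 0) < M - κ) (h1 : I (p 1) < M - κ)
    (hgrad : ∀ t, M - κ ≤ I (p t) → δ ≤ ‖I' (p t)‖ * (1 + ‖p t‖)) :
    ∃ τ > 0, ∃ q : C(unitInterval, E), q 0 = p 0 ∧ q 1 = p 1 ∧
      (∀ t, ‖q t - p t‖ ≤ τ * (1 + ‖p t‖)) ∧ ∀ t, I (q t) ≤ M - τ * δ / 4 := by
  have hIc : Continuous I := continuous_iff_continuousAt.2 fun u => (hI u).continuousAt
  -- A pseudo-gradient field along the path, glued by a partition of unity: all three pointwise
  -- conditions are convex. Replacing δ by δ/2 leaves the slack that makes a constant choice work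
  -- locally, and vanishing at 0 and 1 fixes the endpoints.
  obtain ⟨v, hv⟩ := exists_continuous_forall_mem_convex_of_local_const (X := unitInterval) (E := E)
    (t := fun x => {v | ‖v‖ ≤ 1 ∧ (M - κ ≤ I (p x) → I' (p x) v * (1 + ‖p x‖) < -(δ / 2)) ∧
      (x = 0 ∨ x = 1 → v = 0)}) (by
      intro x a ha b hb α β hα hβ hαβ
      refine ⟨?_, fun h => ?_, fun h => ?_⟩
      · calc ‖α • a + β • b‖ ≤ ‖α • a‖ + ‖β • b‖ := norm_add_le _ _
          _ = α * ‖a‖ + β * ‖b‖ := by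
            rw [norm_smul, norm_smul, Real.norm_of_nonneg hα, Real.norm_of_nonneg hβ]
          _ ≤ α * 1 + β * 1 := by gcongr; exacts [ha.1, hb.1]
          _ = 1 := by rw [mul_one, mul_one, hαβ]
      · have ha' := ha.2.1 h
        have hb' := hb.2.1 h
        rw [map_add, map_smul, map_smul, smul_eq_mul, smul_eq_mul]
        rcases hα.eq_or_lt with rfl | hα
        · have : β = 1 := by linarith
          subst this
          simpa using hb'
        · have e1 := mul_lt_mul_of_pos_left ha' hα
          have e2 := mul_le_mul_of_nonneg_left hb'.le hβ
          have e3 : (α + β) * (δ / 2) = δ / 2 := by rw [hαβ, one_mul]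
          linarith
      · simp [ha.2.2 h, hb.2.2 h]) (by
      intro x
      by_cases hx : M - κ ≤ I (p x)
      · have hg := hgrad x hx
        have hpos : 0 < 1 + ‖p x‖ := by positivity
        have hlt : δ / 2 / (1 + ‖p x‖) < ‖I' (p x)‖ := by
          rw [div_lt_iff₀ hpos]; linarith
        obtain ⟨w, hw1, hw2⟩ := ContinuousLinearMap.exists_lt_apply_of_lt_opNorm _ hlt
        obtain ⟨c, hc1, hc2⟩ : ∃ c : E, ‖c‖ ≤ 1 ∧ I' (p x) c < -(δ / 2 / (1 + ‖p x‖)) := by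
          rcases le_total 0 (I' (p x) w) with h | h
          · refine ⟨-w, by rw [norm_neg]; exact hw1.le, ?_⟩
            rw [Real.norm_of_nonneg h] at hw2
            rw [map_neg]; linarith
          · refine ⟨w, hw1.le, ?_⟩
            rw [Real.norm_of_nonpos h] at hw2
            linarith
        refine ⟨c, ?_⟩
        have hx0 : x ≠ 0 := by rintro rfl; linarith
        have hx1 : x ≠ 1 := by rintro rfl; linarith
        have hcont : Continuous fun y => I' (p y) c * (1 + ‖p y‖) := by fun_prop
        have hc3 : I' (p x) c * (1 + ‖p x‖) < -(δ / 2) := by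
          rw [lt_neg, div_lt_iff₀ hpos] at hc2
          linarith
        filter_upwards [hcont.continuousAt.eventually_lt_const hc3, isOpen_ne.mem_nhds hx0,
          isOpen_ne.mem_nhds hx1] with y hy hy0 hy1
        exact ⟨hc1, fun _ => hy, fun h => (h.elim hy0 hy1).elim⟩
      · refine ⟨0, ?_⟩
        have hcont : Continuous fun y => I (p y) := by fun_prop
        filter_upwards [hcont.continuousAt.eventually_lt_const (not_le.1 hx)] with y hy
        exact ⟨by simp, fun h => (not_lt.2 h hy).elim, fun _ => rfl⟩)
  set w : unitInterval → E := fun x => (1 + ‖p x‖) • v x with hw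
  have hwc : Continuous w := by fun_prop
  have hA : IsCompact {x | M - κ ≤ I (p x)} :=
    (isClosed_le continuous_const (by fun_prop)).isCompact
  have ev1 : ∀ᶠ σ in 𝓝 (0 : ℝ), ∀ x ∈ {x | M - κ ≤ I (p x)},
      I' (p x + σ • w x) (w x) < -(δ / 4) := by
    refine hA.eventually_forall_of_forall_eventually fun x hx => ?_
    have hcont : Continuous fun z : ℝ × unitInterval => I' (p z.2 + z.1 • w z.2) (w z.2) := by
      have : Continuous fun z : ℝ × unitInterval => I' (p z.2 + z.1 • w z.2) := by fun_prop
      exact this.clm_apply (by fun_prop)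
    refine (hcont.tendsto (0, x)).eventually_lt_const (u := -(δ / 4)) ?_
    have := (hv x).2.1 hx
    simp only [zero_smul, add_zero, hw, map_smul, smul_eq_mul]
    linarith
  have ev2 : ∀ᶠ σ in 𝓝 (0 : ℝ), ∀ x ∈ (univ : Set unitInterval),
      I (p x + σ • w x) - I (p x) < κ / 2 := by
    refine isCompact_univ.eventually_forall_of_forall_eventually fun x hx => ?_
    have hcont : Continuous fun z : ℝ × unitInterval => I (p z.2 + z.1 • w z.2) - I (p z.2) := by
      fun_prop
    refine (hcont.tendsto (0, x)).eventually_lt_const (u := κ / 2) ?_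
    simpa using hκ
  obtain ⟨r, hr, hball⟩ := Metric.eventually_nhds_iff_ball.1 (ev1.and ev2)
  -- The bound r/2 keeps the straight motion where both uniform estimates hold. The bound 2κ/δ gives
  -- τδ/4 ≤ κ/2: points starting below the band rise by less than κ/2 and so still end below M -
  -- τδ/4.
  refine ⟨min (r / 2) (2 * κ / δ), by positivity, ⟨fun x => p x + min (r / 2) (2 * κ / δ) • w x,
    by fun_prop⟩, ?_, ?_, fun t => ?_, fun t => ?_⟩
  · simp [hw, (hv 0).2.2 (Or.inl rfl)]
  · simp [hw, (hv 1).2.2 (Or.inr rfl)]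
  · set τ := min (r / 2) (2 * κ / δ)
    have hτ : 0 < τ := by positivity
    simp only [ContinuousMap.coe_mk, add_sub_cancel_left, hw, norm_smul, Real.norm_of_nonneg hτ.le]
    gcongr
    rw [Real.norm_of_nonneg (by positivity)]
    have := mul_le_mul_of_nonneg_left (hv t).1 (by positivity : 0 ≤ 1 + ‖p t‖)
    linarith
  · set τ := min (r / 2) (2 * κ / δ)
    have hτ : 0 < τ := by positivity
    have hτr : τ < r := lt_of_le_of_lt (min_le_left _ _) (by linarith)
    have hτκ : τ * δ ≤ 2 * κ := by
      have : τ ≤ 2 * κ / δ := min_le_right _ _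
      rwa [le_div_iff₀ hδ] at this
    change I (p t + τ • w t) ≤ _
    by_cases ht : M - κ ≤ I (p t)
    · have hd : ∀ σ : ℝ, HasDerivAt (fun σ : ℝ => I (p t + σ • w t))
          (I' (p t + σ • w t) (w t)) σ := fun σ => by
        have h1 : HasDerivAt (fun σ : ℝ => p t + σ • w t) (w t) σ := by
          simpa using ((hasDerivAt_id σ).smul_const (w t)).const_add (p t)
        exact (hI _).comp_hasDerivAt σ h1
      have := (convex_Icc (0 : ℝ) τ).image_sub_le_mul_sub_of_deriv_le
        (f := fun σ : ℝ => I (p t + σ • w t)) (C := -(δ / 4))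
        (fun σ _ => (hd σ).continuousAt.continuousWithinAt)
        (fun σ _ => (hd σ).differentiableAt.differentiableWithinAt)
        (fun σ hσ => by
          rw [interior_Icc] at hσ
          rw [(hd σ).deriv]
          refine ((hball σ ?_).1 t ht).le
          rw [Metric.mem_ball, Real.dist_eq, sub_zero, abs_of_pos hσ.1]
          linarith [hσ.2]) 0 (left_mem_Icc.2 hτ.le) τ (right_mem_Icc.2 hτ.le) hτ.le
      simp only [zero_smul, add_zero, sub_zero] at this
      linarith [hle t]
    · have := (hball τ (by rw [Metric.mem_ball, Real.dist_eq, sub_zero, abs_of_pos hτ]; exact hτr)).2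
        t (mem_univ t)
      push Not at ht
      linarith

/-- **Mountain pass theorem**: almost critical points, in the sense of Cerami, at the mountain
pass level. -/
theorem exists_almost_critical_of_mountainPass [CompleteSpace E] {I : E → ℝ}
    {I' : E → E →L[ℝ] ℝ} (hI : ∀ u, HasFDerivAt I (I' u) u) (hI' : Continuous I') {x y : E} {c : ℝ}
    (hc : IsGLB (range fun p : Path x y => ⨆ t, I (p t)) c) (hx : I x < c) (hy : I y < c)
    {ε : ℝ} (hε : 0 < ε) : ∃ u, |I u - c| ≤ ε ∧ ‖I' u‖ * (1 + ‖u‖) < ε := by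
  by_contra! hcon
  have hIc : Continuous I := continuous_iff_continuousAt.2 fun u => (hI u).continuousAt
  set Φ : C(unitInterval, E) → ℝ := fun p => ⨆ t, I (p t) with hΦ
  have hΦc : Continuous Φ := continuous_iSup_comp hIc
  have hleΦ : ∀ (p : C(unitInterval, E)) t, I (p t) ≤ Φ p := fun p t =>
    le_ciSup (bddAbove_range_comp hIc p) t
  have hcΦ : ∀ p : C(unitInterval, E), p 0 = x → p 1 = y → c ≤ Φ p := fun p h0 h1 =>
    hc.1 ⟨⟨p, h0, h1⟩, rfl⟩
  obtain ⟨_, ⟨p₀, rfl⟩, -, hp₀⟩ := hc.exists_between (show c < c + ε by linarith)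
  -- An Ekeland-type relation: q is admissible from p if its displacement, measured relative to 1 +
  -- ‖p t‖, is paid for by a decrease of Φ.
  set S : C(unitInterval, E) → C(unitInterval, E) → Prop := fun p q => q 0 = p 0 ∧ q 1 = p 1 ∧
    ∀ t, ε / 8 * ‖q t - p t‖ ≤ (Φ p - Φ q) * (1 + ‖p t‖) with hS
  -- Each step realises at least half of the available decrease. Paths with wrong endpoints are sent
  -- to themselves as a dummy value.
  have hnext : ∀ p : C(unitInterval, E), ∃ q, (p 0 = x → p 1 = y → S p q) ∧
      (p 0 = x → p 1 = y → ∀ q', S p q' → Φ p - Φ q' ≤ 2 * (Φ p - Φ q)) := by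
    intro p
    by_cases hp : p 0 = x ∧ p 1 = y
    swap
    · exact ⟨p, fun h0 h1 => (hp ⟨h0, h1⟩).elim, fun h0 h1 => (hp ⟨h0, h1⟩).elim⟩
    have hne : (Φ '' {q | S p q}).Nonempty := ⟨_, p, ⟨rfl, rfl, fun t => by simp⟩, rfl⟩
    have hbd : BddBelow (Φ '' {q | S p q}) := ⟨c, by
      rintro _ ⟨q, hq, rfl⟩
      exact hcΦ q (hq.1.trans hp.1) (hq.2.1.trans hp.2)⟩
    have hm : sInf (Φ '' {q | S p q}) ≤ Φ p := csInf_le hbd ⟨p, ⟨rfl, rfl, fun t => by simp⟩, rfl⟩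
    rcases hm.eq_or_lt with hm | hm
    · refine ⟨p, fun _ _ => ⟨rfl, rfl, fun t => by simp⟩, fun _ _ q' hq' => ?_⟩
      have : Φ p ≤ Φ q' := hm ▸ csInf_le hbd ⟨q', hq', rfl⟩
      linarith
    · obtain ⟨_, ⟨q, hq, rfl⟩, hlt⟩ := exists_lt_of_csInf_lt hne
        (show sInf (Φ '' {q | S p q}) < (Φ p + sInf (Φ '' {q | S p q})) / 2 by linarith)
      refine ⟨q, fun _ _ => hq, fun _ _ q' hq' => ?_⟩
      have : sInf (Φ '' {q | S p q}) ≤ Φ q' := csInf_le hbd ⟨q', hq', rfl⟩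
      linarith
  choose nxt hnxt1 hnxt2 using hnext
  set P : ℕ → C(unitInterval, E) := fun n => nxt^[n] p₀.toContinuousMap with hP
  have hPs : ∀ n, P (n + 1) = nxt (P n) := fun n => Function.iterate_succ_apply' _ _ _
  have hPe : ∀ n, P n 0 = x ∧ P n 1 = y := by
    intro n
    induction n with
    | zero => exact ⟨p₀.source, p₀.target⟩
    | succ n ih =>
      rw [hPs]
      have := hnxt1 _ ih.1 ih.2
      exact ⟨this.1.trans ih.1, this.2.1.trans ih.2⟩
  have hstep : ∀ n t, ε / 8 * ‖P (n + 1) t - P n t‖ ≤ (Φ (P n) - Φ (P (n + 1))) * (1 + ‖P n t‖) :=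
    fun n t => by rw [hPs]; exact (hnxt1 _ (hPe n).1 (hPe n).2).2.2 t
  have hstep' : ∀ n t, ‖P (n + 1) t - P n t‖ ≤
      (Φ (P n) - Φ (P (n + 1))) / (ε / 8) * (1 + ‖P n t‖) := fun n t => by
    have := hstep n t
    rw [div_mul_eq_mul_div, le_div_iff₀ (by positivity)]
    linarith
  have hanti : Antitone fun n => Φ (P n) := antitone_nat_of_succ_le fun n => by
    have h := (norm_nonneg _).trans (hstep' n 0)
    have h2 : 0 ≤ (Φ (P n) - Φ (P (n + 1))) / (ε / 8) := nonneg_of_mul_nonneg_left h (by positivity)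
    have h3 := (div_nonneg_iff.1 h2)
    rcases h3 with h3 | h3
    · linarith [h3.1]
    · linarith [h3.2]
  have hcP : ∀ n, c ≤ Φ (P n) := fun n => hcΦ _ (hPe n).1 (hPe n).2
  -- A discrete Gronwall argument: the factors 1 + d are bounded by exp d and the exponents
  -- telescope. Since Φ ≥ c, the iterates remain in a bounded set, where the weight is harmless and
  -- the sequence is Cauchy.
  have hgrow : ∀ n t, 1 + ‖P n t‖ ≤ Real.exp ((Φ (P 0) - Φ (P n)) / (ε / 8)) * (1 + ‖P 0 t‖) := by
    intro n t
    induction n with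
    | zero => simp
    | succ n ih =>
      set d := (Φ (P n) - Φ (P (n + 1))) / (ε / 8) with hd
      have e1 : 1 + ‖P (n + 1) t‖ ≤ (1 + d) * (1 + ‖P n t‖) := by
        have := norm_le_norm_add_norm_sub (P n t) (P (n + 1) t)
        rw [norm_sub_rev] at this
        have h2 := hstep' n t
        rw [← hd] at h2
        linarith
      have e2 : 1 + d ≤ Real.exp d := by linarith [Real.add_one_le_exp d]
      calc 1 + ‖P (n + 1) t‖ ≤ (1 + d) * (1 + ‖P n t‖) := e1
        _ ≤ Real.exp d * (1 + ‖P n t‖) := by gcongr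
        _ ≤ Real.exp d * (Real.exp ((Φ (P 0) - Φ (P n)) / (ε / 8)) * (1 + ‖P 0 t‖)) := by gcongr
        _ = _ := by
          rw [← mul_assoc, ← Real.exp_add]
          congr 2
          rw [hd]; ring
  set R : ℝ := Real.exp ((Φ (P 0) - c) / (ε / 8)) * (1 + ‖P 0‖) with hR
  have hRb : ∀ n t, 1 + ‖P n t‖ ≤ R := fun n t => (hgrow n t).trans (by
    rw [hR]
    gcongr
    · exact hcP n
    · exact (P 0).norm_coe_le_norm t)
  have hdist : ∀ n, dist (P n) (P n.succ) ≤ (Φ (P n) - Φ (P (n + 1))) / (ε / 8) * R := fun n => by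
    have hnn : 0 ≤ (Φ (P n) - Φ (P (n + 1))) / (ε / 8) :=
      div_nonneg (sub_nonneg.2 (hanti n.le_succ)) (by positivity)
    have hR0 : 0 ≤ R := by positivity
    rw [dist_comm, ContinuousMap.dist_le (by positivity)]
    intro t
    rw [dist_eq_norm]
    exact (hstep' n t).trans (by gcongr; exact hRb n t)
  have hsum : Summable fun n => (Φ (P n) - Φ (P (n + 1))) / (ε / 8) * R := by
    refine Summable.mul_right _ (Summable.div_const ?_ _)
    refine summable_of_sum_range_le (c := Φ (P 0) - c)
      (fun n => sub_nonneg.2 (hanti n.le_succ)) fun n => ?_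
    rw [Finset.sum_range_sub' (fun n => Φ (P n))]
    linarith [hcP n]
  obtain ⟨p, hp⟩ := cauchySeq_tendsto_of_complete (cauchySeq_of_dist_le_of_summable _ hdist hsum)
  have hev : ∀ t, Tendsto (fun n => P n t) atTop (𝓝 (p t)) := fun t =>
    ((continuous_eval_const t).tendsto p).comp hp
  have hp0 : p 0 = x := tendsto_nhds_unique (hev 0) (by simp [hPe])
  have hp1 : p 1 = y := tendsto_nhds_unique (hev 1) (by simp [hPe])
  have hΦp : Tendsto (fun n => Φ (P n)) atTop (𝓝 (Φ p)) := (hΦc.tendsto p).comp hp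
  have hΦle : ∀ n, Φ p ≤ Φ (P n) := fun n => hanti.le_of_tendsto hΦp n
  have hcp : c ≤ Φ p := hcΦ p hp0 hp1
  have hpε : Φ p < c + ε := (hΦle 0).trans_lt hp₀
  -- Taking κ ≤ ε keeps the band Φ p - κ ≤ I ≤ Φ p within ε of c, where the contradiction hypothesis
  -- applies. The half gaps put both endpoints strictly below the band.
  set κ := min ε (min ((c - I x) / 2) ((c - I y) / 2)) with hκ
  have hκ0 : 0 < κ := by
    have : 0 < c - I x := by linarith
    have : 0 < c - I y := by linarith
    positivity
  have hκ1 : κ ≤ (c - I x) / 2 := (min_le_right _ _).trans (min_le_left _ _)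
  have hκ2 : κ ≤ (c - I y) / 2 := (min_le_right _ _).trans (min_le_right _ _)
  have hκ3 : κ ≤ ε := min_le_left _ _
  obtain ⟨τ, hτ, q, hq0, hq1, hqd, hqI⟩ := exists_path_descent hI hI' (p := p) (M := Φ p) hκ0 hε
    (hleΦ p) (by rw [hp0]; linarith) (by rw [hp1]; linarith) (fun t ht => by
      refine hcon _ ?_
      rw [abs_le]
      constructor <;> linarith [hleΦ p t])
  have hΦq : Φ q ≤ Φ p - τ * ε / 4 := ciSup_le hqI
  have ev1 : ∀ᶠ n in atTop, (ε * τ / 8 + ε / 8) * dist (P n) p < ε * τ / 8 := by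
    have : Tendsto (fun n => (ε * τ / 8 + ε / 8) * dist (P n) p) atTop (𝓝 0) := by
      simpa using (tendsto_iff_dist_tendsto_zero.1 hp).const_mul (ε * τ / 8 + ε / 8)
    exact this.eventually_lt_const (by positivity)
  have ev2 : ∀ᶠ n in atTop, Φ (P n) < Φ p + τ * ε / 8 :=
    hΦp.eventually_lt_const (by linarith [mul_pos hτ hε])
  obtain ⟨n, hn1, hn2⟩ := (ev1.and ev2).exists
  have hSn : S (P n) q := by
    refine ⟨by rw [hq0, hp0, (hPe n).1], by rw [hq1, hp1, (hPe n).2], fun t => ?_⟩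
    have hd : ‖p t - P n t‖ ≤ dist (P n) p := by
      rw [← dist_eq_norm, dist_comm]
      exact ContinuousMap.dist_apply_le_dist t
    have e1 : ‖q t - P n t‖ ≤ ‖q t - p t‖ + ‖p t - P n t‖ := norm_sub_le_norm_sub_add_norm_sub _ _ _
    have e2 : ‖p t‖ ≤ ‖P n t‖ + ‖p t - P n t‖ := by
      have := norm_le_norm_add_norm_sub (P n t) (p t)
      rwa [norm_sub_rev] at this
    calc ε / 8 * ‖q t - P n t‖ ≤ ε / 8 * (τ * (1 + ‖p t‖) + dist (P n) p) := by
          gcongr; linarith [hqd t]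
      _ ≤ ε / 8 * (τ * (1 + (‖P n t‖ + dist (P n) p)) + dist (P n) p) := by
          gcongr; linarith
      _ = ε * τ / 8 * (1 + ‖P n t‖) + (ε * τ / 8 + ε / 8) * dist (P n) p := by ring
      _ ≤ ε * τ / 8 * (1 + ‖P n t‖) + ε * τ / 8 * (1 + ‖P n t‖) := by
          have : ε * τ / 8 * 1 ≤ ε * τ / 8 * (1 + ‖P n t‖) := by
            gcongr; exact le_add_of_nonneg_right (norm_nonneg _)
          linarith
      _ = τ * ε / 4 * (1 + ‖P n t‖) := by ring
      _ ≤ (Φ (P n) - Φ q) * (1 + ‖P n t‖) := by gcongr; linarith [hΦle n]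
  -- The deformed path q is admissible from P n, so Φ(P n) - Φ q is at most twice the decrease of
  -- step n, hence less than τε/4. It is also at least τε/4, a contradiction.
  have hfin := hnxt2 _ (hPe n).1 (hPe n).2 q hSn
  rw [← hPs] at hfin
  linarith [hΦle n, hΦle (n + 1), mul_pos hτ hε]

end MountainPass

/-! ## Superposition operators between Lebesgue spaces of a finite measure -/

section Superposition

variable {α : Type*} [MeasurableSpace α] {μ : Measure α} [IsFiniteMeasure μ]

/-- `φ` has growth at most `1 + |t| ^ m`. -/
def PowerGrowth (φ : ℝ → ℝ) (m : ℝ) : Prop := ∃ C, 0 ≤ C ∧ ∀ t, |φ t| ≤ C * (1 + |t| ^ m)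

/-- By Hölder, the L^q norm over a set s is at most M μ(s)^(1/q - 1/r), and the exponent is positive
because q < r. -/
lemma unifIntegrable_of_eLpNorm_le {ι : Type*} {q r : ENNReal} (hq : q ≠ 0) (hqr : q < r)
    {f : ι → α → ℝ} (hf : ∀ i, AEStronglyMeasurable (f i) μ) {M : ENNReal} (hM : M ≠ ⊤)
    (h : ∀ i, eLpNorm (f i) r μ ≤ M) : UnifIntegrable f q μ := by
  intro ε hε
  have hqtop : q ≠ ⊤ := ne_top_of_lt hqr
  set e : ℝ := 1 / q.toReal - 1 / r.toReal with he
  have hq0 : 0 < q.toReal := ENNReal.toReal_pos hq hqtop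
  have he0 : 0 < e := by
    rw [he, sub_pos]
    rcases eq_or_ne r ⊤ with rfl | hr
    · simpa using hq0
    · exact one_div_lt_one_div_of_lt hq0 ((ENNReal.toReal_lt_toReal hqtop hr).2 hqr)
  set m : ℝ := M.toReal + 1 with hm
  have hm0 : 0 < m := by positivity
  refine ⟨(ε / m) ^ (1 / e), by positivity, fun i s hs hμs => ?_⟩
  rw [eLpNorm_indicator_eq_eLpNorm_restrict hs]
  calc eLpNorm (f i) q (μ.restrict s)
      ≤ eLpNorm (f i) r (μ.restrict s) * (μ.restrict s) univ ^ e :=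
        eLpNorm_le_eLpNorm_mul_rpow_measure_univ hqr.le (hf i).restrict
    _ ≤ ENNReal.ofReal m * ENNReal.ofReal ((ε / m) ^ (1 / e)) ^ e := by
        gcongr
        · calc eLpNorm (f i) r (μ.restrict s) ≤ eLpNorm (f i) r μ :=
                eLpNorm_mono_measure _ Measure.restrict_le_self
            _ ≤ M := h i
            _ = ENNReal.ofReal M.toReal := (ENNReal.ofReal_toReal hM).symm
            _ ≤ ENNReal.ofReal m := ENNReal.ofReal_le_ofReal (by linarith)
        · rwa [Measure.restrict_apply_univ]
    _ = ENNReal.ofReal ε := by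
        rw [ENNReal.ofReal_rpow_of_nonneg (by positivity) he0.le, ← Real.rpow_mul (by positivity),
          one_div_mul_cancel he0.ne', Real.rpow_one, ← ENNReal.ofReal_mul hm0.le]
        congr 1
        field_simp

lemma eLpNorm_comp_le {φ : ℝ → ℝ} {m p C : ℝ} (hm : 0 < m) (hmp : m ≤ p) (hC : 0 ≤ C)
    (hφ : ∀ t, |φ t| ≤ C * (1 + |t| ^ m)) {v : α → ℝ} (hv : AEStronglyMeasurable v μ) :
    eLpNorm (fun x => φ (v x)) (ENNReal.ofReal (p / m)) μ ≤ ENNReal.ofReal C *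
      (eLpNorm (fun _ => (1 : ℝ)) (ENNReal.ofReal (p / m)) μ
        + eLpNorm v (ENNReal.ofReal p) μ ^ m) := by
  have h1 : (1 : ENNReal) ≤ ENNReal.ofReal (p / m) := by
    rwa [ENNReal.one_le_ofReal, one_le_div hm]
  have e1 : eLpNorm (fun x => ‖v x‖ ^ m) (ENNReal.ofReal (p / m)) μ
      = eLpNorm v (ENNReal.ofReal p) μ ^ m := by
    rw [eLpNorm_norm_rpow _ hm, ← ENNReal.ofReal_mul (div_nonneg (hm.le.trans hmp) hm.le),
      div_mul_cancel₀ _ hm.ne']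
  calc eLpNorm (fun x => φ (v x)) (ENNReal.ofReal (p / m)) μ
      ≤ eLpNorm (C • ((fun _ => (1 : ℝ)) + fun x => ‖v x‖ ^ m)) (ENNReal.ofReal (p / m)) μ :=
        eLpNorm_mono_real fun x => by simpa using hφ (v x)
    _ ≤ ENNReal.ofReal C * eLpNorm ((fun _ => (1 : ℝ)) + fun x => ‖v x‖ ^ m)
          (ENNReal.ofReal (p / m)) μ := by
        rw [eLpNorm_const_smul, ← ofReal_norm, Real.norm_of_nonneg hC]
    _ ≤ _ := by
        rw [← e1]
        gcongr
        exact eLpNorm_add_le aestronglyMeasurable_const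
          ((hv.norm.aemeasurable.pow_const m).aestronglyMeasurable) h1

lemma MemLp.comp_of_powerGrowth {φ : ℝ → ℝ} (hφc : Continuous φ) {m p : ℝ} (hm : 0 < m)
    (hmp : m ≤ p) (hφ : PowerGrowth φ m) {v : α → ℝ} (hv : MemLp v (ENNReal.ofReal p) μ) :
    MemLp (fun x => φ (v x)) (ENNReal.ofReal (p / m)) μ := by
  obtain ⟨C, hC, hφ⟩ := hφ
  refine ⟨hφc.comp_aestronglyMeasurable hv.1, (eLpNorm_comp_le hm hmp hC hφ hv.1).trans_lt ?_⟩
  have h1 : eLpNorm (fun _ => (1 : ℝ)) (ENNReal.ofReal (p / m)) μ < ⊤ := (memLp_const (1 : ℝ)).2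
  have h2 := hv.2
  exact ENNReal.mul_lt_top ENNReal.ofReal_lt_top
    (ENNReal.add_lt_top.2 ⟨h1, ENNReal.rpow_lt_top_of_nonneg hm.le h2.ne⟩)

/-- Fatou's lemma for the L^p norm. -/
lemma memLp_of_ae_tendsto_of_eLpNorm_le {p : ENNReal} {v : ℕ → α → ℝ} {w : α → ℝ}
    (hv : ∀ n, AEStronglyMeasurable (v n) μ) {M : ENNReal} (hM : M ≠ ⊤)
    (hb : ∀ n, eLpNorm (v n) p μ ≤ M)
    (h : ∀ᵐ x ∂μ, Tendsto (fun n => v n x) atTop (𝓝 (w x))) : MemLp w p μ :=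
  ⟨aestronglyMeasurable_of_tendsto_ae _ hv h,
    ((Lp.eLpNorm_lim_le_liminf_eLpNorm hv w h).trans
      (liminf_le_of_le (by isBoundedDefault) fun b hb' => by
        obtain ⟨n, hn⟩ := hb'.exists
        exact hn.trans (hb n))).trans_lt hM.lt_top⟩

/-- Superposition operators of subcritical growth turn bounded almost everywhere convergence into
norm convergence. -/
lemma tendsto_eLpNorm_comp_sub {φ : ℝ → ℝ} (hφc : Continuous φ) {m p : ℝ} (hm : 0 < m)
    (hφ : PowerGrowth φ m) {q : ENNReal} (hq : 1 ≤ q) (hqp : q < ENNReal.ofReal (p / m))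
    {v : ℕ → α → ℝ} {w : α → ℝ}
    (hv : ∀ n, AEStronglyMeasurable (v n) μ) {M : ENNReal} (hM : M ≠ ⊤)
    (hb : ∀ n, eLpNorm (v n) (ENNReal.ofReal p) μ ≤ M)
    (h : ∀ᵐ x ∂μ, Tendsto (fun n => v n x) atTop (𝓝 (w x))) :
    Tendsto (fun n => eLpNorm ((fun x => φ (v n x)) - fun x => φ (w x)) q μ) atTop (𝓝 0) := by
  have h1 : 1 ≤ p / m := by
    rw [← ENNReal.one_le_ofReal]; exact hq.trans hqp.le
  have hmp : m ≤ p := by rwa [one_le_div hm] at h1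
  have hw := memLp_of_ae_tendsto_of_eLpNorm_le hv hM hb h
  have hφw := (MemLp.comp_of_powerGrowth hφc hm hmp hφ hw).mono_exponent hqp.le
  obtain ⟨C, hC, hφ⟩ := hφ
  -- Vitali's theorem: φ(v n) is bounded in L^(p/m), and the gap q < p/m supplies uniform
  -- integrability in L^q.
  refine tendsto_Lp_finite_of_tendsto_ae hq (ne_top_of_lt hqp)
    (fun n => hφc.comp_aestronglyMeasurable (hv n)) hφw
    (unifIntegrable_of_eLpNorm_le (r := ENNReal.ofReal (p / m)) (M := ENNReal.ofReal C *
      (eLpNorm (fun _ => (1 : ℝ)) (ENNReal.ofReal (p / m)) μ + M ^ m))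
      (zero_lt_one.trans_le hq).ne' hqp
      (fun n => hφc.comp_aestronglyMeasurable (hv n)) ?_ fun n => ?_) ?_
  · have h1 : eLpNorm (fun _ => (1 : ℝ)) (ENNReal.ofReal (p / m)) μ < ⊤ := (memLp_const (1 : ℝ)).2
    exact (ENNReal.mul_lt_top ENNReal.ofReal_lt_top
      (ENNReal.add_lt_top.2 ⟨h1, ENNReal.rpow_lt_top_of_nonneg hm.le hM⟩)).ne
  · refine (eLpNorm_comp_le hm hmp hC hφ (hv n)).trans ?_
    gcongr
    exact hb n
  · filter_upwards [h] with x hx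
    exact (hφc.tendsto _).comp hx

lemma integrable_comp_of_powerGrowth {φ : ℝ → ℝ} (hφc : Continuous φ) {m p : ℝ} (hm : 0 < m)
    (hmp : m ≤ p) (hφ : PowerGrowth φ m) {v : α → ℝ} (hv : MemLp v (ENNReal.ofReal p) μ) :
    Integrable (fun x => φ (v x)) μ :=
  (MemLp.comp_of_powerGrowth hφc hm hmp hφ hv).integrable
    (by rwa [ENNReal.one_le_ofReal, one_le_div hm])

lemma tendsto_integral_comp {φ : ℝ → ℝ} (hφc : Continuous φ) {m p : ℝ} (hm : 0 < m)
    (hφ : PowerGrowth φ m) (hmp : m < p)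
    {v : ℕ → α → ℝ} {w : α → ℝ}
    (hv : ∀ n, AEStronglyMeasurable (v n) μ) {M : ENNReal} (hM : M ≠ ⊤)
    (hb : ∀ n, eLpNorm (v n) (ENNReal.ofReal p) μ ≤ M)
    (h : ∀ᵐ x ∂μ, Tendsto (fun n => v n x) atTop (𝓝 (w x))) :
    Tendsto (fun n => ∫ x, φ (v n x) ∂μ) atTop (𝓝 (∫ x, φ (w x) ∂μ)) := by
  have hlt : 1 < ENNReal.ofReal (p / m) := by
    rwa [ENNReal.one_lt_ofReal, one_lt_div hm]
  have hmem : ∀ n, MemLp (v n) (ENNReal.ofReal p) μ := fun n => ⟨hv n, (hb n).trans_lt hM.lt_top⟩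
  refine tendsto_integral_of_L1' _
    (integrable_comp_of_powerGrowth hφc hm hmp.le hφ
      (memLp_of_ae_tendsto_of_eLpNorm_le hv hM hb h)).aestronglyMeasurable
    (Eventually.of_forall fun n => integrable_comp_of_powerGrowth hφc hm hmp.le hφ (hmem n)) ?_
  exact tendsto_eLpNorm_comp_sub hφc hm hφ le_rfl hlt hv hM hb h

end Superposition

lemma PowerGrowth.primitive {f F : ℝ → ℝ} {m : ℝ} (hf : PowerGrowth f m) (hm : 0 ≤ m)
    (hF : ∀ t, HasDerivAt F (f t) t) (hF0 : F 0 = 0) : PowerGrowth F (m + 1) := by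
  obtain ⟨C, hC, h⟩ := hf
  refine ⟨2 * C, by positivity, fun t => ?_⟩
  have hb := (convex_Icc (-|t|) |t|).norm_image_sub_le_of_norm_hasDerivWithin_le (f := F)
    (C := C * (1 + |t| ^ m)) (x := 0) (y := t)
    (fun x _ => (hF x).hasDerivWithinAt) (fun x hx => ?_)
    ⟨by simp, by simp⟩ ⟨neg_abs_le t, le_abs_self t⟩
  · rw [hF0, sub_zero, sub_zero, Real.norm_eq_abs, Real.norm_eq_abs] at hb
    have e1 : |t| ^ m * |t| = |t| ^ (m + 1) := by
      rcases (abs_nonneg t).eq_or_lt with h0 | h0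
      · rw [← h0, mul_zero, Real.zero_rpow (by linarith)]
      · rw [← Real.rpow_add_one h0.ne']
    have e2 : |t| ≤ 1 + |t| ^ (m + 1) := by
      rcases le_total |t| 1 with h1 | h1
      · linarith [Real.rpow_nonneg (abs_nonneg t) (m + 1)]
      · have := Real.rpow_le_rpow_of_exponent_le h1 (show 1 ≤ m + 1 by linarith)
        rw [Real.rpow_one] at this
        linarith
    calc |F t| ≤ C * (1 + |t| ^ m) * |t| := hb
      _ = C * (|t| + |t| ^ (m + 1)) := by rw [← e1]; ring
      _ ≤ C * (2 * (1 + |t| ^ (m + 1))) := by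
        gcongr
        linarith
      _ = _ := by ring
  · refine (h x).trans ?_
    have : |x| ≤ |t| := abs_le.2 hx
    gcongr

/-! ## Continuous Gâteaux derivatives -/

/-- Apply the mean value inequality on [0,1] to θ ↦ K(u + θh) - θK'(u)h. Its derivative is at most
‖K'(u + θh) - K'(u)‖‖h‖, which continuity of K' makes o(‖h‖). -/
lemma hasFDerivAt_of_hasDerivAt_line {E : Type*} [NormedAddCommGroup E] [NormedSpace ℝ E]
    {K : E → ℝ} {K' : E → E →L[ℝ] ℝ} (hK : ∀ u v : E, ∀ θ : ℝ,
      HasDerivAt (fun θ : ℝ => K (u + θ • v)) (K' (u + θ • v) v) θ) (hK' : Continuous K') (u : E) :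
    HasFDerivAt K (K' u) u := by
  rw [hasFDerivAt_iff_isLittleO_nhds_zero, Asymptotics.isLittleO_iff]
  intro ε hε
  have hev : ∀ᶠ w in 𝓝 u, ‖K' w - K' u‖ < ε := by
    have : Tendsto (fun w => ‖K' w - K' u‖) (𝓝 u) (𝓝 0) := by
      have := ((hK'.sub continuous_const).norm.tendsto u : Tendsto (fun w => ‖K' w - K' u‖) _ _)
      simpa using this
    exact this.eventually_lt_const hε
  obtain ⟨r, hr, hball⟩ := Metric.eventually_nhds_iff_ball.1 hev
  filter_upwards [Metric.ball_mem_nhds (0 : E) hr] with h hh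
  have hd : ∀ θ : ℝ, HasDerivAt (fun θ : ℝ => K (u + θ • h) - θ * K' u h)
      (K' (u + θ • h) h - K' u h) θ := fun θ => by
    simpa using (hK u h θ).fun_sub ((hasDerivAt_id' θ).mul_const (K' u h))
  have := norm_image_sub_le_of_norm_deriv_le_segment_01' (C := ε * ‖h‖)
    (fun θ _ => (hd θ).hasDerivWithinAt) (fun θ hθ => ?_)
  · simp only [one_smul, one_mul, zero_smul, zero_mul, add_zero, sub_zero] at this
    rwa [sub_right_comm]
  · have hmem : u + θ • h ∈ Metric.ball u r := by
      rw [Metric.mem_ball, dist_eq_norm, add_sub_cancel_left, norm_smul, Real.norm_of_nonneg hθ.1]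
      have : ‖h‖ < r := by simpa using hh
      nlinarith [hθ.2, norm_nonneg h]
    exact ((K' (u + θ • h) - K' u).le_opNorm h).trans (by gcongr; exact (hball _ hmem).le)

/-! ## The variational framework -/

instance fact_one_le_ofReal {p : ℝ} [h : Fact (1 < p)] : Fact (1 ≤ ENNReal.ofReal p) :=
  ⟨ENNReal.one_le_ofReal.2 h.out.le⟩

instance fact_one_le_ofReal_conjExponent {p : ℝ} [h : Fact (1 < p)] :
    Fact (1 ≤ ENNReal.ofReal p.conjExponent) :=
  ⟨ENNReal.one_le_ofReal.2 (Real.HolderConjugate.conjExponent h.out).symm.lt.le⟩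

instance holderConjugate_ofReal_conjExponent {p : ℝ} [h : Fact (1 < p)] :
    ENNReal.HolderConjugate (ENNReal.ofReal p.conjExponent) (ENNReal.ofReal p) :=
  (Real.HolderConjugate.conjExponent h.out).symm.ennrealOfReal

/-- A Banach space with an equivalent inner product `form`, mapped compactly (in the sense of
almost everywhere convergence of subsequences) into functions of `L^p(μ)`, in which negative parts
can be truncated. -/
structure EnergySpace (E : Type*) [NormedAddCommGroup E] [NormedSpace ℝ E] {α : Type*}
    [MeasurableSpace α] (μ : Measure α) (p : ℝ) [Fact (1 < p)] where
  /-- the inner product -/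
  form : E →L[ℝ] E →L[ℝ] ℝ
  form_symm : ∀ u v, form u v = form v u
  /-- the coercivity constant -/
  lower : ℝ
  lower_pos : 0 < lower
  le_form : ∀ u, lower * ‖u‖ ^ 2 ≤ form u u
  /-- the embedding into `L^p` -/
  emb : E →L[ℝ] Lp ℝ (ENNReal.ofReal p) μ
  exists_ae_tendsto : ∀ (w : ℕ → E) (M : ℝ), (∀ n, ‖w n‖ ≤ M) → ∃ k : ℕ → ℕ, StrictMono k ∧
    ∃ v : α → ℝ, ∀ᵐ x ∂μ, Tendsto (fun n => emb (w (k n)) x) atTop (𝓝 (v x))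
  exists_trunc : ∃ D : Set E, Dense D ∧ ∀ u ∈ D, ∃ v,
    (∀ᵐ x ∂μ, emb v x ≤ emb u x + 1 ∧ (emb v x = 0 ∨ emb u x ≤ 0)) ∧ form v v ≤ form u v

/-- The superlinear subcritical nonlinearities `f`, with primitive `F`, vanishing on the negative
half-line. -/
structure IsNonlinearity (p γ : ℝ) (f F : ℝ → ℝ) : Prop where
  two_lt : 2 < γ
  lt_crit : γ < p
  cont : Continuous f
  hasDerivAt : ∀ t, HasDerivAt F (f t) t
  zero_of_nonpos : ∀ t ≤ 0, f t = 0
  prim_zero_of_nonpos : ∀ t ≤ 0, F t = 0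
  growth : PowerGrowth f (γ - 1)
  prim_le : ∀ ε > 0, ∃ C ≥ 0, ∀ t, F t ≤ ε * t ^ 2 + C * |t| ^ γ
  superlinear : ∀ M, ∃ C ≥ 0, ∀ t ≥ 0, M * t ^ 2 - C ≤ F t
  quasi_mono : ∃ C ≥ 0, ∀ t θ, 0 ≤ θ → θ ≤ 1 →
    θ * t * f (θ * t) - 2 * F (θ * t) ≤ t * f t - 2 * F t + C

/-! ### Differentiability of the energy functional. -/

namespace EnergySpace

variable {E : Type*} [NormedAddCommGroup E] [NormedSpace ℝ E] {α : Type*}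
    [MeasurableSpace α] {μ : Measure α} [IsFiniteMeasure μ] {p : ℝ} [Fact (1 < p)]
    (S : EnergySpace E μ p) {γ : ℝ} {f F : ℝ → ℝ}

lemma _root_.IsNonlinearity.cont_prim (hf : IsNonlinearity p γ f F) : Continuous F :=
  continuous_iff_continuousAt.2 fun t => (hf.hasDerivAt t).continuousAt

lemma _root_.IsNonlinearity.growth_prim (hf : IsNonlinearity p γ f F) : PowerGrowth F γ := by
  have := hf.growth.primitive (by linarith [hf.two_lt]) hf.hasDerivAt
    (hf.prim_zero_of_nonpos 0 le_rfl)
  rwa [sub_add_cancel] at this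

/-- This is where subcriticality γ < p enters: f(u) lies in L^(p/(γ-1)), strictly better than the
L^(p') needed for the pairing with L^p. The strict gap is the source of compactness. -/
lemma _root_.IsNonlinearity.conjExponent_lt (hf : IsNonlinearity p γ f F) :
    ENNReal.ofReal p.conjExponent < ENNReal.ofReal (p / (γ - 1)) := by
  have h1 := hf.two_lt
  have h2 := hf.lt_crit
  rw [ENNReal.ofReal_lt_ofReal_iff (div_pos (by linarith) (by linarith)), Real.conjExponent]
  exact div_lt_div_of_pos_left (by linarith) (by linarith) (by linarith)

lemma memLp_comp (hf : IsNonlinearity p γ f F) {v : α → ℝ} (hv : MemLp v (ENNReal.ofReal p) μ) :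
    MemLp (fun x => f (v x)) (ENNReal.ofReal p.conjExponent) μ :=
  (MemLp.comp_of_powerGrowth hf.cont (by linarith [hf.two_lt])
    (by linarith [hf.lt_crit]) hf.growth hv).mono_exponent hf.conjExponent_lt.le

/-- The pairing of `L^{p'}(μ)` with the energy space. -/
def pair : Lp ℝ (ENNReal.ofReal p.conjExponent) μ →L[ℝ] E →L[ℝ] ℝ :=
  (ContinuousLinearMap.compL ℝ E (Lp ℝ (ENNReal.ofReal p) μ) ℝ).flip S.emb ∘L
    (ContinuousLinearMap.mul ℝ ℝ).lpPairing μ (ENNReal.ofReal p.conjExponent) (ENNReal.ofReal p)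

lemma pair_apply (h : Lp ℝ (ENNReal.ofReal p.conjExponent) μ) (v : E) :
    S.pair h v = ∫ x, h x * S.emb v x ∂μ := by
  simp [pair, ContinuousLinearMap.lpPairing_eq_integral]

/-- The functional `u ↦ ∫ u dμ`. -/
def mass : E →L[ℝ] ℝ := S.pair ((memLp_const (1 : ℝ)).toLp _)

lemma mass_apply (u : E) : S.mass u = ∫ x, S.emb u x ∂μ := by
  rw [mass, pair_apply]
  refine integral_congr_ae ?_
  filter_upwards [(memLp_const (1 : ℝ)).coeFn_toLp (μ := μ)
    (p := ENNReal.ofReal p.conjExponent)] with x hx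
  rw [hx, one_mul]

/-- The derivative of `u ↦ ∫ F(u) dμ`. -/
def dPot (hf : IsNonlinearity p γ f F) (u : E) : E →L[ℝ] ℝ :=
  S.pair ((memLp_comp hf (Lp.memLp (S.emb u))).toLp _)

lemma dPot_apply (hf : IsNonlinearity p γ f F) (u v : E) :
    S.dPot hf u v = ∫ x, f (S.emb u x) * S.emb v x ∂μ := by
  rw [dPot, pair_apply]
  refine integral_congr_ae ?_
  filter_upwards [(memLp_comp hf (Lp.memLp (S.emb u))).coeFn_toLp] with x hx
  rw [hx]

lemma integrable_dPot (hf : IsNonlinearity p γ f F) (u v : E) :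
    Integrable (fun x => f (S.emb u x) * S.emb v x) μ :=
  (memLp_comp hf (Lp.memLp (S.emb u))).integrable_mul (Lp.memLp (S.emb v))

variable (F) in
/-- The potential energy `u ↦ ∫ F(u) dμ`. -/
def pot (u : E) : ℝ := ∫ x, F (S.emb u x) ∂μ

lemma integrable_pot (hf : IsNonlinearity p γ f F) (u : E) :
    Integrable (fun x => F (S.emb u x)) μ :=
  integrable_comp_of_powerGrowth hf.cont_prim (by linarith [hf.two_lt]) hf.lt_crit.le
    hf.growth_prim (Lp.memLp (S.emb u))

lemma eLpNorm_emb_le {M : ℝ} {u : E} (hu : ‖u‖ ≤ M) :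
    eLpNorm (S.emb u) (ENNReal.ofReal p) μ ≤ ENNReal.ofReal (‖S.emb‖ * M) := by
  rw [← Lp.enorm_def, ← ofReal_norm]
  exact ENNReal.ofReal_le_ofReal ((S.emb.le_opNorm u).trans (by gcongr))

/-- Bounded a.e. convergence gives f(w_n) → f(v) in L^(p'), hence convergence of the derivatives in
dual norm. The limit v need not come from an element of E, which avoids weak limits in the energy
space. -/
lemma tendsto_dPot (hf : IsNonlinearity p γ f F) {w : ℕ → E} {M : ℝ} (hM : ∀ n, ‖w n‖ ≤ M)
    {v : α → ℝ} (h : ∀ᵐ x ∂μ, Tendsto (fun n => S.emb (w n) x) atTop (𝓝 (v x)))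
    (hv : MemLp v (ENNReal.ofReal p) μ) :
    Tendsto (fun n => S.dPot hf (w n)) atTop (𝓝 (S.pair ((memLp_comp hf hv).toLp _))) := by
  refine (S.pair.continuous.tendsto _).comp ?_
  rw [Lp.tendsto_Lp_iff_tendsto_eLpNorm'']
  exact tendsto_eLpNorm_comp_sub hf.cont (by linarith [hf.two_lt]) hf.growth
    (Fact.out : 1 ≤ ENNReal.ofReal p.conjExponent) hf.conjExponent_lt
    (fun n => (Lp.aestronglyMeasurable _)) ENNReal.ofReal_ne_top
    (fun n => S.eLpNorm_emb_le (hM n)) h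

lemma memLp_of_ae_tendsto {w : ℕ → E} {M : ℝ} (hM : ∀ n, ‖w n‖ ≤ M) {v : α → ℝ}
    (h : ∀ᵐ x ∂μ, Tendsto (fun n => S.emb (w n) x) atTop (𝓝 (v x))) :
    MemLp v (ENNReal.ofReal p) μ :=
  memLp_of_ae_tendsto_of_eLpNorm_le (fun _ => Lp.aestronglyMeasurable _)
    (ENNReal.ofReal_ne_top) (fun n => S.eLpNorm_emb_le (hM n)) h

/-- Norm convergence in E gives a.e. convergence only along subsequences. This suffices, because
every subsequence has a further one along which the derivatives tend to the same limit. -/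
lemma continuous_dPot (hf : IsNonlinearity p γ f F) : Continuous (S.dPot hf) := by
  rw [continuous_iff_seqContinuous]
  intro w u hw
  refine tendsto_of_subseq_tendsto fun ns hns => ?_
  have hw' := hw.comp hns
  obtain ⟨M, hM⟩ := hw'.norm.bddAbove_range
  obtain ⟨ms, -, hms⟩ := (tendstoInMeasure_of_tendsto_Lp
    ((S.emb.continuous.tendsto u).comp hw')).exists_seq_tendsto_ae
  exact ⟨ms, S.tendsto_dPot hf (fun n => hM ⟨ms n, rfl⟩) hms (Lp.memLp _)⟩

lemma hasDerivAt_pot_line (hf : IsNonlinearity p γ f F) (u v : E) (θ : ℝ) :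
    HasDerivAt (fun θ : ℝ => S.pot F (u + θ • v)) (S.dPot hf (u + θ • v) v) θ := by
  have hγ := hf.two_lt
  have hcoe : ∀ θ : ℝ, ∀ᵐ x ∂μ, S.emb (u + θ • v) x = S.emb u x + θ * S.emb v x := fun θ => by
    rw [map_add, map_smul]
    filter_upwards [Lp.coeFn_add (S.emb u) (θ • S.emb v), Lp.coeFn_smul θ (S.emb v)] with x h1 h2
    rw [h1, Pi.add_apply, h2, Pi.smul_apply, smul_eq_mul]
  have e1 : (fun θ : ℝ => S.pot F (u + θ • v))
      = fun θ => ∫ x, F (S.emb u x + θ * S.emb v x) ∂μ := by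
    funext θ
    refine integral_congr_ae ?_
    filter_upwards [hcoe θ] with x hx
    rw [hx]
  have e2 : S.dPot hf (u + θ • v) v = ∫ x, f (S.emb u x + θ * S.emb v x) * S.emb v x ∂μ := by
    rw [dPot_apply]
    refine integral_congr_ae ?_
    filter_upwards [hcoe θ] with x hx
    rw [hx]
  rw [e1, e2]
  have hum := Lp.memLp (S.emb u)
  have hvm := Lp.memLp (S.emb v)
  have hlin : ∀ θ : ℝ, MemLp (fun x => S.emb u x + θ * S.emb v x) (ENNReal.ofReal p) μ :=
    fun θ => hum.add (hvm.const_mul θ)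
  obtain ⟨C, hC, hgr⟩ := hf.growth
  set ψ : ℝ → ℝ := fun t => C * (1 + |t| ^ (γ - 1)) with hψ
  have hψc : Continuous ψ := by
    have : Continuous fun t : ℝ => |t| ^ (γ - 1) :=
      continuous_abs.rpow_const fun _ => Or.inr (by linarith)
    fun_prop
  have hψg : PowerGrowth ψ (γ - 1) := ⟨C, hC, fun t => by
    rw [hψ, abs_of_nonneg (by positivity)]⟩
  -- For |σ - θ| < 1 the point u + σv stays below b in absolute value, so the differentiated
  -- integrand is dominated by ψ(b)|v|, a product of an L^(p') and an L^p function.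
  set b : α → ℝ := fun x => |S.emb u x| + (|θ| + 1) * |S.emb v x| with hb
  have hbm : MemLp b (ENNReal.ofReal p) μ := hum.abs.add (hvm.abs.const_mul (|θ| + 1))
  have hψb : MemLp (fun x => ψ (b x)) (ENNReal.ofReal p.conjExponent) μ :=
    (MemLp.comp_of_powerGrowth hψc (by linarith) (by linarith [hf.lt_crit])
      hψg hbm).mono_exponent hf.conjExponent_lt.le
  refine (hasDerivAt_integral_of_dominated_loc_of_deriv_le (s := Metric.ball θ 1)
    (F := fun θ x => F (S.emb u x + θ * S.emb v x))
    (F' := fun θ x => f (S.emb u x + θ * S.emb v x) * S.emb v x)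
    (bound := fun x => ψ (b x) * |S.emb v x|)
    (Metric.ball_mem_nhds θ one_pos) (Eventually.of_forall fun σ =>
      hf.cont_prim.comp_aestronglyMeasurable (hlin σ).1)
    (integrable_comp_of_powerGrowth hf.cont_prim (by linarith) hf.lt_crit.le hf.growth_prim
      (hlin θ)) ((hf.cont.comp_aestronglyMeasurable (hlin θ).1).mul hvm.1)
    (ae_of_all _ fun x σ hσ => ?_) (hψb.integrable_mul hvm.abs)
    (ae_of_all _ fun x σ _ => ?_)).2
  · have hσ' : |σ| ≤ |θ| + 1 := by
      rw [Metric.mem_ball, Real.dist_eq] at hσ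
      have := abs_sub_abs_le_abs_sub σ θ
      linarith
    have hle : |S.emb u x + σ * S.emb v x| ≤ b x := by
      refine (abs_add_le _ _).trans ?_
      rw [abs_mul]
      exact add_le_add le_rfl (mul_le_mul_of_nonneg_right hσ' (abs_nonneg _))
    have hb0 : 0 ≤ b x := (abs_nonneg _).trans hle
    rw [norm_mul, Real.norm_eq_abs, Real.norm_eq_abs]
    refine mul_le_mul_of_nonneg_right ((hgr _).trans ?_) (abs_nonneg _)
    simp only [hψ]
    rw [abs_of_nonneg hb0]
    gcongr
    linarith
  · have h1 : HasDerivAt (fun σ : ℝ => S.emb u x + σ * S.emb v x) (S.emb v x) σ := by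
      simpa using ((hasDerivAt_id σ).mul_const (S.emb v x)).const_add (S.emb u x)
    exact (hf.hasDerivAt _).comp σ h1

lemma hasFDerivAt_pot (hf : IsNonlinearity p γ f F) (u : E) :
    HasFDerivAt (S.pot F) (S.dPot hf u) u :=
  hasFDerivAt_of_hasDerivAt_line (fun u v θ => S.hasDerivAt_pot_line hf u v θ)
    (S.continuous_dPot hf) u

variable (F) in
/-- The energy functional `½ B(u,u) - ∫ F(u) dμ + a ∫ u dμ`. -/
def action (a : ℝ) (u : E) : ℝ := S.form u u / 2 - S.pot F u + a * S.mass u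

/-- The derivative of the energy functional. -/
def dAction (hf : IsNonlinearity p γ f F) (a : ℝ) (u : E) : E →L[ℝ] ℝ :=
  S.form u - S.dPot hf u + a • S.mass

lemma hasFDerivAt_action (hf : IsNonlinearity p γ f F) (a : ℝ) (u : E) :
    HasFDerivAt (S.action F a) (S.dAction hf a u) u := by
  have h1 : HasFDerivAt (fun u => S.form u u / 2) (S.form u) u := by
    have h := (S.form.hasFDerivAt (x := u)).clm_apply (hasFDerivAt_id u)
    have h' := h.mul_const (1 / 2 : ℝ)
    simp only [id_eq, mul_one_div] at h'
    refine h'.congr_fderiv ?_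
    ext v
    simp [S.form_symm v u]
    ring
  have h3 : HasFDerivAt (fun u => a * S.mass u) (a • S.mass) u := S.mass.hasFDerivAt.const_mul a
  exact (h1.sub (S.hasFDerivAt_pot hf u)).add h3

lemma continuous_dAction (hf : IsNonlinearity p γ f F) (a : ℝ) : Continuous (S.dAction hf a) :=
  (S.form.continuous.sub (S.continuous_dPot hf)).add continuous_const

lemma fderiv_action (hf : IsNonlinearity p γ f F) (a : ℝ) :
    fderiv ℝ (S.action F a) = S.dAction hf a :=
  funext fun u => (S.hasFDerivAt_action hf a u).fderiv

lemma contDiff_action (hf : IsNonlinearity p γ f F) (a : ℝ) : ContDiff ℝ 1 (S.action F a) := by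
  rw [contDiff_one_iff_fderiv, S.fderiv_action hf]
  exact ⟨fun u => (S.hasFDerivAt_action hf a u).differentiableAt, S.continuous_dAction hf a⟩

lemma dAction_apply (hf : IsNonlinearity p γ f F) (a : ℝ) (u v : E) :
    S.dAction hf a u v = S.form u v - S.dPot hf u v + a * S.mass v := rfl

end EnergySpace

/-! ### Compactness and a priori bounds for Cerami sequences. -/

namespace EnergySpace

variable {E : Type*} [NormedAddCommGroup E] [NormedSpace ℝ E] {α : Type*}
    [MeasurableSpace α] {μ : Measure α} [IsFiniteMeasure μ] {p : ℝ} [Fact (1 < p)]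
    (S : EnergySpace E μ p) {γ : ℝ} {f F : ℝ → ℝ}

lemma lower_mul_norm_sub_le (u v : E) : S.lower * ‖u - v‖ ≤ ‖S.form u - S.form v‖ := by
  rcases (norm_nonneg (u - v)).eq_or_lt with h | h
  · rw [← h, mul_zero]; exact norm_nonneg _
  · refine le_of_mul_le_mul_right ?_ h
    calc S.lower * ‖u - v‖ * ‖u - v‖ = S.lower * ‖u - v‖ ^ 2 := by ring
      _ ≤ S.form (u - v) (u - v) := S.le_form _
      _ ≤ ‖S.form (u - v) (u - v)‖ := le_abs_self _
      _ ≤ ‖S.form (u - v)‖ * ‖u - v‖ := (S.form (u - v)).le_opNorm _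
      _ = ‖S.form u - S.form v‖ * ‖u - v‖ := by rw [map_sub]

/-- Coercivity makes u ↦ B(u, ·) bounded below. Closed range and the embedding property are all that
is needed of the Riesz isomorphism: convergence of B(w_n, ·) in the dual pulls back to convergence
of w_n. -/
lemma isClosedEmbedding_form [CompleteSpace E] : IsClosedEmbedding S.form := by
  have h : AntilipschitzWith (Real.toNNReal S.lower⁻¹) S.form :=
    AntilipschitzWith.of_le_mul_dist fun u v => by
      rw [dist_eq_norm, dist_eq_norm, Real.coe_toNNReal _ (inv_nonneg.2 S.lower_pos.le),
        inv_mul_eq_div, le_div_iff₀ S.lower_pos, mul_comm]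
      exact S.lower_mul_norm_sub_le u v
  exact h.isClosedEmbedding S.form.uniformContinuous

/-- Bounded Palais-Smale sequences have convergent subsequences. -/
lemma exists_subseq_tendsto [CompleteSpace E] (hf : IsNonlinearity p γ f F) {a : ℝ} {w : ℕ → E}
    {M : ℝ} (hM : ∀ n, ‖w n‖ ≤ M)
    (h : Tendsto (fun n => S.dAction hf a (w n)) atTop (𝓝 0)) :
    ∃ v, ∃ k : ℕ → ℕ, StrictMono k ∧ Tendsto (w ∘ k) atTop (𝓝 v) := by
  obtain ⟨k, hk, v, hv⟩ := S.exists_ae_tendsto w M hM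
  have hlim := S.tendsto_dPot hf (fun n => hM (k n)) hv
    (S.memLp_of_ae_tendsto (fun n => hM (k n)) hv)
  -- B(w, ·) = I'(w) + ∫f(w)· dμ - a∫· dμ: the first summand tends to 0 and the second converges by
  -- compactness.
  have h1 : Tendsto (fun n => S.form (w (k n))) atTop (𝓝 (0 +
      S.pair ((memLp_comp hf (S.memLp_of_ae_tendsto (fun n => hM (k n)) hv)).toLp _)
        - a • S.mass)) := by
    refine (((h.comp hk.tendsto_atTop).add hlim).sub_const (a • S.mass)).congr fun n => ?_
    simp only [dAction, Function.comp_apply]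
    abel
  have hemb := S.isClosedEmbedding_form
  obtain ⟨u, hu⟩ := hemb.isClosed_range.mem_of_tendsto h1 (Eventually.of_forall fun n => ⟨_, rfl⟩)
  refine ⟨u, k, hk, ?_⟩
  rw [hemb.isEmbedding.tendsto_nhds_iff, hu]
  exact h1

/-- A bound for the negative part of almost critical points. -/
lemma neg_mass_le (hf : IsNonlinearity p γ f F) : ∃ C ≥ 0, ∀ a ≥ 0, ∀ u,
    -S.mass u ≤ C * (1 + a + ‖S.dAction hf a u‖) := by
  have hl := S.lower_pos
  set C := μ.real univ + ‖S.mass‖ / S.lower + ‖S.mass‖ * (‖S.mass‖ / S.lower) with hC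
  have hC0 : 0 ≤ C := by positivity
  refine ⟨C, hC0, fun a ha => ?_⟩
  obtain ⟨D, hD, hDt⟩ := S.exists_trunc
  -- Truncations are available on a dense set only; both sides are continuous in u, so the estimate
  -- passes to the closure.
  have hclosed : IsClosed {u | -S.mass u ≤ C * (1 + a + ‖S.dAction hf a u‖)} := by
    have := S.continuous_dAction hf a
    exact isClosed_le (by fun_prop) (by fun_prop)
  suffices h : D ⊆ {u | -S.mass u ≤ C * (1 + a + ‖S.dAction hf a u‖)} by
    intro u
    have := hclosed.closure_subset_iff.2 h
    rw [hD.closure_eq] at this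
    exact this (mem_univ u)
  intro u hu
  obtain ⟨v, hv, hform⟩ := hDt u hu
  -- The truncation v lives where u ≤ 0, and there f(u) = 0, so the nonlinear term disappears when
  -- I'(u) is tested with v.
  have hpot : S.dPot hf u v = 0 := by
    rw [dPot_apply]
    refine integral_eq_zero_of_ae ?_
    filter_upwards [hv] with x hx
    rcases hx.2 with h | h
    · simp [h]
    · simp [hf.zero_of_nonpos _ h]
  set d := ‖S.dAction hf a u‖ with hd
  have hmv : |S.mass v| ≤ ‖S.mass‖ * ‖v‖ := S.mass.le_opNorm v
  -- Testing with v gives B(v,v) ≤ B(u,v) = I'(u)v - a∫v dμ, and coercivity bounds ‖v‖ linearly.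
  -- Since v ≤ u + 1, the integral of v then bounds that of u from below.
  have hv1 : S.lower * ‖v‖ ≤ d + a * ‖S.mass‖ := by
    rcases (norm_nonneg v).eq_or_lt with h0 | h0
    · rw [← h0, mul_zero]; positivity
    · refine le_of_mul_le_mul_right ?_ h0
      have e1 := S.dAction_apply hf a u v
      have e2 : S.dAction hf a u v ≤ d * ‖v‖ :=
        (le_abs_self _).trans ((S.dAction hf a u).le_opNorm v)
      have e3 : -(a * S.mass v) ≤ a * (‖S.mass‖ * ‖v‖) := by
        rw [← mul_neg]
        exact mul_le_mul_of_nonneg_left ((neg_le_abs _).trans hmv) ha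
      have e4 := S.le_form v
      nlinarith
  have hv2 : ‖v‖ ≤ (d + a * ‖S.mass‖) / S.lower := by
    rw [le_div_iff₀ hl]; linarith
  have hm : S.mass v ≤ S.mass u + μ.real univ := by
    have hi : ∀ w : E, Integrable (fun x => S.emb w x) μ := fun w =>
      (Lp.memLp (S.emb w)).integrable Fact.out
    rw [mass_apply, mass_apply]
    calc ∫ x, S.emb v x ∂μ ≤ ∫ x, (S.emb u x + 1) ∂μ :=
          integral_mono_ae (hi v) ((hi u).add (integrable_const 1)) (hv.mono fun x hx => hx.1)
      _ = _ := by rw [integral_add (hi u) (integrable_const 1)]; simp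
  have hfin : -S.mass u ≤ μ.real univ + ‖S.mass‖ * ((d + a * ‖S.mass‖) / S.lower) := by
    have : ‖S.mass‖ * ‖v‖ ≤ ‖S.mass‖ * ((d + a * ‖S.mass‖) / S.lower) := by gcongr
    linarith [neg_le_abs (S.mass v)]
  refine hfin.trans ?_
  have hd0 : 0 ≤ d := norm_nonneg _
  have hx : 0 ≤ μ.real (univ : Set α) := measureReal_nonneg
  have hy : 0 ≤ ‖S.mass‖ / S.lower := by positivity
  have hz : 0 ≤ ‖S.mass‖ * (‖S.mass‖ / S.lower) := by positivity
  have : ‖S.mass‖ * ((d + a * ‖S.mass‖) / S.lower)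
      = ‖S.mass‖ / S.lower * d + ‖S.mass‖ * (‖S.mass‖ / S.lower) * a := by ring
  rw [this, hC]
  nlinarith [mul_nonneg hx ha, mul_nonneg hx hd0, mul_nonneg hy ha, mul_nonneg hz hd0]

lemma emb_smul (t : ℝ) (u : E) : ∀ᵐ x ∂μ, S.emb (t • u) x = t * S.emb u x := by
  rw [map_smul]
  filter_upwards [Lp.coeFn_smul t (S.emb u)] with x hx
  rw [hx, Pi.smul_apply, smul_eq_mul]

lemma tendsto_pot (hf : IsNonlinearity p γ f F) {w : ℕ → E} {M : ℝ} (hM : ∀ n, ‖w n‖ ≤ M)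
    {v : α → ℝ} (h : ∀ᵐ x ∂μ, Tendsto (fun n => S.emb (w n) x) atTop (𝓝 (v x))) :
    Tendsto (fun n => S.pot F (w n)) atTop (𝓝 (∫ x, F (v x) ∂μ)) :=
  tendsto_integral_comp hf.cont_prim (by linarith [hf.two_lt]) hf.growth_prim hf.lt_crit
    (fun _ => Lp.aestronglyMeasurable _) ENNReal.ofReal_ne_top
    (fun n => S.eLpNorm_emb_le (hM n)) h

/-- The function `t f(t) - 2 F(t)` which governs compactness is integrable along the space, and
computes `2 I - I'(u) u`. -/
lemma integrable_defect (hf : IsNonlinearity p γ f F) (u : E) :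
    Integrable (fun x => S.emb u x * f (S.emb u x) - 2 * F (S.emb u x)) μ := by
  refine Integrable.sub ?_ ((S.integrable_pot hf u).const_mul 2)
  simpa only [mul_comm] using S.integrable_dPot hf u u

/-- The quadratic part, homogeneous of degree 2, cancels, while the linear term survives with factor
2 - 1 = 1. -/
lemma two_mul_action_sub (hf : IsNonlinearity p γ f F) (a : ℝ) (u : E) :
    2 * S.action F a u - S.dAction hf a u u
      = ∫ x, (S.emb u x * f (S.emb u x) - 2 * F (S.emb u x)) ∂μ + a * S.mass u := by
  rw [integral_sub, integral_const_mul, dAction_apply, dPot_apply, action, pot]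
  · simp only [mul_comm (S.emb u _)]
    ring
  · simpa only [mul_comm] using S.integrable_dPot hf u u
  · exact (S.integrable_pot hf u).const_mul 2

lemma action_zero (hf : IsNonlinearity p γ f F) (a : ℝ) : S.action F a 0 = 0 := by
  have : S.pot F 0 = 0 := by
    refine integral_eq_zero_of_ae ?_
    rw [map_zero]
    filter_upwards [Lp.coeFn_zero ℝ (ENNReal.ofReal p) μ] with x hx
    rw [hx]
    exact hf.prim_zero_of_nonpos 0 le_rfl
  simp [action, this]

lemma powerGrowth_posPart_sq : PowerGrowth (fun t => (max t 0) ^ 2) 2 :=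
  ⟨1, zero_le_one, fun t => by
    simp only [one_mul, abs_of_nonneg (sq_nonneg (max t 0)), Real.rpow_two, sq_abs]
    rcases le_total t 0 with h | h
    · rw [max_eq_right h]; nlinarith [sq_nonneg t]
    · rw [max_eq_left h]; linarith⟩

/-- Along normalised sequences with bounded energy the positive part vanishes in the limit. -/
lemma ae_nonpos_of_action_bounded (hf : IsNonlinearity p γ f F) {A Λ : ℝ} {a : ℕ → ℝ}
    (ha0 : ∀ n, 0 ≤ a n) (haA : ∀ n, a n ≤ A) {w : ℕ → E} {r : ℕ → ℝ} (hr : ∀ n, 0 < r n)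
    (hrt : Tendsto r atTop atTop) (hw : ∀ n, ‖w n‖ ≤ 1)
    (hI : ∀ n, -Λ ≤ S.action F (a n) (r n • w n)) {v : α → ℝ}
    (hv : ∀ᵐ x ∂μ, Tendsto (fun n => S.emb (w n) x) atTop (𝓝 (v x))) : ∀ᵐ x ∂μ, v x ≤ 0 := by
  have hvm := S.memLp_of_ae_tendsto hw hv
  have h2p : 2 < p := hf.two_lt.trans hf.lt_crit
  have hsqc : Continuous fun t : ℝ => (max t 0) ^ 2 := by fun_prop
  have hlim : Tendsto (fun n => ∫ x, (max (S.emb (w n) x) 0) ^ 2 ∂μ) atTop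
      (𝓝 (∫ x, (max (v x) 0) ^ 2 ∂μ)) :=
    tendsto_integral_comp hsqc two_pos powerGrowth_posPart_sq h2p
      (fun _ => Lp.aestronglyMeasurable _) ENNReal.ofReal_ne_top
      (fun n => S.eLpNorm_emb_le (hw n)) hv
  have hint : ∀ u : α → ℝ, MemLp u (ENNReal.ofReal p) μ →
      Integrable (fun x => (max (u x) 0) ^ 2) μ := fun u hu =>
    integrable_comp_of_powerGrowth hsqc two_pos h2p.le powerGrowth_posPart_sq hu
  -- Divide the energy bound by r². The quadratic form contributes at most ‖B‖/2, the mass term is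
  -- O(1/r), and F(t) ≥ Mt² - C on t ≥ 0 gives the left side. Since M is arbitrary, the integral
  -- vanishes.
  have hkey : ∀ M ≥ 0, M * ∫ x, (max (v x) 0) ^ 2 ∂μ ≤ ‖S.form‖ / 2 := by
    intro M hM
    obtain ⟨C, hC, hFM⟩ := hf.superlinear M
    have hbound : ∀ n, M * ∫ x, (max (S.emb (w n) x) 0) ^ 2 ∂μ ≤
        ‖S.form‖ / 2 + (A * ‖S.mass‖) * (r n)⁻¹ + (Λ + C * μ.real univ) * ((r n)⁻¹ * (r n)⁻¹) := by
      intro n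
      have hrn := hr n
      have e1 : M * (r n ^ 2 * ∫ x, (max (S.emb (w n) x) 0) ^ 2 ∂μ) - C * μ.real univ
          ≤ S.pot F (r n • w n) := by
        have : ∫ x, (M * (r n ^ 2 * (max (S.emb (w n) x) 0) ^ 2) - C) ∂μ
            ≤ S.pot F (r n • w n) := by
          refine integral_mono_ae ((((hint _ (Lp.memLp _)).const_mul _).const_mul _).sub
            (integrable_const C)) (S.integrable_pot hf _) ?_
          filter_upwards [S.emb_smul (r n) (w n)] with x hx
          rw [hx]
          rcases le_total (S.emb (w n) x) 0 with h | h
          · rw [max_eq_right h, hf.prim_zero_of_nonpos _ (mul_nonpos_of_nonneg_of_nonpos hrn.le h)]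
            simpa using hC
          · rw [max_eq_left h, ← mul_pow]
            exact hFM _ (by positivity)
        rw [integral_sub (((hint _ (Lp.memLp _)).const_mul _).const_mul _) (integrable_const C),
          integral_const_mul, integral_const_mul, integral_const, smul_eq_mul, mul_comm _ C] at this
        exact this
      have hn := hI n
      have e2 : S.form (r n • w n) (r n • w n) ≤ ‖S.form‖ * r n ^ 2 := by
        have h1 := (le_abs_self _).trans (S.form.le_opNorm₂ (w n) (w n))
        have h2 : ‖S.form‖ * ‖w n‖ * ‖w n‖ ≤ ‖S.form‖ * 1 * 1 := by gcongr <;> exact hw n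
        simp only [map_smul, smul_apply, smul_eq_mul]
        nlinarith [sq_nonneg (r n)]
      have e3 : a n * S.mass (r n • w n) ≤ A * ‖S.mass‖ * r n := by
        have h1 : S.mass (w n) ≤ ‖S.mass‖ :=
          (le_abs_self _).trans ((S.mass.le_opNorm (w n)).trans
            (mul_le_of_le_one_right (norm_nonneg _) (hw n)))
        have h2 : a n * S.mass (w n) ≤ A * ‖S.mass‖ :=
          (mul_le_mul_of_nonneg_left h1 (ha0 n)).trans
            (mul_le_mul_of_nonneg_right (haA n) (norm_nonneg _))
        rw [map_smul, smul_eq_mul]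
        nlinarith
      rw [action] at hn
      have e4 : r n ^ 2 * (M * ∫ x, (max (S.emb (w n) x) 0) ^ 2 ∂μ) ≤
          ‖S.form‖ * r n ^ 2 / 2 + A * ‖S.mass‖ * r n + (Λ + C * μ.real univ) := by linarith
      refine le_of_mul_le_mul_left (e4.trans_eq ?_) (by positivity : 0 < r n ^ 2)
      field_simp
    have hrinv := tendsto_inv_atTop_zero.comp hrt
    have := le_of_tendsto_of_tendsto' (hlim.const_mul M) (((tendsto_const_nhds (x := ‖S.form‖ / 2)).add
      (hrinv.const_mul (A * ‖S.mass‖))).add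
      ((hrinv.mul hrinv).const_mul (Λ + C * μ.real univ))) hbound
    simpa using this
  have hzero : ∫ x, (max (v x) 0) ^ 2 ∂μ = 0 := by
    refine le_antisymm ?_ (integral_nonneg fun x => sq_nonneg _)
    by_contra! hpos
    have := hkey ((‖S.form‖ / 2 + 1) / ∫ x, (max (v x) 0) ^ 2 ∂μ) (by positivity)
    rw [div_mul_cancel₀ _ hpos.ne'] at this
    linarith
  rw [integral_eq_zero_iff_of_nonneg (fun x => sq_nonneg _) (hint v hvm)] at hzero
  filter_upwards [hzero] with x hx
  have : max (v x) 0 = 0 := by simpa using hx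
  exact max_eq_right_iff.1 this

/-- Jeanjean's monotonicity argument: the energy along the segment to `u` is controlled. -/
lemma action_smul_le (hf : IsNonlinearity p γ f F) {C : ℝ}
    (hC : ∀ t θ, 0 ≤ θ → θ ≤ 1 →
      θ * t * f (θ * t) - 2 * F (θ * t) ≤ t * f t - 2 * F t + C) (a : ℝ) (u : E) {θ : ℝ}
    (h0 : 0 ≤ θ) (h1 : θ ≤ 1) (hcrit : S.dAction hf a (θ • u) (θ • u) = 0) :
    2 * S.action F a (θ • u) ≤ 2 * S.action F a u - S.dAction hf a u u + C * μ.real univ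
      + a * ((1 - θ) * -S.mass u) := by
  have e1 := S.two_mul_action_sub hf a (θ • u)
  have e2 := S.two_mul_action_sub hf a u
  rw [hcrit, sub_zero, S.mass.map_smul, smul_eq_mul] at e1
  have e3 : ∫ x, (S.emb (θ • u) x * f (S.emb (θ • u) x) - 2 * F (S.emb (θ • u) x)) ∂μ
      ≤ ∫ x, (S.emb u x * f (S.emb u x) - 2 * F (S.emb u x) + C) ∂μ := by
    refine integral_mono_ae (S.integrable_defect hf _)
      ((S.integrable_defect hf u).add (integrable_const C)) ?_
    filter_upwards [S.emb_smul θ u] with x hx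
    rw [hx]
    exact hC _ θ h0 h1
  rw [integral_add (S.integrable_defect hf u) (integrable_const C), integral_const, smul_eq_mul,
    mul_comm _ C] at e3
  rw [e1, e2]
  linarith

/-- Points with bounded energy and bounded `‖I'(u)‖ ‖u‖` are bounded, uniformly in the parameter. -/
theorem exists_norm_bound (hf : IsNonlinearity p γ f F) (A Λ : ℝ) : ∃ ρ > 0, ∀ a ≥ 0, a ≤ A → ∀ u,
    |S.action F a u| ≤ Λ → ‖S.dAction hf a u‖ * ‖u‖ ≤ Λ → ‖u‖ ≤ ρ := by
  by_contra! hcon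
  choose a ha0 haA u hI hI' hu using fun n : ℕ => hcon ((n : ℝ) + 1) (by positivity)
  have hΛ : 0 ≤ Λ := (abs_nonneg _).trans (hI 0)
  have hA : 0 ≤ A := (ha0 0).trans (haA 0)
  have hr1 : ∀ n, 1 ≤ ‖u n‖ := fun n => by
    have := hu n
    have : (0 : ℝ) ≤ n := n.cast_nonneg
    linarith
  have hrt : Tendsto (fun n => ‖u n‖) atTop atTop :=
    tendsto_atTop_mono (fun n => (hu n).le)
      (tendsto_atTop_add_const_right _ 1 tendsto_natCast_atTop_atTop)
  set w : ℕ → E := fun n => ‖u n‖⁻¹ • u n with hwdef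
  have hw : ∀ n, ‖w n‖ ≤ 1 := fun n => by
    rw [hwdef, norm_smul, norm_inv, norm_norm, inv_mul_cancel₀ (by linarith [hr1 n])]
  have hw1 : ∀ n, 1 ≤ ‖w n‖ := fun n => by
    rw [hwdef, norm_smul, norm_inv, norm_norm, inv_mul_cancel₀ (by linarith [hr1 n])]
  have huw : ∀ n, ‖u n‖ • w n = u n := fun n => by
    rw [hwdef, smul_inv_smul₀ (by linarith [hr1 n])]
  obtain ⟨k, hk, v, hv⟩ := S.exists_ae_tendsto w 1 hw
  have hv0 : ∀ᵐ x ∂μ, v x ≤ 0 := S.ae_nonpos_of_action_bounded hf (Λ := Λ)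
    (a := a ∘ k) (w := w ∘ k) (r := fun n => ‖u (k n)‖) (fun n => ha0 _) (fun n => haA _)
    (fun n => by linarith [hr1 (k n)]) (hrt.comp hk.tendsto_atTop) (fun n => hw _)
    (fun n => by
      simp only [Function.comp_apply, huw]
      exact (abs_le.1 (hI (k n))).1) hv
  obtain ⟨Cn, hCn, hneg⟩ := S.neg_mass_le hf
  obtain ⟨Cq, hCq, hquasi⟩ := hf.quasi_mono
  -- B dominates both I(u) and the right-hand side that the monotonicity argument gives for 2I(θu),
  -- so energy above B on the segment is contradictory.
  set B := 2 * Λ + Λ + Cq * μ.real univ + A * (Cn * (1 + A + Λ)) with hB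
  have hB0 : Λ ≤ B := by
    have : 0 ≤ Cq * μ.real univ := by positivity
    have : 0 ≤ A * (Cn * (1 + A + Λ)) := by positivity
    linarith
  have hl := S.lower_pos
  -- T is large enough that lower·T²/2 - A‖mass‖T - 1 > B; the 1 absorbs ∫F(Tw) dμ, which tends to 0
  -- because the limit of w is nonpositive.
  set T := 1 + 2 / S.lower * (A * ‖S.mass‖ + 1 + B) with hT
  have hT1 : 1 ≤ T := by
    have : 0 ≤ 2 / S.lower * (A * ‖S.mass‖ + 1 + B) := by positivity
    linarith
  have hTB : B < S.lower * T ^ 2 / 2 - A * ‖S.mass‖ * T - 1 := by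
    have e1 : S.lower * T / 2 = S.lower / 2 + (A * ‖S.mass‖ + 1 + B) := by
      rw [hT]; field_simp
    have e2 : S.lower * T ^ 2 / 2 = (S.lower * T / 2) * T := by ring
    rw [e2, e1]
    nlinarith [mul_pos hl (zero_lt_one.trans_le hT1)]
  have hpot : Tendsto (fun n => S.pot F (T • w (k n))) atTop (𝓝 0) := by
    have h1 := S.tendsto_pot hf (w := fun n => T • w (k n)) (M := T) (v := fun x => T * v x)
      (fun n => by
        rw [norm_smul, Real.norm_of_nonneg (by linarith)]
        exact mul_le_of_le_one_right (by linarith) (hw _)) (by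
        have : ∀ᵐ x ∂μ, ∀ n, S.emb (T • w (k n)) x = T * S.emb (w (k n)) x :=
          ae_all_iff.2 fun n => S.emb_smul T (w (k n))
        filter_upwards [hv, this] with x hx hx'
        simp only [hx']
        exact hx.const_mul T)
    have h2 : ∫ x, F (T * v x) ∂μ = 0 := by
      refine integral_eq_zero_of_ae ?_
      filter_upwards [hv0] with x hx
      exact hf.prim_zero_of_nonpos _ (mul_nonpos_of_nonneg_of_nonpos (by linarith) hx)
    rwa [h2] at h1
  obtain ⟨n, hn1, hn2⟩ := ((hpot.eventually_lt_const one_pos).and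
    ((hrt.comp hk.tendsto_atTop).eventually_ge_atTop T)).exists
  set m := k n
  simp only [Function.comp_apply] at hn2
  have hbig : B < S.action F (a m) (T • w m) := by
    have e1 : S.lower * T ^ 2 ≤ S.form (T • w m) (T • w m) := by
      have := S.le_form (T • w m)
      rw [norm_smul, Real.norm_of_nonneg (by linarith), mul_pow] at this
      have h2 : (1 : ℝ) ≤ ‖w m‖ ^ 2 := one_le_pow₀ (hw1 m)
      have h3 : S.lower * T ^ 2 * 1 ≤ S.lower * T ^ 2 * ‖w m‖ ^ 2 := by gcongr
      linarith
    have e2 : -(A * ‖S.mass‖ * T) ≤ a m * S.mass (T • w m) := by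
      have h1 : |S.mass (T • w m)| ≤ ‖S.mass‖ * T := by
        refine (S.mass.le_opNorm _).trans ?_
        gcongr
        rw [norm_smul, Real.norm_of_nonneg (by linarith)]
        exact mul_le_of_le_one_right (by linarith) (hw _)
      have h2 : a m * |S.mass (T • w m)| ≤ A * (‖S.mass‖ * T) := by
        gcongr
        exact haA m
      have h3 : -(a m * |S.mass (T • w m)|) ≤ a m * S.mass (T • w m) := by
        rw [← mul_neg]
        exact mul_le_mul_of_nonneg_left (neg_abs_le _) (ha0 m)
      linarith
    rw [action]
    linarith
  have hderiv : ∀ θ : ℝ, HasDerivAt (fun θ : ℝ => S.action F (a m) (θ • u m))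
      (S.dAction hf (a m) (θ • u m) (u m)) θ := fun θ => by
    have h1 : HasDerivAt (fun θ : ℝ => θ • u m) (u m) θ := by
      simpa using (hasDerivAt_id θ).smul_const (u m)
    exact (S.hasFDerivAt_action hf (a m) _).comp_hasDerivAt θ h1
  obtain ⟨θ, hθ, hmax⟩ := (isCompact_Icc (a := (0 : ℝ)) (b := 1)).exists_isMaxOn
    ⟨0, by simp⟩ (f := fun θ : ℝ => S.action F (a m) (θ • u m))
    (fun θ _ => (hderiv θ).continuousAt.continuousWithinAt)
  have hrm : 0 < ‖u m‖ := by linarith [hr1 m]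
  have hlarge : B < S.action F (a m) (θ • u m) := by
    refine hbig.trans_le ?_
    have := hmax (show T / ‖u m‖ ∈ Icc (0 : ℝ) 1 from
      ⟨by positivity, (div_le_one hrm).2 hn2⟩)
    simpa only [hwdef, smul_smul, div_eq_mul_inv, mem_ofPred_eq] using this
  -- The maximum exceeds B ≥ Λ ≥ 0, whereas I(0) = 0 and I(u) ≤ Λ. Hence θ is interior and the
  -- derivative along the ray vanishes.
  have hθ0 : θ ≠ 0 := by
    rintro rfl
    rw [zero_smul, S.action_zero hf] at hlarge
    linarith
  have hθ1 : θ ≠ 1 := by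
    rintro rfl
    rw [one_smul] at hlarge
    linarith [(abs_le.1 (hI m)).2]
  have hcrit : S.dAction hf (a m) (θ • u m) (θ • u m) = 0 := by
    have hloc : IsLocalMax (fun θ : ℝ => S.action F (a m) (θ • u m)) θ :=
      hmax.isLocalMax (Icc_mem_nhds (lt_of_le_of_ne hθ.1 hθ0.symm) (lt_of_le_of_ne hθ.2 hθ1))
    rw [map_smul, hloc.hasDerivAt_eq_zero (hderiv θ), smul_zero]
  have hfin := S.action_smul_le hf hquasi (a m) (u m) hθ.1 hθ.2 hcrit
  have hd : ‖S.dAction hf (a m) (u m)‖ ≤ Λ :=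
    (le_mul_of_one_le_right (norm_nonneg _) (hr1 m)).trans (hI' m)
  have e1 : -(S.dAction hf (a m) (u m) (u m)) ≤ Λ :=
    (neg_le_abs _).trans (((S.dAction hf (a m) (u m)).le_opNorm _).trans (hI' m))
  have e2 : -S.mass (u m) ≤ Cn * (1 + A + Λ) :=
    (hneg (a m) (ha0 m) (u m)).trans (by gcongr; exact haA m)
  -- The bound on -∫u dμ is one-sided, which suffices because it is multiplied by a(1 - θ) ≥ 0.
  have e3 : a m * ((1 - θ) * -S.mass (u m)) ≤ A * (Cn * (1 + A + Λ)) := by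
    have hX : 0 ≤ Cn * (1 + A + Λ) := by positivity
    have h1 : (1 - θ) * -S.mass (u m) ≤ Cn * (1 + A + Λ) :=
      (mul_le_mul_of_nonneg_left e2 (by linarith [hθ.2])).trans
        (mul_le_of_le_one_left hX (by linarith [hθ.1]))
    exact (mul_le_mul_of_nonneg_left h1 (ha0 m)).trans (mul_le_mul_of_nonneg_right (haA m) hX)
  linarith [(abs_le.1 (hI m)).2]

/-- The mountain pass level is a critical value. -/
theorem exists_critical_of_mountainPass [CompleteSpace E] (hf : IsNonlinearity p γ f F) {a : ℝ}
    (ha : 0 ≤ a) {e : E} {c : ℝ}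
    (hc : IsGLB (range fun q : Path (0 : E) e => ⨆ t, S.action F a (q t)) c) (hc0 : 0 < c)
    (he : S.action F a e < c) : ∃ u, S.action F a u = c ∧ S.dAction hf a u = 0 := by
  have hex : ∀ n : ℕ, ∃ u, |S.action F a u - c| ≤ 1 / ((n : ℝ) + 1) ∧
      ‖S.dAction hf a u‖ * (1 + ‖u‖) < 1 / ((n : ℝ) + 1) := fun n =>
    exists_almost_critical_of_mountainPass (S.hasFDerivAt_action hf a) (S.continuous_dAction hf a)
      hc (by rw [S.action_zero hf]; exact hc0) he (by positivity)
  choose u hu1 hu2 using hex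
  have hle : ∀ n : ℕ, 1 / ((n : ℝ) + 1) ≤ 1 := fun n => by
    rw [div_le_one (by positivity)]
    linarith [(n.cast_nonneg : (0 : ℝ) ≤ n)]
  obtain ⟨ρ, -, hρ⟩ := S.exists_norm_bound hf a (c + 1)
  have hbd : ∀ n, ‖u n‖ ≤ ρ := fun n => by
    refine hρ a ha le_rfl _ ?_ ?_
    · have := abs_le.1 ((hu1 n).trans (hle n))
      rw [abs_le]
      constructor <;> linarith [this.1, this.2]
    · have := (hu2 n).trans_le (hle n)
      have h0 := norm_nonneg (S.dAction hf a (u n))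
      linarith
  have hlim : Tendsto (fun n : ℕ => 1 / ((n : ℝ) + 1)) atTop (𝓝 0) :=
    tendsto_one_div_add_atTop_nhds_zero_nat
  have hd : Tendsto (fun n => S.dAction hf a (u n)) atTop (𝓝 0) := by
    refine squeeze_zero_norm (fun n => ?_) hlim
    refine le_trans ?_ (hu2 n).le
    exact le_mul_of_one_le_right (norm_nonneg _) (le_add_of_nonneg_right (norm_nonneg _))
  have hI : Tendsto (fun n => S.action F a (u n)) atTop (𝓝 c) := by
    rw [tendsto_iff_dist_tendsto_zero]
    exact squeeze_zero (fun n => dist_nonneg) hu1 hlim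
  obtain ⟨v, k, hk, hv⟩ := S.exists_subseq_tendsto hf hbd hd
  refine ⟨v, ?_, ?_⟩
  · exact tendsto_nhds_unique
      (((S.contDiff_action hf a).continuous.tendsto v).comp hv) (hI.comp hk.tendsto_atTop)
  · exact tendsto_nhds_unique
      (((S.continuous_dAction hf a).tendsto v).comp hv) (hd.comp hk.tendsto_atTop)

end EnergySpace

/-! ## Averages over balls and the fractional Sobolev inequality -/

lemma enorm_setAverage_le {α : Type*} [MeasurableSpace α] {μ : Measure α} {B : Set α}
    (hB0 : μ B ≠ 0) (hB : μ B ≠ ⊤) {q : ENNReal} (hq : 1 ≤ q) {h : α → ℝ}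
    (hh : AEStronglyMeasurable h (μ.restrict B)) :
    ‖⨍ y in B, h y ∂μ‖ₑ ≤ eLpNorm h q (μ.restrict B) * μ B ^ (-(1 / q.toReal)) := by
  have h1 : ‖⨍ y in B, h y ∂μ‖ₑ ≤ (μ B)⁻¹ * eLpNorm h 1 (μ.restrict B) := by
    rw [setAverage_eq, enorm_smul, eLpNorm_one_eq_lintegral_enorm]
    gcongr
    · rw [measureReal_def, ← ENNReal.toReal_inv, ← ofReal_norm, Real.norm_of_nonneg (by positivity),
        ENNReal.ofReal_toReal (ENNReal.inv_ne_top.2 hB0)]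
    · exact enorm_integral_le_lintegral_enorm _
  refine h1.trans ?_
  calc (μ B)⁻¹ * eLpNorm h 1 (μ.restrict B)
      ≤ (μ B)⁻¹ * (eLpNorm h q (μ.restrict B) * μ B ^ (1 / (1 : ENNReal).toReal - 1 / q.toReal)) := by
        gcongr
        have := eLpNorm_le_eLpNorm_mul_rpow_measure_univ (μ := μ.restrict B) hq hh
        rwa [Measure.restrict_apply_univ] at this
    _ = eLpNorm h q (μ.restrict B) * (μ B ^ (-1 : ℝ) * μ B ^ (1 - 1 / q.toReal)) := by
        rw [ENNReal.toReal_one, div_one, ENNReal.rpow_neg_one]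
        ring
    _ = _ := by
        rw [← ENNReal.rpow_add _ _ hB0 hB]
        congr 2
        ring

section Averages

variable {N : ℕ} {s : ℝ}

local notation "V" => EuclideanSpace ℝ (Fin N)

/-- The density of the Gagliardo energy at a point. -/
def localEnergy (N : ℕ) (s : ℝ) (u : EuclideanSpace ℝ (Fin N) → ℝ)
    (x : EuclideanSpace ℝ (Fin N)) : ENNReal :=
  ∫⁻ y, ‖diffQuot N s u (x, y)‖ₑ ^ (2 : ℝ)

lemma lintegral_localEnergy {u : V → ℝ} (hu : AEStronglyMeasurable u volume) :
    ∫⁻ x, localEnergy N s u x = eLpNorm (diffQuot N s u) 2 volume ^ (2 : ℝ) := by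
  have hm := (aestronglyMeasurable_diffQuot N s hu).enorm.pow_const (2 : ℝ)
  rw [eLpNorm_eq_lintegral_rpow_enorm_toReal (by norm_num) (by norm_num), ← ENNReal.rpow_mul]
  simp only [ENNReal.toReal_ofNat, one_div, inv_mul_cancel₀ (two_ne_zero' ℝ), ENNReal.rpow_one]
  rw [Measure.volume_eq_prod] at hm ⊢
  exact (lintegral_prod _ hm).symm

lemma aemeasurable_localEnergy {u : V → ℝ} (hu : AEStronglyMeasurable u volume) :
    AEMeasurable (localEnergy N s u) volume := by
  have hm := (aestronglyMeasurable_diffQuot N s hu).enorm.pow_const (2 : ℝ)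
  rw [Measure.volume_eq_prod] at hm
  exact hm.lintegral_prod_right'

variable (N) in
/-- The volume of the unit ball. -/
def unitBallVolume : ℝ := volume.real (Metric.ball (0 : V) 1)

variable (N) in
lemma unitBallVolume_pos : 0 < unitBallVolume N :=
  ENNReal.toReal_pos (Metric.measure_ball_pos volume _ one_pos).ne' measure_ball_lt_top.ne

lemma volume_ball_eq (x : V) {r : ℝ} (hr : 0 < r) :
    volume (Metric.ball x r) = ENNReal.ofReal (unitBallVolume N * r ^ (N : ℝ)) := by
  rw [Measure.addHaar_ball_of_pos volume x hr, finrank_euclideanSpace, Fintype.card_fin,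
    Real.rpow_natCast, mul_comm, ENNReal.ofReal_mul (unitBallVolume_pos N).le, unitBallVolume,
    ofReal_measureReal measure_ball_lt_top.ne]

lemma volume_ball_rpow (x : V) {r : ℝ} (hr : 0 < r) (e : ℝ) :
    volume (Metric.ball x r) ^ e = ENNReal.ofReal (unitBallVolume N ^ e * r ^ (N * e)) := by
  have := unitBallVolume_pos N
  rw [volume_ball_eq x hr, ENNReal.ofReal_rpow_of_pos (by positivity),
    Real.mul_rpow (by positivity) (by positivity), ← Real.rpow_mul hr.le]

/-- For |x - y| < r, |u(x) - u(y)| is at most r^((N+2s)/2) times the difference quotient. Averaging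
in L² over the ball costs |B|^(-1/2), of order r^(-N/2), and r^s remains. -/
lemma enorm_sub_average_le (hs : 0 < s) {u : V → ℝ} (hu : LocallyIntegrable u volume) (x : V)
    {r : ℝ} (hr : 0 < r) :
    ‖u x - ⨍ y in Metric.ball x r, u y‖ₑ ≤
      ENNReal.ofReal (unitBallVolume N ^ (-(1 / 2) : ℝ) * r ^ s)
        * localEnergy N s u x ^ (1 / 2 : ℝ) := by
  have hω := unitBallVolume_pos N
  have hB0 : volume (Metric.ball x r) ≠ 0 := (Metric.measure_ball_pos volume x hr).ne'
  have hB : volume (Metric.ball x r) ≠ ⊤ := measure_ball_lt_top.ne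
  have hint : IntegrableOn u (Metric.ball x r) :=
    (hu.integrableOn_isCompact (isCompact_closedBall x r)).mono_set Metric.ball_subset_closedBall
  have hconst : IntegrableOn (fun _ => u x) (Metric.ball x r) :=
    integrableOn_const hB
  have e1 : u x - ⨍ y in Metric.ball x r, u y = ⨍ y in Metric.ball x r, (u x - u y) := by
    rw [setAverage_eq, setAverage_eq, integral_sub hconst hint, smul_sub, setIntegral_const,
      smul_smul, inv_mul_cancel₀, one_smul]
    exact (ENNReal.toReal_pos hB0 hB).ne'
  have hexp : 0 < (N : ℝ) + 2 * s := by positivity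
  have e2 : eLpNorm (fun y => u x - u y) 2 (volume.restrict (Metric.ball x r)) ≤
      ENNReal.ofReal (r ^ (((N : ℝ) + 2 * s) / 2)) * localEnergy N s u x ^ (1 / 2 : ℝ) := by
    rw [eLpNorm_eq_lintegral_rpow_enorm_toReal (by norm_num) (by norm_num), ENNReal.toReal_ofNat]
    calc (∫⁻ y in Metric.ball x r, ‖u x - u y‖ₑ ^ (2 : ℝ)) ^ (1 / 2 : ℝ)
        ≤ (∫⁻ y in Metric.ball x r, (ENNReal.ofReal (r ^ (((N : ℝ) + 2 * s) / 2))) ^ (2 : ℝ)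
            * ‖diffQuot N s u (x, y)‖ₑ ^ (2 : ℝ)) ^ (1 / 2 : ℝ) := by
          refine ENNReal.rpow_le_rpow (setLIntegral_mono' Metric.isOpen_ball.measurableSet
            fun y hy => ?_) (by norm_num)
          rw [← ENNReal.mul_rpow_of_nonneg _ _ (by norm_num)]
          refine ENNReal.rpow_le_rpow ?_ (by norm_num)
          rw [← ofReal_norm, ← ofReal_norm, ← ENNReal.ofReal_mul (by positivity)]
          refine ENNReal.ofReal_le_ofReal ?_
          simp only [diffQuot, Real.norm_eq_abs, abs_div]
          rcases eq_or_ne x y with rfl | hxy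
          · simp
          · have hd : 0 < ‖x - y‖ := norm_pos_iff.2 (sub_ne_zero.2 hxy)
            have hdr : ‖x - y‖ ≤ r := by
              rw [← dist_eq_norm, dist_comm]; exact (Metric.mem_ball.1 hy).le
            rw [abs_of_pos (Real.rpow_pos_of_pos hd _), mul_div_assoc', le_div_iff₀
              (Real.rpow_pos_of_pos hd _), mul_comm]
            gcongr
      _ = (ENNReal.ofReal (r ^ (((N : ℝ) + 2 * s) / 2)) ^ (2 : ℝ)
            * ∫⁻ y in Metric.ball x r, ‖diffQuot N s u (x, y)‖ₑ ^ (2 : ℝ)) ^ (1 / 2 : ℝ) := by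
          rw [lintegral_const_mul' _ _ (by finiteness)]
      _ ≤ (ENNReal.ofReal (r ^ (((N : ℝ) + 2 * s) / 2)) ^ (2 : ℝ)
            * localEnergy N s u x) ^ (1 / 2 : ℝ) := by
          gcongr
          exact setLIntegral_le_lintegral _ _
      _ = _ := by
          rw [ENNReal.mul_rpow_of_nonneg _ _ (by norm_num), ← ENNReal.rpow_mul,
            mul_one_div_cancel (by norm_num), ENNReal.rpow_one]
  rw [e1]
  calc ‖⨍ y in Metric.ball x r, (u x - u y)‖ₑ
      ≤ eLpNorm (fun y => u x - u y) 2 (volume.restrict (Metric.ball x r))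
          * volume (Metric.ball x r) ^ (-(1 / (2 : ENNReal).toReal)) :=
        enorm_setAverage_le hB0 hB (by norm_num) (hconst.sub hint).aestronglyMeasurable
    _ ≤ (ENNReal.ofReal (r ^ (((N : ℝ) + 2 * s) / 2)) * localEnergy N s u x ^ (1 / 2 : ℝ))
          * volume (Metric.ball x r) ^ (-(1 / (2 : ENNReal).toReal)) := by gcongr
    _ = _ := by
        rw [volume_ball_rpow x hr, mul_right_comm, ← ENNReal.ofReal_mul (by positivity),
          ENNReal.toReal_ofNat]
        congr 2
        rw [mul_comm, mul_assoc, ← Real.rpow_add hr]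
        congr 2
        ring

lemma abs_average_le {p : ℝ} (hp : 1 ≤ p) {u : V → ℝ} (hu : MemLp u (ENNReal.ofReal p) volume)
    (x : V) {r : ℝ} (hr : 0 < r) :
    |⨍ y in Metric.ball x r, u y| ≤ unitBallVolume N ^ (-(1 / p)) * r ^ (-(N / p))
      * (eLpNorm u (ENNReal.ofReal p) volume).toReal := by
  have hω := unitBallVolume_pos N
  have h := enorm_setAverage_le (μ := volume) (B := Metric.ball x r)
    (Metric.measure_ball_pos volume x hr).ne' measure_ball_lt_top.ne
    (ENNReal.one_le_ofReal.2 hp) hu.1.restrict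
  have h2 : ‖⨍ y in Metric.ball x r, u y‖ₑ ≤ ENNReal.ofReal (unitBallVolume N ^ (-(1 / p))
      * r ^ (-(N / p)) * (eLpNorm u (ENNReal.ofReal p) volume).toReal) := by
    refine h.trans ?_
    rw [volume_ball_rpow x hr, ENNReal.toReal_ofReal (by linarith), mul_comm,
      ENNReal.ofReal_mul (q := ENNReal.toReal _) (by positivity), ENNReal.ofReal_toReal hu.2.ne,
      show (N : ℝ) * -(1 / p) = -(N / p) by ring]
    gcongr
    exact Measure.restrict_le_self
  rw [← ofReal_norm] at h2
  exact (ENNReal.ofReal_le_ofReal_iff (by positivity)).1 h2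

/-- The radius r = (U/D)^(2/n) makes both terms comparable. To include D = 0 it is used with d > D
in place of D, and then d ↓ D. -/
lemma le_interpolation {A D U c₁ c₂ n s : ℝ} (hn : 0 < n) (hsn : 2 * s < n)
    (hc₁ : 0 ≤ c₁) (hD : 0 ≤ D) (hU : 0 < U)
    (h : ∀ r > 0, A ≤ c₁ * r ^ s * D + c₂ * r ^ (-((n - 2 * s) / 2)) * U) :
    A ≤ (c₁ + c₂) * (U ^ (2 * s / n) * D ^ (1 - 2 * s / n)) := by
  have key : ∀ d > D, A ≤ (c₁ + c₂) * (U ^ (2 * s / n) * d ^ (1 - 2 * s / n)) := by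
    intro d hd
    have hd0 : 0 < d := hD.trans_lt hd
    have hq : 0 < U / d := by positivity
    have h1 := h ((U / d) ^ (2 / n)) (by positivity)
    rw [← Real.rpow_mul hq.le, ← Real.rpow_mul hq.le] at h1
    have e1 : (U / d) ^ (2 / n * s) * d = U ^ (2 * s / n) * d ^ (1 - 2 * s / n) := by
      rw [show 2 / n * s = 2 * s / n by ring, Real.div_rpow hU.le hd0.le, Real.rpow_sub hd0,
        Real.rpow_one]
      ring
    have e2 : (U / d) ^ (2 / n * -((n - 2 * s) / 2)) * U = U ^ (2 * s / n) * d ^ (1 - 2 * s / n) := by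
      rw [show 2 / n * -((n - 2 * s) / 2) = -(1 - 2 * s / n) by field_simp, Real.rpow_neg hq.le,
        Real.div_rpow hU.le hd0.le, inv_div, div_mul_eq_mul_div, mul_div_assoc, mul_comm]
      congr 1
      rw [div_eq_iff (by positivity), ← Real.rpow_add hU, add_sub_cancel, Real.rpow_one]
    have h2 : c₁ * (U / d) ^ (2 / n * s) * D ≤ c₁ * (U / d) ^ (2 / n * s) * d := by gcongr
    calc A ≤ _ := h1
      _ ≤ c₁ * (U / d) ^ (2 / n * s) * d + c₂ * (U / d) ^ (2 / n * -((n - 2 * s) / 2)) * U := by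
        linarith
      _ = _ := by rw [mul_assoc, e1, mul_assoc, e2]; ring
  have hexp : 0 < 1 - 2 * s / n := by
    rw [sub_pos, div_lt_one hn]; exact hsn
  have hcont : Continuous fun d : ℝ => (c₁ + c₂) * (U ^ (2 * s / n) * d ^ (1 - 2 * s / n)) := by
    have : Continuous fun d : ℝ => d ^ (1 - 2 * s / n) :=
      continuous_id.rpow_const fun _ => Or.inr hexp.le
    fun_prop
  refine ge_of_tendsto ((hcont.tendsto D).mono_left nhdsWithin_le_nhds : Tendsto _ (𝓝[>] D) _) ?_
  filter_upwards [self_mem_nhdsWithin] with d hd using key d hd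

lemma critExp_gt_two (hs : 0 < s) (hN : 2 * s < N) : 2 < critExp N s := by
  rw [critExp, lt_div_iff₀ (by linarith)]
  linarith

lemma locallyIntegrable_of_memLp {p : ENNReal} (hp : 1 ≤ p) {u : V → ℝ} (hu : MemLp u p volume) :
    LocallyIntegrable u volume := fun x =>
  ⟨Metric.ball x 1, Metric.ball_mem_nhds x one_pos, by
    have : IsFiniteMeasure (volume.restrict (Metric.ball x 1)) :=
      ⟨by rw [Measure.restrict_apply_univ]; exact measure_ball_lt_top⟩
    exact (hu.restrict _).integrable hp⟩

/-- The fractional Sobolev inequality. -/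
theorem exists_sobolev_const (hs : 0 < s) (hN : 2 * s < N) : ∃ C > 0, ∀ u : V → ℝ,
    MemLp u (ENNReal.ofReal (critExp N s)) volume → MemLp (diffQuot N s u) 2 volume →
    (eLpNorm u (ENNReal.ofReal (critExp N s)) volume).toReal
      ≤ C * (eLpNorm (diffQuot N s u) 2 volume).toReal := by
  have hω := unitBallVolume_pos N
  have hp2 := critExp_gt_two hs hN
  set p := critExp N s with hp
  have hn : (0 : ℝ) < N := by linarith
  set c := unitBallVolume N ^ (-(1 / 2) : ℝ) + unitBallVolume N ^ (-(1 / p)) with hc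
  have hc0 : 0 < c := by positivity
  refine ⟨c ^ (p / 2), by positivity, fun u hu hd => ?_⟩
  set U := (eLpNorm u (ENNReal.ofReal p) volume).toReal with hU
  set G := (eLpNorm (diffQuot N s u) 2 volume).toReal with hG
  have hG0 : 0 ≤ G := ENNReal.toReal_nonneg
  have hUnn : 0 ≤ U := ENNReal.toReal_nonneg
  rcases hUnn.eq_or_lt with hU0 | hU0
  · rw [← hU0]; positivity
  have hloc := locallyIntegrable_of_memLp (ENNReal.one_le_ofReal.2 (by linarith)) hu
  have hLE : ∫⁻ x, localEnergy N s u x = ENNReal.ofReal (G ^ 2) := by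
    rw [lintegral_localEnergy hu.1, ENNReal.ofReal_pow hG0, hG, ENNReal.ofReal_toReal hd.2.ne,
      ENNReal.rpow_two]
  have hfin : ∀ᵐ x : V, localEnergy N s u x < ⊤ :=
    ae_lt_top' (aemeasurable_localEnergy hu.1) (by rw [hLE]; exact ENNReal.ofReal_ne_top)
  have hθ : N / p = ((N : ℝ) - 2 * s) / 2 := by
    rw [hp, critExp]
    have : (N : ℝ) - 2 * s ≠ 0 := by linarith
    field_simp
  -- A Hedberg-type pointwise bound. With p critical, (1 - 2s/N)p = 2, so the p-th power is linear
  -- in the local energy and can be integrated.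
  have hpt : ∀ᵐ x : V, ‖u x‖ₑ ^ p
      ≤ ENNReal.ofReal (c ^ p * U ^ (2 * s / N * p)) * localEnergy N s u x := by
    filter_upwards [hfin] with x hx
    set D := Real.sqrt (localEnergy N s u x).toReal with hD
    have hbound : |u x| ≤ c * (U ^ (2 * s / N) * D ^ (1 - 2 * s / N)) := by
      refine le_interpolation hn hN (by positivity) (Real.sqrt_nonneg _) hU0 fun r hr => ?_
      have h1 := enorm_sub_average_le hs hloc x hr
      have h2 := abs_average_le (by linarith) hu x hr
      rw [hθ] at h2
      have h3 : |u x - ⨍ y in Metric.ball x r, u y| ≤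
          unitBallVolume N ^ (-(1 / 2) : ℝ) * r ^ s * D := by
        have e : localEnergy N s u x ^ (1 / 2 : ℝ) = ENNReal.ofReal D := by
          rw [hD, Real.sqrt_eq_rpow, ← ENNReal.ofReal_rpow_of_nonneg (by positivity) (by norm_num),
            ENNReal.ofReal_toReal hx.ne]
        rw [e, ← ENNReal.ofReal_mul (by positivity), ← ofReal_norm] at h1
        exact (ENNReal.ofReal_le_ofReal_iff (by positivity)).1 h1
      calc |u x| = |(u x - ⨍ y in Metric.ball x r, u y) + ⨍ y in Metric.ball x r, u y| := by
            rw [sub_add_cancel]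
        _ ≤ _ := (abs_add_le _ _).trans (add_le_add h3 h2)
    have e1 : |u x| ^ p ≤ c ^ p * U ^ (2 * s / N * p) * (localEnergy N s u x).toReal := by
      have hD0 : 0 ≤ D := Real.sqrt_nonneg _
      refine (Real.rpow_le_rpow (abs_nonneg _) hbound (by linarith)).trans_eq ?_
      rw [Real.mul_rpow hc0.le (by positivity), Real.mul_rpow (by positivity) (by positivity),
        ← Real.rpow_mul hU0.le, ← Real.rpow_mul hD0, mul_assoc]
      congr 2
      have : (1 - 2 * s / N) * p = 2 := by
        rw [hp, critExp]
        have : (N : ℝ) - 2 * s ≠ 0 := by linarith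
        field_simp
      rw [this, Real.rpow_two, hD, Real.sq_sqrt ENNReal.toReal_nonneg]
    rw [← ofReal_norm, ENNReal.ofReal_rpow_of_nonneg (norm_nonneg _) (by linarith),
      ← ENNReal.ofReal_toReal hx.ne, ← ENNReal.ofReal_mul (by positivity)]
    exact ENNReal.ofReal_le_ofReal e1
  have hmain : U ^ p ≤ c ^ p * U ^ (2 * s / N * p) * G ^ 2 := by
    have h1 : ENNReal.ofReal (U ^ p) = ∫⁻ x, ‖u x‖ₑ ^ p := by
      rw [← ENNReal.ofReal_rpow_of_nonneg hU0.le (by linarith), hU, ENNReal.ofReal_toReal hu.2.ne,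
        eLpNorm_eq_lintegral_rpow_enorm_toReal (by simp; linarith) ENNReal.ofReal_ne_top,
        ENNReal.toReal_ofReal (by linarith), ← ENNReal.rpow_mul, one_div_mul_cancel (by linarith),
        ENNReal.rpow_one]
    have h2 : ENNReal.ofReal (U ^ p) ≤ ENNReal.ofReal (c ^ p * U ^ (2 * s / N * p) * G ^ 2) := by
      rw [h1]
      refine (lintegral_mono_ae hpt).trans_eq ?_
      rw [lintegral_const_mul' _ _ ENNReal.ofReal_ne_top, hLE, ← ENNReal.ofReal_mul (by positivity)]
    exact (ENNReal.ofReal_le_ofReal_iff (by positivity)).1 h2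
  -- This lets the factor U^(2sp/N) be cancelled from both sides, leaving U² against G². The case U
  -- = 0 was treated separately, so the division is legitimate.
  have hpp : p = 2 * s / N * p + 2 := by
    rw [hp, critExp]
    have : (N : ℝ) - 2 * s ≠ 0 := by linarith
    field_simp
    ring
  have hsq : U ^ 2 ≤ (c ^ (p / 2) * G) ^ 2 := by
    have e1 : U ^ p = U ^ (2 * s / N * p) * U ^ 2 := by
      conv_lhs => rw [hpp, Real.rpow_add hU0, Real.rpow_two]
    have e2 : (c ^ (p / 2)) ^ 2 = c ^ p := by
      rw [← Real.rpow_natCast, ← Real.rpow_mul hc0.le]; congr 1; push_cast; ring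
    rw [mul_pow, e2]
    rw [e1] at hmain
    refine le_of_mul_le_mul_left ?_ (by positivity : 0 < U ^ (2 * s / N * p))
    linarith
  exact (sq_le_sq₀ hU0.le (by positivity)).1 hsq

end Averages

/-! ## Compactness -/

/-- Bounded sequences in `L^p` have subsequences along which all integrals over sets of finite
measure converge. -/
lemma exists_subseq_tendsto_setIntegral {α : Type*} [MeasurableSpace α] {μ : Measure α}
    [IsSeparable μ] {p : ℝ} [Fact (1 < p)]
    (u : ℕ → Lp ℝ (ENNReal.ofReal p) μ) {M : ℝ} (hM : ∀ n, ‖u n‖ ≤ M) :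
    ∃ k : ℕ → ℕ, StrictMono k ∧ ∀ B, MeasurableSet B → μ B ≠ ⊤ →
      ∃ c, Tendsto (fun n => ∫ x in B, u (k n) x ∂μ) atTop (𝓝 c) := by
  have : Fact (ENNReal.ofReal p.conjExponent ≠ ⊤) := ⟨ENNReal.ofReal_ne_top⟩
  -- The functions are viewed as functionals on the separable space L^(p'). Sequential
  -- Banach-Alaoglu gives a weak-* convergent subsequence, which is then tested on indicators.
  set Q := ((ContinuousLinearMap.mul ℝ ℝ).lpPairing μ (ENNReal.ofReal p.conjExponent)
    (ENNReal.ofReal p)).flip with hQ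
  obtain ⟨ℓ, -, k, hk, hlim⟩ := WeakDual.isSeqCompact_closedBall ℝ
    (Lp ℝ (ENNReal.ofReal p.conjExponent) μ) 0 (‖Q‖ * M)
    (x := fun n => StrongDual.toWeakDual (Q (u n))) (fun n => by
      change dist (Q (u n)) 0 ≤ _
      rw [dist_zero_right]
      exact (Q.le_opNorm _).trans (by gcongr; exact hM n))
  refine ⟨k, hk, fun B hB hBt => ⟨ℓ (indicatorConstLp _ hB hBt 1), ?_⟩⟩
  have h1 := ((WeakDual.eval_continuous (indicatorConstLp (ENNReal.ofReal p.conjExponent)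
    hB hBt (1 : ℝ))).tendsto ℓ).comp hlim
  refine h1.congr fun n => ?_
  change Q (u (k n)) (indicatorConstLp _ hB hBt 1) = _
  rw [hQ, ContinuousLinearMap.flip_apply, ContinuousLinearMap.lpPairing_eq_integral,
    ← integral_indicator hB]
  refine integral_congr_ae ?_
  filter_upwards [indicatorConstLp_coeFn (p := ENNReal.ofReal p.conjExponent) (hs := hB)
    (hμs := hBt) (c := (1 : ℝ))] with x hx
  rw [hx]
  by_cases hxB : x ∈ B <;> simp [hxB]

/-! ### Approximation by ball averages and the Rellich theorem. -/

section Rellich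

variable {N : ℕ} {s : ℝ}

lemma stronglyMeasurable_average {u : EuclideanSpace ℝ (Fin N) → ℝ} (hu : StronglyMeasurable u)
    (r : ℝ) : StronglyMeasurable fun x => ⨍ y in Metric.ball x r, u y := by
  have h1 : (fun x => ⨍ y in Metric.ball x r, u y) = fun x =>
      ((volume.real (Metric.ball (0 : EuclideanSpace ℝ (Fin N)) r))⁻¹ *
        ∫ y, (Metric.ball x r).indicator u y) := by
    funext x
    rw [setAverage_eq, smul_eq_mul, integral_indicator Metric.isOpen_ball.measurableSet,
      measureReal_def, measureReal_def, Measure.addHaar_ball_center]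
  rw [h1]
  refine StronglyMeasurable.const_mul ?_ _
  have h2 : StronglyMeasurable fun z : EuclideanSpace ℝ (Fin N) × EuclideanSpace ℝ (Fin N) =>
      (Metric.ball z.1 r).indicator u z.2 := by
    have h3 : (fun z : EuclideanSpace ℝ (Fin N) × EuclideanSpace ℝ (Fin N) =>
        (Metric.ball z.1 r).indicator u z.2)
        = {z : EuclideanSpace ℝ (Fin N) × EuclideanSpace ℝ (Fin N) | dist z.2 z.1 < r}.indicator
          (fun z => u z.2) := by
      funext z
      by_cases hz : dist z.2 z.1 < r <;> simp [indicator, Metric.mem_ball, hz]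
    rw [h3]
    exact (hu.comp_measurable measurable_snd).indicator
      (measurableSet_lt (by fun_prop) measurable_const)
  exact h2.integral_prod_right'

lemma eLpNorm_sub_average_le (hs : 0 < s) {u : EuclideanSpace ℝ (Fin N) → ℝ}
    (hum : AEStronglyMeasurable u volume)
    (hu : LocallyIntegrable u volume) {r : ℝ} (hr : 0 < r) :
    eLpNorm (fun x => u x - ⨍ y in Metric.ball x r, u y) 2 volume ≤
      ENNReal.ofReal (unitBallVolume N ^ (-(1 / 2) : ℝ) * r ^ s)
        * eLpNorm (diffQuot N s u) 2 volume := by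
  rw [eLpNorm_eq_lintegral_rpow_enorm_toReal (by norm_num) (by norm_num), ENNReal.toReal_ofNat]
  set c := ENNReal.ofReal (unitBallVolume N ^ (-(1 / 2) : ℝ) * r ^ s) with hc
  calc (∫⁻ x, ‖u x - ⨍ y in Metric.ball x r, u y‖ₑ ^ (2 : ℝ)) ^ (1 / 2 : ℝ)
      ≤ (∫⁻ x, c ^ (2 : ℝ) * localEnergy N s u x) ^ (1 / 2 : ℝ) := by
        refine ENNReal.rpow_le_rpow (lintegral_mono fun x => ?_) (by norm_num)
        refine (ENNReal.rpow_le_rpow (enorm_sub_average_le hs hu x hr) (by norm_num)).trans_eq ?_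
        rw [ENNReal.mul_rpow_of_nonneg _ _ (by norm_num), ← ENNReal.rpow_mul,
          one_div_mul_cancel (by norm_num), ENNReal.rpow_one]
    _ = (c ^ (2 : ℝ) * eLpNorm (diffQuot N s u) 2 volume ^ (2 : ℝ)) ^ (1 / 2 : ℝ) := by
        rw [lintegral_const_mul' _ _ (ENNReal.rpow_ne_top_of_nonneg (by norm_num)
          ENNReal.ofReal_ne_top), lintegral_localEnergy hum]
    _ = _ := by
        rw [← ENNReal.mul_rpow_of_nonneg _ _ (by norm_num), ← ENNReal.rpow_mul,
          mul_one_div_cancel (by norm_num), ENNReal.rpow_one]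

lemma eLpNorm_le_of_le_smul {α : Type*} [MeasurableSpace α] {μ ν : Measure α} {c : ENNReal}
    (hμ : μ ≤ c • ν) {p : ENNReal} (hp : p ≠ ⊤) (u : α → ℝ) :
    eLpNorm u p μ ≤ c ^ (1 / p).toReal * eLpNorm u p ν := by
  refine (eLpNorm_mono_measure u hμ).trans_eq ?_
  rw [eLpNorm_smul_measure_of_ne_top hp, smul_eq_mul]

/-- The fractional Rellich theorem, for finite measures with bounded density. -/
theorem exists_subseq_ae_tendsto (hs : 0 < s) {μ : Measure (EuclideanSpace ℝ (Fin N))}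
    [IsFiniteMeasure μ] {c : ENNReal} (hc : c ≠ ⊤) (hμ : μ ≤ c • volume) {p : ℝ} [Fact (1 < p)]
    (u : ℕ → Lp ℝ (ENNReal.ofReal p) (volume : Measure (EuclideanSpace ℝ (Fin N))))
    {M : ℝ} (hM : ∀ n, ‖u n‖ ≤ M)
    (hM' : ∀ n, eLpNorm (diffQuot N s (u n)) 2 volume ≤ ENNReal.ofReal M) :
    ∃ k : ℕ → ℕ, StrictMono k ∧ ∃ v : EuclideanSpace ℝ (Fin N) → ℝ,
      ∀ᵐ x ∂μ, Tendsto (fun n => u (k n) x) atTop (𝓝 (v x)) := by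
  have hp1 : 1 < p := Fact.out
  have hω := unitBallVolume_pos N
  have hac : μ ≪ volume := (Measure.absolutelyContinuous_of_le hμ).trans
    Measure.smul_absolutelyContinuous
  obtain ⟨k, hk, hlim⟩ := exists_subseq_tendsto_setIntegral u hM
  have hloc : ∀ n, LocallyIntegrable (u n) volume := fun n =>
    locallyIntegrable_of_memLp (ENNReal.one_le_ofReal.2 hp1.le) (Lp.memLp (u n))
  set A : ℝ → ℕ → EuclideanSpace ℝ (Fin N) → ℝ :=
    fun r n x => ⨍ y in Metric.ball x r, u (k n) y with hA
  have hAm : ∀ r n, StronglyMeasurable (A r n) := fun r n =>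
    stronglyMeasurable_average (Lp.stronglyMeasurable _) r
  have hAlim : ∀ r > 0, ∃ a : EuclideanSpace ℝ (Fin N) → ℝ, ∀ x,
      Tendsto (fun n => A r n x) atTop (𝓝 (a x)) := by
    intro r hr
    have : ∀ x : EuclideanSpace ℝ (Fin N), ∃ a, Tendsto (fun n => A r n x) atTop (𝓝 a) := by
      intro x
      obtain ⟨b, hb⟩ := hlim (Metric.ball x r) Metric.isOpen_ball.measurableSet
        measure_ball_lt_top.ne
      refine ⟨(volume.real (Metric.ball x r))⁻¹ • b, ?_⟩
      simp only [hA, setAverage_eq]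
      exact hb.const_smul _
    choose a ha using this
    exact ⟨a, ha⟩
  have hAconv : ∀ r > 0, ∃ a : EuclideanSpace ℝ (Fin N) → ℝ, AEStronglyMeasurable a μ ∧
      Tendsto (fun n => eLpNorm (A r n - a) 1 μ) atTop (𝓝 0) := by
    intro r hr
    obtain ⟨a, ha⟩ := hAlim r hr
    refine ⟨a, aestronglyMeasurable_of_tendsto_ae atTop
      (fun n => (hAm r n).aestronglyMeasurable) (ae_of_all _ ha), ?_⟩
    set K := unitBallVolume N ^ (-(1 / p)) * r ^ (-(N / p)) * M with hK
    have hAb : ∀ n, eLpNorm (A r n) (ENNReal.ofReal 2) μ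
        ≤ μ univ ^ (ENNReal.ofReal 2).toReal⁻¹ * ENNReal.ofReal K := fun n => by
      refine eLpNorm_le_of_ae_bound (ae_of_all _ fun x => ?_)
      rw [Real.norm_eq_abs]
      refine (abs_average_le hp1.le (Lp.memLp (u (k n))) x hr).trans ?_
      rw [hK]
      gcongr
      exact hM (k n)
    -- At fixed radius the averages are bounded uniformly in x and n, so their pointwise convergence
    -- improves to L¹(μ). The exponent 2 only has to exceed 1.
    exact tendsto_eLpNorm_comp_sub (φ := fun t => t) (p := 2) (m := 1) continuous_id one_pos
      ⟨1, zero_le_one, fun t => by simp⟩ le_rfl (by norm_num)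
      (fun n => (hAm r n).aestronglyMeasurable) (by finiteness) hAb (ae_of_all _ ha)
  -- The approximation error is O(r^s) uniformly in n, by the seminorm bound and the bounded density
  -- of μ.
  have happrox : ∀ ε : ENNReal, ε ≠ 0 → ∃ r > 0, ∀ n, eLpNorm (⇑(u (k n)) - A r n) 1 μ ≤ ε := by
    intro ε hε
    set L : ENNReal := c ^ (1 / (2 : ENNReal)).toReal * ENNReal.ofReal M
      * μ univ ^ (1 / (1 : ENNReal).toReal - 1 / (2 : ENNReal).toReal) with hL
    have hLt : L ≠ ⊤ := by
      have : (0 : ℝ) ≤ 1 / (1 : ENNReal).toReal - 1 / (2 : ENNReal).toReal := by norm_num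
      finiteness
    have hbound : ∀ r > 0, ∀ n, eLpNorm (⇑(u (k n)) - A r n) 1 μ
        ≤ ENNReal.ofReal (unitBallVolume N ^ (-(1 / 2) : ℝ) * r ^ s) * L := by
      intro r hr n
      have hmeas : AEStronglyMeasurable (⇑(u (k n)) - A r n) volume :=
        (Lp.aestronglyMeasurable _).sub (hAm r n).aestronglyMeasurable
      calc eLpNorm (⇑(u (k n)) - A r n) 1 μ
          ≤ eLpNorm (⇑(u (k n)) - A r n) 2 μ
              * μ univ ^ (1 / (1 : ENNReal).toReal - 1 / (2 : ENNReal).toReal) :=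
            eLpNorm_le_eLpNorm_mul_rpow_measure_univ (by norm_num) (hmeas.mono_ac hac)
        _ ≤ (c ^ (1 / (2 : ENNReal)).toReal *
              (ENNReal.ofReal (unitBallVolume N ^ (-(1 / 2) : ℝ) * r ^ s) * ENNReal.ofReal M))
              * μ univ ^ (1 / (1 : ENNReal).toReal - 1 / (2 : ENNReal).toReal) := by
            gcongr
            refine (eLpNorm_le_of_le_smul hμ (by norm_num) _).trans ?_
            gcongr
            refine (eLpNorm_sub_average_le hs (Lp.aestronglyMeasurable _) (hloc _) hr).trans ?_
            gcongr
            exact hM' (k n)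
        _ = _ := by rw [hL]; ring
    have htend : Tendsto (fun r : ℝ =>
        ENNReal.ofReal (unitBallVolume N ^ (-(1 / 2) : ℝ) * r ^ s) * L) (𝓝[>] 0) (𝓝 0) := by
      have h1 : Tendsto (fun r : ℝ => unitBallVolume N ^ (-(1 / 2) : ℝ) * r ^ s) (𝓝[>] 0) (𝓝 0) := by
        have : Tendsto (fun r : ℝ => unitBallVolume N ^ (-(1 / 2) : ℝ) * r ^ s) (𝓝 0)
            (𝓝 (unitBallVolume N ^ (-(1 / 2) : ℝ) * 0 ^ s)) :=
          ((Real.continuousAt_rpow_const 0 s (Or.inr hs.le)).tendsto).const_mul _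
        rw [Real.zero_rpow hs.ne', mul_zero] at this
        exact this.mono_left nhdsWithin_le_nhds
      have h2 := ENNReal.Tendsto.mul_const (b := L) (ENNReal.tendsto_ofReal h1) (Or.inr hLt)
      simpa using h2
    obtain ⟨r, hr1, hr2⟩ := ((htend.eventually_le_const (pos_iff_ne_zero.2 hε)).and
      self_mem_nhdsWithin).exists
    exact ⟨r, hr2, fun n => (hbound r hr2 n).trans hr1⟩
  have hmem : ∀ n, MemLp (u (k n)) 1 μ := fun n =>
    MemLp.mono_exponent (q := ENNReal.ofReal p)
      ⟨(Lp.aestronglyMeasurable _).mono_ac hac,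
        (eLpNorm_le_of_le_smul hμ ENNReal.ofReal_ne_top _).trans_lt
          (ENNReal.mul_lt_top (by finiteness) (Lp.memLp (u (k n))).2)⟩
      (ENNReal.one_le_ofReal.2 hp1.le)
  -- With r fixed independently of n, two functions differ by two approximation errors and two
  -- convergence errors. Taking each at most ε/5 keeps the total strictly below ε.
  have hcauchy : CauchySeq fun n => (hmem n).toLp (u (k n)) := by
    rw [EMetric.cauchySeq_iff]
    intro ε hε
    have hε5 : ε / 5 ≠ 0 := (ENNReal.div_pos hε.ne' (by norm_num)).ne'
    by_cases hεt : ε = ⊤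
    · refine ⟨0, fun m _ n _ => ?_⟩
      rw [hεt]
      exact edist_lt_top _ _
    obtain ⟨r, hr, hr'⟩ := happrox (ε / 5) hε5
    obtain ⟨a, ham, ha⟩ := hAconv r hr
    obtain ⟨n₀, hn₀⟩ := eventually_atTop.1 (ha.eventually_le_const (pos_iff_ne_zero.2 hε5))
    have hclose : ∀ n ≥ n₀, eLpNorm (⇑(u (k n)) - a) 1 μ ≤ ε / 5 + ε / 5 := fun n hn => by
      have : ⇑(u (k n)) - a = (⇑(u (k n)) - A r n) + (A r n - a) := by abel
      rw [this]
      exact (eLpNorm_add_le ((hmem n).1.sub (hAm r n).aestronglyMeasurable)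
        ((hAm r n).aestronglyMeasurable.sub ham) le_rfl).trans
        (add_le_add (hr' n) (hn₀ n hn))
    refine ⟨n₀, fun m hm n hn => ?_⟩
    rw [Lp.edist_toLp_toLp]
    have : ⇑(u (k m)) - ⇑(u (k n)) = (⇑(u (k m)) - a) - (⇑(u (k n)) - a) := by abel
    rw [this]
    refine ((eLpNorm_sub_le ((hmem m).1.sub ham) ((hmem n).1.sub ham) le_rfl).trans
      (add_le_add (hclose m hm) (hclose n hn))).trans_lt ?_
    have e : ε / 5 + ε / 5 + (ε / 5 + ε / 5) = ε * (4 / 5) := by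
      simp only [div_eq_mul_inv]
      ring
    rw [e]
    calc ε * (4 / 5) < ε * 1 := by
          refine ENNReal.mul_lt_mul_right hε.ne' hεt ?_
          rw [ENNReal.div_lt_iff (by norm_num) (by norm_num)]
          norm_num
      _ = ε := mul_one _
  obtain ⟨v, hv⟩ := cauchySeq_tendsto_of_complete hcauchy
  obtain ⟨j, hj, hjv⟩ := (tendstoInMeasure_of_tendsto_Lp hv).exists_seq_tendsto_ae
  refine ⟨k ∘ j, hk.comp hj, v, ?_⟩
  have hcoe : ∀ᵐ x ∂μ, ∀ n, (hmem n).toLp (u (k n)) x = u (k n) x :=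
    ae_all_iff.2 fun n => (hmem n).coeFn_toLp
  filter_upwards [hjv, hcoe] with x hx hx'
  simp only [hx'] at hx
  exact hx

end Rellich

/-! ## The Gagliardo space as a Hilbert space -/

namespace GagliardoSpace

variable {N : ℕ} {s : ℝ} {hs : 0 < s} {hN : 2 * s < N}

lemma norm_toLp_nonneg (u : GagliardoSpace hs hN) : 0 ≤ ‖toLp u‖ := ENNReal.toReal_nonneg

/-- The difference quotient, as an isometric image of the seminorm in `L²`. -/
def quot : GagliardoSpace hs hN →L[ℝ]
    Lp ℝ 2 (volume : Measure (EuclideanSpace ℝ (Fin N) × EuclideanSpace ℝ (Fin N))) :=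
  LinearMap.mkContinuous
    { toFun := fun u => (memLp_diffQuot u).toLp _
      map_add' := fun u v => by
        rw [← MemLp.toLp_add, MemLp.toLp_eq_toLp_iff, ← diffQuot_add]
        exact diffQuot_congr N s (coe_add u v)
      map_smul' := fun c u => by
        rw [RingHom.id_apply, ← MemLp.toLp_const_smul, MemLp.toLp_eq_toLp_iff, ← diffQuot_smul]
        exact diffQuot_congr N s (coe_smul c u) } 1 fun u => by
    have h1 := (memLp_diffQuot u).1
    change ‖(memLp_diffQuot u).toLp _‖ ≤ _
    rw [Lp.norm_toLp, one_mul, norm_def, seminorm_eq, toReal_eLpNorm h1]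
    exact le_add_of_nonneg_right (norm_toLp_nonneg u)

lemma quot_coe (u : GagliardoSpace hs hN) : quot u =ᵐ[volume] diffQuot N s u :=
  (memLp_diffQuot u).coeFn_toLp

lemma norm_quot (u : GagliardoSpace hs hN) : ‖quot u‖ = gagliardoSeminorm N s u := by
  change ‖(memLp_diffQuot u).toLp _‖ = _
  rw [Lp.norm_toLp, seminorm_eq, toReal_eLpNorm (memLp_diffQuot u).1]

lemma inner_quot (u v : GagliardoSpace hs hN) :
    inner ℝ (quot u) (quot v) = gagliardoForm N s u v := by
  rw [L2.inner_def, gagliardoForm]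
  refine integral_congr_ae ?_
  filter_upwards [quot_coe u, quot_coe v] with z h1 h2
  rw [h1, h2]
  simp only [diffQuot, gagliardoIntegrand, RCLike.inner_apply, conj_trivial]
  rw [div_mul_div_comm, ← Real.rpow_add_of_nonneg (norm_nonneg _), add_halves, mul_comm]
  all_goals positivity

lemma norm_toLp_le_norm (u : GagliardoSpace hs hN) : ‖toLp u‖ ≤ ‖u‖ := by
  rw [norm_def]
  exact le_add_of_nonneg_left (Real.sqrt_nonneg _)

lemma eLpNorm_diffQuot_le {M : ℝ} {u : GagliardoSpace hs hN} (hu : ‖u‖ ≤ M) :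
    eLpNorm (diffQuot N s u) 2 volume ≤ ENNReal.ofReal M := by
  rw [← ENNReal.ofReal_toReal (memLp_diffQuot u).2.ne, toReal_eLpNorm (memLp_diffQuot u).1,
    ← seminorm_eq]
  refine ENNReal.ofReal_le_ofReal (le_trans ?_ hu)
  rw [norm_def]
  exact le_add_of_nonneg_right (norm_toLp_nonneg u)

variable (hs hN) in
-- The Sobolev inequality makes the seminorm an equivalent norm; this is the coercivity of the
-- Gagliardo form.
lemma exists_norm_le_seminorm : ∃ C > 0, ∀ u : GagliardoSpace hs hN,
    ‖u‖ ≤ C * gagliardoSeminorm N s u := by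
  obtain ⟨C, hC, h⟩ := exists_sobolev_const hs hN
  refine ⟨1 + C, by positivity, fun u => ?_⟩
  have := h (toLp u) (Lp.memLp _) (memLp_diffQuot u)
  rw [toReal_eLpNorm (memLp_diffQuot u).1, ← seminorm_eq] at this
  rw [norm_def, add_mul, one_mul]
  exact add_le_add le_rfl this

/-- A Cauchy sequence has a limit in the Lebesgue space, and its difference quotients have a limit
in L². A.e. convergence along a common subsequence identifies the second limit as the quotient of
the first. -/
instance : CompleteSpace (GagliardoSpace hs hN) := by
  have hfact : Fact (1 ≤ ENNReal.ofReal (critExp N s)) := ⟨one_le_ofReal_critExp hs hN⟩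
  refine Metric.complete_of_cauchySeq_tendsto fun u hu => ?_
  have hL : CauchySeq fun n => toLp (u n) := by
    rw [Metric.cauchySeq_iff] at hu ⊢
    intro ε hε
    obtain ⟨n₀, h⟩ := hu ε hε
    refine ⟨n₀, fun m hm n hn => lt_of_le_of_lt ?_ (h m hm n hn)⟩
    rw [dist_eq_norm, dist_eq_norm]
    exact norm_toLp_le_norm (u m - u n)
  obtain ⟨U, hU⟩ := cauchySeq_tendsto_of_complete hL
  obtain ⟨H, hH⟩ := cauchySeq_tendsto_of_complete (u := fun n => quot (u n))
    (hu.map (quot (hs := hs) (hN := hN)).uniformContinuous)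
  obtain ⟨k, hk, hkU⟩ := (tendstoInMeasure_of_tendsto_Lp hU).exists_seq_tendsto_ae
  obtain ⟨j, hj, hjH⟩ := (tendstoInMeasure_of_tendsto_Lp
    (hH.comp hk.tendsto_atTop)).exists_seq_tendsto_ae
  have hae : H =ᵐ[volume] diffQuot N s U := by
    have h1 : ∀ᵐ z : EuclideanSpace ℝ (Fin N) × EuclideanSpace ℝ (Fin N),
        Tendsto (fun n => toLp (u (k n)) z.1) atTop (𝓝 (U z.1)) :=
      Measure.quasiMeasurePreserving_fst.ae hkU
    have h2 : ∀ᵐ z : EuclideanSpace ℝ (Fin N) × EuclideanSpace ℝ (Fin N),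
        Tendsto (fun n => toLp (u (k n)) z.2) atTop (𝓝 (U z.2)) :=
      Measure.quasiMeasurePreserving_snd.ae hkU
    have h3 : ∀ᵐ z, ∀ n, quot (u n) z = diffQuot N s (u n) z :=
      ae_all_iff.2 fun n => quot_coe (u n)
    filter_upwards [h1, h2, h3, hjH] with z hz1 hz2 hz3 hz4
    simp only [Function.comp_apply, hz3] at hz4
    exact tendsto_nhds_unique hz4
      (((hz1.sub hz2).div_const _).comp hj.tendsto_atTop)
  have hmem : U ∈ gagliardoSubmodule N s :=
    (memLp_diffQuot_iff N s (Lp.aestronglyMeasurable _)).1 ((memLp_congr_ae hae).1 (Lp.memLp H))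
  set v : GagliardoSpace hs hN := (⟨U, hmem⟩ : gagliardoSubmodule N s) with hv
  have hqv : quot v = H := by
    refine Lp.ext ?_
    exact (quot_coe v).trans hae.symm
  refine ⟨v, ?_⟩
  rw [tendsto_iff_norm_sub_tendsto_zero]
  have e : ∀ n, ‖u n - v‖ = ‖quot (u n) - H‖ + ‖toLp (u n) - U‖ := fun n => by
    rw [norm_def, ← norm_quot, map_sub, hqv]
    rfl
  simp only [e]
  simpa using (tendsto_iff_norm_sub_tendsto_zero.1 hH).add (tendsto_iff_norm_sub_tendsto_zero.1 hU)

end GagliardoSpace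

/-! ## Test functions -/

section TestFunctions

variable {N : ℕ} {s : ℝ}

/-- The radial kernel which dominates the difference quotients of a test function. -/
lemma integrable_kernel (hs0 : 0 < s) (hs1 : s < 1) (hN : 0 < N) {L M : ℝ} (hL : 0 ≤ L)
    (hM : 0 ≤ M) : Integrable (fun x : EuclideanSpace ℝ (Fin N) =>
      min (L * ‖x‖ ^ 2) M / ‖x‖ ^ ((N : ℝ) + 2 * s)) volume := by
  have : Nonempty (Fin N) := ⟨⟨0, hN⟩⟩
  have hmeas : Measurable fun t : ℝ =>
      t ^ (N - 1) • (min (L * t ^ 2) M / t ^ ((N : ℝ) + 2 * s)) := by fun_prop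
  have hpow : ∀ t : ℝ, 0 < t → t ^ (N - 1) = t ^ ((N : ℝ) - 1) := fun t ht => by
    rw [← Real.rpow_natCast, Nat.cast_sub hN, Nat.cast_one]
  rw [integrable_fun_norm_addHaar volume
    (f := fun t : ℝ => min (L * t ^ 2) M / t ^ ((N : ℝ) + 2 * s)), finrank_euclideanSpace,
    Fintype.card_fin, ← Ioc_union_Ioi_eq_Ioi (zero_le_one (α := ℝ)), integrableOn_union]
  -- In polar coordinates the integrand is at most Lt^(1-2s) near 0, integrable because s < 1, and
  -- at most Mt^(-1-2s) at infinity, integrable because s > 0.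
  constructor
  · have h1 : IntegrableOn (fun t : ℝ => L * t ^ (1 - 2 * s)) (Ioc 0 1) :=
      ((intervalIntegrable_iff_integrableOn_Ioc_of_le zero_le_one).1
        (intervalIntegral.intervalIntegrable_rpow' (by linarith))).const_mul L
    refine Integrable.mono' h1 hmeas.aestronglyMeasurable
      ((ae_restrict_iff' measurableSet_Ioc).2 (ae_of_all _ fun t ht => ?_))
    have ht0 : 0 < t := ht.1
    rw [Real.norm_of_nonneg (by positivity), smul_eq_mul, hpow t ht0]
    calc t ^ ((N : ℝ) - 1) * (min (L * t ^ 2) M / t ^ ((N : ℝ) + 2 * s))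
        ≤ t ^ ((N : ℝ) - 1) * (L * t ^ 2 / t ^ ((N : ℝ) + 2 * s)) := by
          gcongr; exact min_le_left _ _
      _ = L * (t ^ ((N : ℝ) - 1) * t ^ (2 : ℝ) / t ^ ((N : ℝ) + 2 * s)) := by
          rw [Real.rpow_two]; ring
      _ = _ := by
          rw [← Real.rpow_add ht0, ← Real.rpow_sub ht0]
          congr 2; ring
  · have h1 : IntegrableOn (fun t : ℝ => M * t ^ (-1 - 2 * s)) (Ioi 1) :=
      (integrableOn_Ioi_rpow_of_lt (by linarith) one_pos).const_mul M
    refine Integrable.mono' h1 hmeas.aestronglyMeasurable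
      ((ae_restrict_iff' measurableSet_Ioi).2 (ae_of_all _ fun t ht => ?_))
    have ht0 : 0 < t := zero_lt_one.trans ht
    rw [Real.norm_of_nonneg (by positivity), smul_eq_mul, hpow t ht0]
    calc t ^ ((N : ℝ) - 1) * (min (L * t ^ 2) M / t ^ ((N : ℝ) + 2 * s))
        ≤ t ^ ((N : ℝ) - 1) * (M / t ^ ((N : ℝ) + 2 * s)) := by
          gcongr; exact min_le_right _ _
      _ = M * (t ^ ((N : ℝ) - 1) / t ^ ((N : ℝ) + 2 * s)) := by ring
      _ = _ := by
          rw [← Real.rpow_sub ht0]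
          congr 2; ring

/-- Functions in `C_c^1` have finite Gagliardo seminorm. -/
lemma memLp_diffQuot_of_contDiff (hs0 : 0 < s) (hs1 : s < 1) (hN : 0 < N)
    {φ : EuclideanSpace ℝ (Fin N) → ℝ} (hφ : ContDiff ℝ 1 φ) (hc : HasCompactSupport φ) :
    MemLp (diffQuot N s φ) 2 volume := by
  obtain ⟨L, hL⟩ := hφ.lipschitzWith_of_hasCompactSupport hc one_ne_zero
  obtain ⟨M, hM⟩ := hφ.continuous.bounded_above_of_compact_support hc
  have hM0 : 0 ≤ M := (norm_nonneg _).trans (hM 0)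
  set K := tsupport φ with hK
  set κ : EuclideanSpace ℝ (Fin N) → ℝ := fun x =>
    min ((L : ℝ) ^ 2 * ‖x‖ ^ 2) ((2 * M) ^ 2) / ‖x‖ ^ ((N : ℝ) + 2 * s) with hκ
  have hκi : Integrable κ volume := integrable_kernel hs0 hs1 hN (by positivity) (by positivity)
  have hκ0 : ∀ x, 0 ≤ κ x := fun x => by positivity
  have hKi : Integrable (K.indicator (fun _ => (1 : ℝ))) volume :=
    (integrable_indicator_iff (isClosed_tsupport φ).measurableSet).2
      (integrableOn_const hc.isCompact.measure_lt_top.ne)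
  -- The squared quotient is at most κ(x - y) and vanishes unless x or y lies in the support K, so
  -- two convolution-type integrands 1_K(x)κ(x - y) and 1_K(y)κ(x - y) dominate it.
  have h2 : Integrable (fun z : EuclideanSpace ℝ (Fin N) × EuclideanSpace ℝ (Fin N) =>
      K.indicator (fun _ => (1 : ℝ)) z.2 * κ (z.1 - z.2)) (volume.prod volume) := by
    simpa using Integrable.convolution_integrand (ContinuousLinearMap.mul ℝ ℝ) hKi hκi
  have h1 : Integrable (fun z : EuclideanSpace ℝ (Fin N) × EuclideanSpace ℝ (Fin N) =>
      K.indicator (fun _ => (1 : ℝ)) z.1 * κ (z.1 - z.2)) (volume.prod volume) := by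
    refine h2.swap.congr (ae_of_all _ fun z => ?_)
    simp only [Function.comp_apply, Prod.fst_swap, Prod.snd_swap, hκ, norm_sub_rev z.2 z.1]
  have hmeas : AEStronglyMeasurable φ (volume : Measure (EuclideanSpace ℝ (Fin N))) :=
    hφ.continuous.aestronglyMeasurable
  rw [memLp_diffQuot_iff N s hmeas, gagliardoIntegrand_self, Measure.volume_eq_prod]
  refine Integrable.mono' (h1.add h2)
    ((aestronglyMeasurable_diffQuot N s hmeas).pow 2) (ae_of_all _ fun z => ?_)
  have hkey : diffQuot N s φ z ^ 2 ≤ κ (z.1 - z.2) := by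
    have e : diffQuot N s φ z ^ 2
        = (φ z.1 - φ z.2) ^ 2 / ‖z.1 - z.2‖ ^ ((N : ℝ) + 2 * s) := by
      rw [diffQuot, div_pow, ← Real.rpow_natCast (‖z.1 - z.2‖ ^ _),
        ← Real.rpow_mul (norm_nonneg _)]
      congr 2
      push_cast; ring
    rw [e]
    simp only [hκ]
    gcongr
    refine le_min ?_ ?_
    · have := hL.dist_le_mul z.1 z.2
      rw [dist_eq_norm, dist_eq_norm, Real.norm_eq_abs] at this
      rw [← mul_pow, ← sq_abs]
      gcongr
    · rw [← sq_abs]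
      gcongr
      have e1 := hM z.1
      have e2 := hM z.2
      rw [Real.norm_eq_abs] at e1 e2
      exact (abs_sub _ _).trans (by linarith)
  rw [Real.norm_of_nonneg (sq_nonneg _), Pi.add_apply]
  by_cases hz1 : z.1 ∈ K
  · have := mul_nonneg (indicator_nonneg (s := K) (f := fun _ => (1 : ℝ))
      (fun _ _ => zero_le_one) z.2) (hκ0 (z.1 - z.2))
    simp only [indicator_of_mem hz1, one_mul]
    linarith
  by_cases hz2 : z.2 ∈ K
  · have := mul_nonneg (indicator_nonneg (s := K) (f := fun _ => (1 : ℝ))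
      (fun _ _ => zero_le_one) z.1) (hκ0 (z.1 - z.2))
    simp only [indicator_of_mem hz2, one_mul]
    linarith
  · have : diffQuot N s φ z = 0 := by
      simp [diffQuot, image_eq_zero_of_notMem_tsupport hz1, image_eq_zero_of_notMem_tsupport hz2]
    rw [this]
    simp [hz1, hz2]

variable {hs : 0 < s} {hN : 2 * s < N}

lemma pos_of_two_mul_lt (hs : 0 < s) (hN : 2 * s < N) : 0 < N := by
  rcases Nat.eq_zero_or_pos N with rfl | h
  · simp at hN; linarith
  · exact h

/-- Functions in `C_c^1` define elements of the homogeneous fractional Sobolev space. -/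
lemma exists_testFunction (hs1 : s < 1) {φ : EuclideanSpace ℝ (Fin N) → ℝ}
    (hφ : ContDiff ℝ 1 φ) (hc : HasCompactSupport φ) :
    ∃ u : HDot hs hN, (u : GagliardoSpace hs hN) ∈ testFunctions hs hN ∧ u.fn =ᵐ[volume] φ := by
  have hmem : MemLp φ (ENNReal.ofReal (critExp N s)) volume :=
    hφ.continuous.memLp_of_hasCompactSupport hc
  have hq := memLp_diffQuot_of_contDiff hs hs1 (pos_of_two_mul_lt hs hN) hφ hc
  have hmem' : hmem.toLp φ ∈ gagliardoSubmodule N s :=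
    (memLp_diffQuot_iff N s (Lp.aestronglyMeasurable _)).1
      ((memLp_congr_ae (diffQuot_congr N s hmem.coeFn_toLp)).2 hq)
  set v : GagliardoSpace hs hN := (⟨hmem.toLp φ, hmem'⟩ : gagliardoSubmodule N s) with hv
  have hvt : v ∈ testFunctions hs hN := ⟨φ, hφ, hc, hmem.coeFn_toLp⟩
  exact ⟨⟨v, subset_closure hvt⟩, hvt, hmem.coeFn_toLp⟩

lemma HDot.dense_testFunctions :
    Dense {u : HDot hs hN | (u : GagliardoSpace hs hN) ∈ testFunctions hs hN} := by
  refine Subtype.dense_iff.2 fun u hu => ?_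
  have h : (testFunctions hs hN : Set (GagliardoSpace hs hN)) ⊆
      Subtype.val '' {u : HDot hs hN | (u : GagliardoSpace hs hN) ∈ testFunctions hs hN} :=
    fun v hv => ⟨⟨v, subset_closure hv⟩, hv, rfl⟩
  exact closure_mono h hu

end TestFunctions

/-! ## A smooth substitute for the negative part -/

/-- A nonpositive `C¹` function, vanishing on `[0, ∞)`, nondecreasing and `1`-Lipschitz. -/
def softNeg (t : ℝ) : ℝ := 1 - Real.sqrt (1 + (min t 0) ^ 2)

lemma hasDerivAt_min_sq (t : ℝ) : HasDerivAt (fun t : ℝ => (min t 0) ^ 2) (2 * min t 0) t := by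
  rcases lt_trichotomy t 0 with h | rfl | h
  · have h1 : HasDerivAt (fun t : ℝ => t ^ 2) (2 * min t 0) t := by
      simpa [min_eq_left h.le] using hasDerivAt_pow 2 t
    refine h1.congr_of_eventuallyEq ?_
    filter_upwards [gt_mem_nhds h] with x hx
    rw [min_eq_left hx.le]
  · rw [hasDerivAt_iff_isLittleO_nhds_zero]
    simp only [min_self, mul_zero, smul_zero, zero_add, ne_eq, OfNat.ofNat_ne_zero,
      not_false_eq_true, zero_pow, sub_zero]
    rw [Asymptotics.isLittleO_iff]
    intro c hc
    filter_upwards [Metric.ball_mem_nhds (0 : ℝ) hc] with x hx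
    rw [mem_ball_zero_iff, Real.norm_eq_abs] at hx
    rw [Real.norm_eq_abs, Real.norm_eq_abs, abs_pow, sq]
    have h1 : |min x 0| ≤ |x| := by
      rcases le_total x 0 with h | h
      · rw [min_eq_left h]
      · rw [min_eq_right h, abs_zero]; exact abs_nonneg _
    exact mul_le_mul (h1.trans hx.le) h1 (abs_nonneg _) hc.le
  · have h1 : HasDerivAt (fun _ : ℝ => (0 : ℝ)) (2 * min t 0) t := by
      simpa [min_eq_right h.le] using hasDerivAt_const t (0 : ℝ)
    refine h1.congr_of_eventuallyEq ?_
    filter_upwards [lt_mem_nhds h] with x hx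
    rw [min_eq_right hx.le]
    simp

lemma contDiff_softNeg : ContDiff ℝ 1 softNeg := by
  have h : ContDiff ℝ 1 fun t : ℝ => (min t 0) ^ 2 := by
    rw [contDiff_one_iff_deriv]
    refine ⟨fun t => (hasDerivAt_min_sq t).differentiableAt, ?_⟩
    have : deriv (fun t : ℝ => (min t 0) ^ 2) = fun t => 2 * min t 0 :=
      funext fun t => (hasDerivAt_min_sq t).deriv
    rw [this]
    fun_prop
  exact contDiff_const.sub ((contDiff_const.add h).sqrt fun t => by positivity)

lemma softNeg_of_nonneg {t : ℝ} (ht : 0 ≤ t) : softNeg t = 0 := by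
  simp [softNeg, min_eq_right ht]

/-- Smoothing the corner costs at most 1 pointwise, hence at most the total mass of μ after
integration. -/
lemma softNeg_le_add_one (t : ℝ) : softNeg t ≤ t + 1 := by
  have : |min t 0| ≤ Real.sqrt (1 + (min t 0) ^ 2) := Real.abs_le_sqrt (by linarith)
  rw [softNeg]
  linarith [neg_abs_le (min t 0), min_le_left t 0]

/-- With X = √(1+x²) and Y = √(1+y²), (X - Y)(X + Y) = (y - x)(-x - y), and -x - y ≤ X + Y. -/
lemma softNeg_sub_bounds {a b : ℝ} (hab : a ≤ b) :
    0 ≤ softNeg b - softNeg a ∧ softNeg b - softNeg a ≤ b - a := by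
  have hm : min a 0 ≤ min b 0 := min_le_min_right 0 hab
  have hmd : min b 0 - min a 0 ≤ b - a := by
    rcases le_total b 0 with h | h
    · rw [min_eq_left h, min_eq_left (hab.trans h)]
    · rw [min_eq_right h]
      rcases le_total a 0 with h' | h'
      · rw [min_eq_left h']; linarith
      · rw [min_eq_right h']; linarith
  have hb0 : min b 0 ≤ 0 := min_le_right _ _
  set x := min a 0
  set y := min b 0
  have hx := Real.sq_sqrt (show 0 ≤ 1 + x ^ 2 by positivity)
  have hy := Real.sq_sqrt (show 0 ≤ 1 + y ^ 2 by positivity)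
  have hX : |x| ≤ Real.sqrt (1 + x ^ 2) := Real.abs_le_sqrt (by linarith)
  have hY : |y| ≤ Real.sqrt (1 + y ^ 2) := Real.abs_le_sqrt (by linarith)
  have hY1 : 1 ≤ Real.sqrt (1 + y ^ 2) := Real.one_le_sqrt.2 (by nlinarith [sq_nonneg y])
  have hXp : 0 ≤ Real.sqrt (1 + x ^ 2) := Real.sqrt_nonneg _
  have e : softNeg b - softNeg a = Real.sqrt (1 + x ^ 2) - Real.sqrt (1 + y ^ 2) := by
    simp only [softNeg, x, y]; ring
  rw [e]
  rw [abs_of_nonpos (hm.trans hb0)] at hX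
  rw [abs_of_nonpos hb0] at hY
  constructor
  · rw [sub_nonneg]
    exact Real.sqrt_le_sqrt (by nlinarith)
  · refine le_trans ?_ hmd
    set X := Real.sqrt (1 + x ^ 2)
    set Y := Real.sqrt (1 + y ^ 2)
    refine le_of_mul_le_mul_right ?_ (show 0 < X + Y by linarith)
    have h1 : (X - Y) * (X + Y) = (y - x) * (-x - y) := by nlinarith
    rw [h1]
    exact mul_le_mul_of_nonneg_left (by linarith) (by linarith)

/-- Monotonicity together with the Lipschitz constant 1. Divided by |x - y|^(N+2s) and integrated,
this is B(v,v) ≤ B(u,v) for the truncation v of u. -/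
lemma softNeg_sub_sq_le (a b : ℝ) :
    (softNeg a - softNeg b) * (softNeg a - softNeg b) ≤ (a - b) * (softNeg a - softNeg b) := by
  rcases le_total a b with h | h
  · obtain ⟨h1, h2⟩ := softNeg_sub_bounds h
    nlinarith
  · obtain ⟨h1, h2⟩ := softNeg_sub_bounds h
    nlinarith

/-! ## The homogeneous fractional Sobolev space as an energy space -/

/-- The pullback of an inner product by a continuous linear map. -/
def pullbackInner {E F : Type*} [NormedAddCommGroup E] [NormedSpace ℝ E] [NormedAddCommGroup F]
    [InnerProductSpace ℝ F] (Q : E →L[ℝ] F) : E →L[ℝ] E →L[ℝ] ℝ :=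
  LinearMap.mkContinuous₂ (LinearMap.mk₂ ℝ (fun u v : E => inner ℝ (Q u) (Q v))
    (fun u v w => by rw [map_add, inner_add_left])
    (fun c u v => by rw [map_smul, real_inner_smul_left, smul_eq_mul])
    (fun u v w => by rw [map_add, inner_add_right])
    (fun c u v => by rw [map_smul, real_inner_smul_right, smul_eq_mul])) (‖Q‖ * ‖Q‖) fun u v => by
      rw [LinearMap.mk₂_apply]
      calc ‖inner ℝ (Q u) (Q v)‖ ≤ ‖Q u‖ * ‖Q v‖ := norm_inner_le_norm _ _
        _ ≤ (‖Q‖ * ‖u‖) * (‖Q‖ * ‖v‖) := by gcongr <;> exact Q.le_opNorm _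
        _ = _ := by ring

namespace HDot

variable {N : ℕ} {s : ℝ} {hs : 0 < s} {hN : 2 * s < N}

lemma memLp_fn (u : HDot hs hN) : MemLp u.fn (ENNReal.ofReal (critExp N s)) volume := Lp.memLp _

lemma fn_add (u v : HDot hs hN) : (u + v).fn =ᵐ[volume] u.fn + v.fn :=
  GagliardoSpace.coe_add _ _

lemma fn_smul (c : ℝ) (u : HDot hs hN) : (c • u).fn =ᵐ[volume] c • u.fn :=
  GagliardoSpace.coe_smul _ _

/-- The difference quotient on the homogeneous space. -/
def quot : HDot hs hN →L[ℝ]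
    Lp ℝ 2 (volume : Measure (EuclideanSpace ℝ (Fin N) × EuclideanSpace ℝ (Fin N))) :=
  GagliardoSpace.quot ∘L Submodule.subtypeL _

/-- The Gagliardo form as a continuous bilinear form. -/
def form : HDot hs hN →L[ℝ] HDot hs hN →L[ℝ] ℝ := pullbackInner quot

lemma form_eq_inner (u v : HDot hs hN) : form u v = inner ℝ (quot u) (quot v) := rfl

lemma form_apply (u v : HDot hs hN) : form u v = gagliardoForm N s u.fn v.fn :=
  GagliardoSpace.inner_quot (u : GagliardoSpace hs hN) v

lemma form_self (u : HDot hs hN) : form u u = gagliardoSeminorm N s u.fn ^ 2 := by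
  rw [form_eq_inner, real_inner_self_eq_norm_sq]
  congr 1
  exact GagliardoSpace.norm_quot (u : GagliardoSpace hs hN)

variable {μ : Measure (EuclideanSpace ℝ (Fin N))} {c : ENNReal}

lemma memLp_fn_weight (hc : c ≠ ⊤) (hμ : μ ≤ c • volume) (u : HDot hs hN) :
    MemLp u.fn (ENNReal.ofReal (critExp N s)) μ :=
  (memLp_fn u).of_measure_le_smul hc hμ

lemma ac_of_le_smul (hμ : μ ≤ c • volume) : μ ≪ volume :=
  (Measure.absolutelyContinuous_of_le hμ).trans Measure.smul_absolutelyContinuous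

/-- The embedding of the homogeneous space into a weighted Lebesgue space. -/
def embWeight [Fact (1 < critExp N s)] (hc : c ≠ ⊤) (hμ : μ ≤ c • volume) :
    HDot hs hN →L[ℝ] Lp ℝ (ENNReal.ofReal (critExp N s)) μ :=
  LinearMap.mkContinuous
    { toFun := fun u => (memLp_fn_weight hc hμ u).toLp _
      map_add' := fun u v => by
        rw [← MemLp.toLp_add, MemLp.toLp_eq_toLp_iff]
        exact (ac_of_le_smul hμ).ae_eq (fn_add u v)
      map_smul' := fun a u => by
        rw [RingHom.id_apply, ← MemLp.toLp_const_smul, MemLp.toLp_eq_toLp_iff]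
        exact (ac_of_le_smul hμ).ae_eq (fn_smul a u) }
    (c ^ (1 / ENNReal.ofReal (critExp N s)).toReal).toReal fun u => by
    change ‖(memLp_fn_weight hc hμ u).toLp _‖ ≤ _
    have h1 : ‖GagliardoSpace.toLp (u : GagliardoSpace hs hN)‖ ≤ ‖u‖ :=
      GagliardoSpace.norm_toLp_le_norm _
    rw [Lp.norm_toLp]
    refine le_trans ?_ (mul_le_mul_of_nonneg_left h1 ENNReal.toReal_nonneg)
    rw [Lp.norm_def, ← ENNReal.toReal_mul]
    refine ENNReal.toReal_mono (ENNReal.mul_ne_top (by finiteness) (memLp_fn u).2.ne) ?_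
    exact eLpNorm_le_of_le_smul hμ ENNReal.ofReal_ne_top _

lemma embWeight_coe [Fact (1 < critExp N s)] (hc : c ≠ ⊤) (hμ : μ ≤ c • volume)
    (u : HDot hs hN) : embWeight hc hμ u =ᵐ[μ] u.fn :=
  (memLp_fn_weight hc hμ u).coeFn_toLp

/-- The truncation is `softNeg` composed with a C_c^1 representative. Being C¹ and zero at 0,
`softNeg` preserves C_c^1, so the truncated function belongs to the closure without a separate
approximation. -/
lemma exists_trunc [Fact (1 < critExp N s)] (hs1 : s < 1) (hc : c ≠ ⊤) (hμ : μ ≤ c • volume)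
    {u : HDot hs hN} (hu : (u : GagliardoSpace hs hN) ∈ testFunctions hs hN) :
    ∃ v : HDot hs hN, (∀ᵐ x ∂μ, embWeight hc hμ v x ≤ embWeight hc hμ u x + 1 ∧
      (embWeight hc hμ v x = 0 ∨ embWeight hc hμ u x ≤ 0)) ∧ form v v ≤ form u v := by
  obtain ⟨φ, hφ, hφc, huφ⟩ := hu
  have huφ' : u.fn =ᵐ[volume] φ := huφ
  obtain ⟨v, -, hv⟩ := exists_testFunction (hs := hs) (hN := hN) hs1
    (φ := softNeg ∘ φ) (contDiff_softNeg.comp hφ)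
    (hφc.comp_left (g := softNeg) (softNeg_of_nonneg le_rfl))
  refine ⟨v, ?_, ?_⟩
  · filter_upwards [embWeight_coe hc hμ u, embWeight_coe hc hμ v,
      (ac_of_le_smul hμ).ae_eq huφ', (ac_of_le_smul hμ).ae_eq hv] with x h1 h2 h3 h4
    rw [h1, h2, h3, h4, Function.comp_apply]
    refine ⟨softNeg_le_add_one _, ?_⟩
    rcases le_total (φ x) 0 with h | h
    · exact Or.inr h
    · exact Or.inl (softNeg_of_nonneg h)
  · rw [form_eq_inner, form_eq_inner, L2.inner_def, L2.inner_def]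
    refine integral_mono_ae (L2.integrable_inner _ _) (L2.integrable_inner _ _) ?_
    have hqu : quot u =ᵐ[volume] diffQuot N s φ :=
      (GagliardoSpace.quot_coe (u : GagliardoSpace hs hN)).trans (diffQuot_congr N s huφ)
    have hqv : quot v =ᵐ[volume] diffQuot N s (softNeg ∘ φ) :=
      (GagliardoSpace.quot_coe (v : GagliardoSpace hs hN)).trans (diffQuot_congr N s hv)
    filter_upwards [hqu, hqv] with z h1 h2
    rw [h1, h2]
    simp only [diffQuot, RCLike.inner_apply, conj_trivial, Function.comp_apply]
    rw [div_mul_div_comm, div_mul_div_comm, mul_comm (softNeg _ - softNeg _) (φ _ - φ _)]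
    exact div_le_div_of_nonneg_right (softNeg_sub_sq_le _ _) (by positivity)

variable (hs hN) in
lemma exists_lower : ∃ l > 0, ∀ u : HDot hs hN, l * ‖u‖ ^ 2 ≤ form u u := by
  obtain ⟨C, hC, h⟩ := GagliardoSpace.exists_norm_le_seminorm hs hN
  refine ⟨(C ^ 2)⁻¹, by positivity, fun u => ?_⟩
  rw [inv_mul_le_iff₀ (by positivity), form_self, ← mul_pow]
  exact pow_le_pow_left₀ (norm_nonneg _) (h (u : GagliardoSpace hs hN)) 2

variable (hs hN) in
/-- The homogeneous fractional Sobolev space is an energy space for finite measures with bounded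
density. -/
def energySpace [IsFiniteMeasure μ] [Fact (1 < critExp N s)] (hs1 : s < 1) (hc : c ≠ ⊤)
    (hμ : μ ≤ c • volume) : EnergySpace (HDot hs hN) μ (critExp N s) where
  form := form
  form_symm u v := by rw [form_eq_inner, form_eq_inner, real_inner_comm]
  lower := (exists_lower hs hN).choose
  lower_pos := (exists_lower hs hN).choose_spec.1
  le_form := (exists_lower hs hN).choose_spec.2
  emb := embWeight hc hμ
  exists_ae_tendsto w M hM := by
    obtain ⟨k, hk, v, hv⟩ := exists_subseq_ae_tendsto hs hc hμ
      (fun n => GagliardoSpace.toLp (w n : GagliardoSpace hs hN))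
      (fun n => (GagliardoSpace.norm_toLp_le_norm _).trans (hM n))
      (fun n => GagliardoSpace.eLpNorm_diffQuot_le (hM n))
    refine ⟨k, hk, v, ?_⟩
    have hcoe : ∀ᵐ x ∂μ, ∀ n, embWeight hc hμ (w n) x = (w n).fn x :=
      ae_all_iff.2 fun n => embWeight_coe hc hμ (w n)
    filter_upwards [hv, hcoe] with x hx hx'
    simp only [hx']
    exact hx
  exists_trunc := ⟨_, dense_testFunctions, fun _ hu => exists_trunc hs1 hc hμ hu⟩

end HDot

/-! ## Mountain pass geometry -/

namespace EnergySpace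

variable {E : Type*} [NormedAddCommGroup E] [NormedSpace ℝ E] {α : Type*}
    [MeasurableSpace α] {μ : Measure α} [IsFiniteMeasure μ] {p : ℝ} [Fact (1 < p)]
    (S : EnergySpace E μ p) {γ : ℝ} {f F : ℝ → ℝ}

lemma integrable_abs_rpow {m : ℝ} (hm : 0 < m) (hmp : m ≤ p) (u : E) :
    Integrable (fun x => |S.emb u x| ^ m) μ :=
  integrable_comp_of_powerGrowth (φ := fun t => |t| ^ m)
    (continuous_abs.rpow_const fun _ => Or.inr hm.le) hm hmp
    ⟨1, zero_le_one, fun t => by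
      rw [abs_of_nonneg (by positivity)]
      linarith⟩ (Lp.memLp (S.emb u))

/-- On a finite measure L^p embeds in L^m, so the embedding of E also bounds the lower powers. -/
lemma exists_integral_abs_rpow_le {m : ℝ} (hm : 0 < m) (hmp : m ≤ p) :
    ∃ C ≥ 0, ∀ u, ∫ x, |S.emb u x| ^ m ∂μ ≤ C * ‖u‖ ^ m := by
  set e : ℝ := 1 / (ENNReal.ofReal m).toReal - 1 / (ENNReal.ofReal p).toReal with he
  have he0 : 0 ≤ e := by
    rw [he, ENNReal.toReal_ofReal hm.le, ENNReal.toReal_ofReal (hm.le.trans hmp), sub_nonneg]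
    exact one_div_le_one_div_of_le hm hmp
  set K : ℝ := ‖S.emb‖ * (μ univ ^ e).toReal with hK
  have hK0 : 0 ≤ K := by positivity
  refine ⟨K ^ m, by positivity, fun u => ?_⟩
  have hmeas : AEStronglyMeasurable (S.emb u) μ := Lp.aestronglyMeasurable _
  have h1 : lpNorm (S.emb u) (ENNReal.ofReal m) μ ≤ K * ‖u‖ := by
    rw [← toReal_eLpNorm hmeas]
    have h2 := eLpNorm_le_eLpNorm_mul_rpow_measure_univ (ENNReal.ofReal_le_ofReal hmp) hmeas
    have h3 : μ univ ^ e ≠ ⊤ := ENNReal.rpow_ne_top_of_nonneg he0 (measure_ne_top _ _)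
    have h4 := ENNReal.toReal_mono (ENNReal.mul_ne_top (Lp.memLp (S.emb u)).2.ne h3) h2
    rw [ENNReal.toReal_mul, ← Lp.norm_def] at h4
    refine h4.trans ?_
    rw [hK, mul_right_comm]
    gcongr
    exact S.emb.le_opNorm u
  have h5 : ∫ x, |S.emb u x| ^ m ∂μ = lpNorm (S.emb u) (ENNReal.ofReal m) μ ^ m := by
    rw [lpNorm_eq_integral_norm_rpow_toReal (by simpa using hm) ENNReal.ofReal_ne_top hmeas,
      ENNReal.toReal_ofReal hm.le, ← Real.rpow_mul (integral_nonneg fun x => by positivity),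
      inv_mul_cancel₀ hm.ne', Real.rpow_one]
    rfl
  rw [h5, ← Real.mul_rpow hK0 (norm_nonneg _)]
  have : 0 ≤ lpNorm (S.emb u) (ENNReal.ofReal m) μ := by
    rw [← toReal_eLpNorm hmeas]; exact ENNReal.toReal_nonneg
  exact Real.rpow_le_rpow this h1 hm.le

/-- The energy is bounded below on small spheres, uniformly for small parameters. -/
lemma exists_le_action (hf : IsNonlinearity p γ f F) : ∃ a₁ > 0, ∃ ρ > 0, ∃ β > 0,
    ∀ a ∈ Ioo 0 a₁, ∀ v, S.form v v = ρ ^ 2 → β ≤ S.action F a v := by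
  have hl := S.lower_pos
  have hγ := hf.two_lt
  have hγp := hf.lt_crit
  obtain ⟨c₂, hc₂, h₂⟩ := S.exists_integral_abs_rpow_le (m := 2) two_pos (by linarith)
  obtain ⟨cγ, hcγ, hγ'⟩ := S.exists_integral_abs_rpow_le (m := γ) (by linarith) hγp.le
  -- Chosen so that the quadratic part of ∫F dμ costs at most ρ²/8. The γ-power term and the mass
  -- term get ρ²/8 each, leaving ρ²/8 out of ρ²/2. The +1 avoids dividing by zero.
  obtain ⟨C, hC, hF⟩ := hf.prim_le (S.lower / (8 * (c₂ + 1))) (by positivity)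
  set t : ℝ := 1 / Real.sqrt S.lower with ht
  have ht0 : 0 < t := by positivity
  set K : ℝ := C * (cγ * t ^ γ) with hK
  have hK0 : 0 ≤ K := by positivity
  obtain ⟨ρ, hρK, hρ⟩ : ∃ ρ : ℝ, K * ρ ^ (γ - 2) < 1 / 8 ∧ 0 < ρ := by
    have h1 : Tendsto (fun r : ℝ => K * r ^ (γ - 2)) (𝓝[>] 0) (𝓝 (K * 0 ^ (γ - 2))) :=
      (((Real.continuousAt_rpow_const 0 (γ - 2) (Or.inr (by linarith))).tendsto).const_mul
        K).mono_left nhdsWithin_le_nhds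
    rw [Real.zero_rpow (by linarith), mul_zero] at h1
    exact ((h1.eventually_lt_const (by norm_num : (0 : ℝ) < 1 / 8)).and
      self_mem_nhdsWithin).exists
  have hρK' : K * ρ ^ γ ≤ ρ ^ 2 / 8 := by
    have e : ρ ^ γ = ρ ^ (γ - 2) * ρ ^ 2 := by
      rw [← Real.rpow_two, ← Real.rpow_add hρ, sub_add_cancel]
    rw [e, ← mul_assoc]
    have := mul_le_mul_of_nonneg_right hρK.le (sq_nonneg ρ)
    linarith
  refine ⟨ρ / (8 * t * (‖S.mass‖ + 1)), by positivity, ρ, hρ, ρ ^ 2 / 8, by positivity,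
    fun a ha v hv => ?_⟩
  have hvn : ‖v‖ ≤ t * ρ := by
    have h1 := S.le_form v
    rw [hv] at h1
    have h2 : (Real.sqrt S.lower * ‖v‖) ^ 2 ≤ ρ ^ 2 := by
      rwa [mul_pow, Real.sq_sqrt hl.le]
    have h3 := (sq_le_sq₀ (by positivity) hρ.le).1 h2
    rw [ht, one_div, inv_mul_eq_div, le_div_iff₀ (by positivity), mul_comm]
    exact h3
  have hpot : S.pot F v ≤ ρ ^ 2 / 8 + ρ ^ 2 / 8 := by
    have e1 : S.pot F v ≤ ∫ x, (S.lower / (8 * (c₂ + 1)) * |S.emb v x| ^ (2 : ℝ)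
        + C * |S.emb v x| ^ γ) ∂μ := by
      refine integral_mono (S.integrable_pot hf v)
        (((S.integrable_abs_rpow two_pos (by linarith) v).const_mul _).add
          ((S.integrable_abs_rpow (by linarith) hγp.le v).const_mul _)) fun x => ?_
      have := hF (S.emb v x)
      simpa only [Real.rpow_two, sq_abs] using this
    rw [integral_add ((S.integrable_abs_rpow two_pos (by linarith) v).const_mul _)
      ((S.integrable_abs_rpow (by linarith) hγp.le v).const_mul _), integral_const_mul,
      integral_const_mul] at e1
    have e2 : S.lower / (8 * (c₂ + 1)) * ∫ x, |S.emb v x| ^ (2 : ℝ) ∂μ ≤ ρ ^ 2 / 8 := by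
      have h3 := S.le_form v
      rw [hv] at h3
      have h4 := h₂ v
      rw [Real.rpow_two] at h4
      calc S.lower / (8 * (c₂ + 1)) * ∫ x, |S.emb v x| ^ (2 : ℝ) ∂μ
          ≤ S.lower / (8 * (c₂ + 1)) * ((c₂ + 1) * ‖v‖ ^ 2) := by
            gcongr
            nlinarith [sq_nonneg ‖v‖]
        _ = S.lower * ‖v‖ ^ 2 / 8 := by field_simp
        _ ≤ _ := by linarith
    have e3 : C * ∫ x, |S.emb v x| ^ γ ∂μ ≤ ρ ^ 2 / 8 := by
      calc C * ∫ x, |S.emb v x| ^ γ ∂μ ≤ C * (cγ * (t * ρ) ^ γ) := by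
            gcongr
            refine (hγ' v).trans ?_
            gcongr
        _ = K * ρ ^ γ := by rw [Real.mul_rpow ht0.le hρ.le, hK]; ring
        _ ≤ _ := hρK'
    linarith
  have hmass : -(ρ ^ 2 / 8) ≤ a * S.mass v := by
    have h1 : |S.mass v| ≤ (‖S.mass‖ + 1) * (t * ρ) := by
      refine (S.mass.le_opNorm v).trans ?_
      gcongr
      linarith
    have h2 : a * |S.mass v| ≤ ρ / (8 * t * (‖S.mass‖ + 1)) * ((‖S.mass‖ + 1) * (t * ρ)) := by
      gcongr
      exact ha.2.le
    have h3 : ρ / (8 * t * (‖S.mass‖ + 1)) * ((‖S.mass‖ + 1) * (t * ρ)) = ρ ^ 2 / 8 := by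
      have : ‖S.mass‖ + 1 ≠ 0 := by positivity
      field_simp
    have h4 : -(a * |S.mass v|) ≤ a * S.mass v := by
      rw [← mul_neg]
      exact mul_le_mul_of_nonneg_left (neg_abs_le _) ha.1.le
    linarith
  rw [action, hv]
  linarith

/-- The energy is negative far away in nonnegative directions, uniformly in the parameter. -/
lemma exists_action_neg (hf : IsNonlinearity p γ f F) {u : E} (hu : ∀ᵐ x ∂μ, 0 ≤ S.emb u x)
    (hne : ¬ S.emb u =ᵐ[μ] 0) (ρ : ℝ) :
    ∃ e, ρ ^ 2 < S.form e e ∧ ∀ a ∈ Icc 0 1, S.action F a e < 0 := by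
  have hγ := hf.two_lt
  have hγp := hf.lt_crit
  have hint : Integrable (fun x => (S.emb u x) ^ 2) μ := by
    simpa only [Real.rpow_two, sq_abs] using S.integrable_abs_rpow two_pos (by linarith) u
  set q := ∫ x, (S.emb u x) ^ 2 ∂μ with hq
  have hq0 : 0 < q := by
    refine lt_of_le_of_ne (integral_nonneg fun x => sq_nonneg _) fun h => hne ?_
    have := (integral_eq_zero_iff_of_nonneg (fun x => sq_nonneg _) hint).1 h.symm
    filter_upwards [this] with x hx
    simpa using hx
  have hu0 : u ≠ 0 := by
    rintro rfl
    refine hne ?_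
    rw [map_zero]
    exact Lp.coeFn_zero _ _ _
  have hform : 0 < S.form u u :=
    lt_of_lt_of_le (mul_pos S.lower_pos (by positivity)) (S.le_form u)
  -- This slope makes ∫F(Tu) dμ beat the quadratic part by T², up to a constant. The energy at Tu is
  -- then at most -T² + kT + const, negative for the T below; the summand ρ²/B(u,u) in T places the
  -- point outside the sphere.
  obtain ⟨C, hC, hF⟩ := hf.superlinear ((S.form u u / 2 + 1) / q)
  set k := ‖S.mass‖ * ‖u‖ with hk
  set T := 1 + k + C * μ.real univ + (ρ ^ 2) / S.form u u with hT
  have hk0 : 0 ≤ k := by positivity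
  have hCμ : 0 ≤ C * μ.real univ := by positivity
  have hT1 : 1 + k + C * μ.real univ ≤ T := le_add_of_nonneg_right (by positivity)
  have hT2 : ρ ^ 2 / S.form u u + 1 ≤ T := by linarith
  have hTp : 1 ≤ T := by linarith
  refine ⟨T • u, ?_, fun a ha => ?_⟩
  · simp only [map_smul, smul_apply, smul_eq_mul]
    have h1 : ρ ^ 2 / S.form u u < T := by linarith
    rw [div_lt_iff₀ hform] at h1
    nlinarith [mul_le_mul_of_nonneg_right hTp (mul_nonneg (zero_le_one.trans hTp) hform.le)]
  · have e1 : (S.form u u / 2 + 1) * T ^ 2 - C * μ.real univ ≤ S.pot F (T • u) := by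
      have h1 : ∫ x, ((S.form u u / 2 + 1) / q * T ^ 2 * (S.emb u x) ^ 2 - C) ∂μ
          ≤ S.pot F (T • u) := by
        refine integral_mono_ae ((hint.const_mul _).sub (integrable_const C))
          (S.integrable_pot hf _) ?_
        filter_upwards [hu, S.emb_smul T u] with x hx hx'
        rw [hx']
        have := hF (T * S.emb u x) (by positivity)
        rw [mul_pow, ← mul_assoc] at this
        exact this
      rw [integral_sub (hint.const_mul _) (integrable_const C), integral_const_mul, integral_const,
        smul_eq_mul, ← hq] at h1
      have h2 : (S.form u u / 2 + 1) / q * T ^ 2 * q = (S.form u u / 2 + 1) * T ^ 2 := by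
        field_simp
      linarith
    have e2 : a * S.mass (T • u) ≤ k * T := by
      have h1 : S.mass u ≤ k := (le_abs_self _).trans (S.mass.le_opNorm u)
      rw [map_smul, smul_eq_mul]
      have h2 : a * S.mass u ≤ k := by
        rcases le_total (S.mass u) 0 with h | h
        · exact (mul_nonpos_of_nonneg_of_nonpos ha.1 h).trans hk0
        · exact (mul_le_of_le_one_left h ha.2).trans h1
      nlinarith
    have e3 : S.form (T • u) (T • u) = T ^ 2 * S.form u u := by
      simp only [map_smul, smul_apply, smul_eq_mul]
      ring
    rw [action, e3]
    nlinarith [mul_le_mul_of_nonneg_right hT1 (zero_le_one.trans hTp)]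

/-- Existence and uniform bounds of mountain pass critical points. -/
theorem exists_mountainPass [CompleteSpace E] (hf : IsNonlinearity p γ f F) {u₀ : E}
    (hu₀ : ∀ᵐ x ∂μ, 0 ≤ S.emb u₀ x) (hne : ¬ S.emb u₀ =ᵐ[μ] 0) :
    ∃ a₁ > 0, ∃ ρ > 0, ∃ β > 0, ∃ e, ∃ Λ, ρ ^ 2 < S.form e e ∧ ∀ a ∈ Ioo 0 a₁,
      (∀ v, S.form v v = ρ ^ 2 → β ≤ S.action F a v) ∧ S.action F a e < 0 ∧
      ∃ u, β ≤ S.action F a u ∧ S.action F a u ≤ Λ ∧ S.dAction hf a u = 0 ∧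
        IsGLB (range fun q : Path (0 : E) e => ⨆ t, S.action F a (q t)) (S.action F a u) := by
  obtain ⟨a₁, ha₁, ρ, hρ, β, hβ, hsphere⟩ := S.exists_le_action hf
  obtain ⟨e, he, hneg⟩ := S.exists_action_neg hf hu₀ hne ρ
  have hcont : ∀ a, Continuous (S.action F a) := fun a => (S.contDiff_action hf a).continuous
  set q₀ : Path (0 : E) e := ⟨⟨fun t => (t : ℝ) • e, by fun_prop⟩, by simp, by simp⟩ with hq₀
  -- The energy is affine in a, so along the fixed segment to e and for a ≤ 1 it exceeds its value
  -- at a = 0 by at most ‖mass‖‖e‖. This bounds the mountain pass levels uniformly.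
  refine ⟨min a₁ 1, by positivity, ρ, hρ, β, hβ, e,
    (⨆ t, S.action F 0 (q₀ t)) + ‖S.mass‖ * ‖e‖, he, fun a ha => ?_⟩
  have ha' : a ∈ Ioo 0 a₁ := ⟨ha.1, ha.2.trans_le (min_le_left _ _)⟩
  have ha1 : a ≤ 1 := (ha.2.trans_le (min_le_right _ _)).le
  have hae := hneg a ⟨ha.1.le, ha1⟩
  refine ⟨hsphere a ha', hae, ?_⟩
  -- Every path from 0 to e crosses the sphere, by the intermediate value theorem.
  have hlow : ∀ q : Path (0 : E) e, β ≤ ⨆ t, S.action F a (q t) := by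
    intro q
    have hc : Continuous fun t => S.form (q t) (q t) :=
      (S.form.continuous.comp q.continuous).clm_apply q.continuous
    obtain ⟨t, ht⟩ := mem_range_of_exists_le_of_exists_ge hc (c := ρ ^ 2)
      ⟨0, by simp only [q.source, map_zero]; positivity⟩ ⟨1, by rw [q.target]; exact he.le⟩
    exact (hsphere a ha' _ ht).trans
      (le_ciSup (bddAbove_range_comp (hcont a) q.toContinuousMap) t)
  have hbdd : BddBelow (range fun q : Path (0 : E) e => ⨆ t, S.action F a (q t)) :=
    ⟨β, by rintro _ ⟨q, rfl⟩; exact hlow q⟩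
  have : Nonempty (Path (0 : E) e) := ⟨q₀⟩
  have hglb := isGLB_ciInf hbdd
  set c := ⨅ q : Path (0 : E) e, ⨆ t, S.action F a (q t) with hc
  have hβc : β ≤ c := le_ciInf hlow
  obtain ⟨u, hu, hcrit⟩ := S.exists_critical_of_mountainPass hf ha.1.le hglb
    (hβ.trans_le hβc) (hae.trans (hβ.trans_le hβc))
  refine ⟨u, by rwa [hu], ?_, hcrit, by rwa [hu]⟩
  rw [hu]
  refine (ciInf_le hbdd q₀).trans (ciSup_le fun t => ?_)
  have h1 : S.action F a (q₀ t) = S.action F 0 (q₀ t) + a * S.mass (q₀ t) := by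
    simp only [action]; ring
  have h2 : a * S.mass (q₀ t) ≤ ‖S.mass‖ * ‖e‖ := by
    have h3 : |S.mass (q₀ t)| ≤ ‖S.mass‖ * ‖e‖ := by
      refine (S.mass.le_opNorm _).trans ?_
      gcongr
      change ‖(t : ℝ) • e‖ ≤ _
      rw [norm_smul, Real.norm_of_nonneg t.2.1]
      exact mul_le_of_le_one_left (norm_nonneg _) t.2.2
    calc a * S.mass (q₀ t) ≤ a * |S.mass (q₀ t)| :=
          mul_le_mul_of_nonneg_left (le_abs_self _) ha.1.le
      _ ≤ 1 * |S.mass (q₀ t)| := mul_le_mul_of_nonneg_right ha1 (abs_nonneg _)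
      _ ≤ _ := by rw [one_mul]; exact h3
  rw [h1]
  exact add_le_add (le_ciSup (bddAbove_range_comp (hcont 0) q₀.toContinuousMap) t) h2

end EnergySpace

/-! ## The nonlinearity -/

/-- The extension by `f 0` to the negative half-line. -/
def extendLeft (f : ℝ → ℝ) (t : ℝ) : ℝ := f (max t 0)

/-- The primitive of `extendLeft f` vanishing at `0`. -/
def primitiveLeft (f : ℝ → ℝ) (t : ℝ) : ℝ := ∫ τ in (0 : ℝ)..t, extendLeft f τ

section ExtendLeft

variable {f : ℝ → ℝ}

lemma continuous_extendLeft (hfc : ContinuousOn f (Ici 0)) : Continuous (extendLeft f) :=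
  hfc.comp_continuous (by fun_prop) fun t => le_max_right t 0

lemma extendLeft_of_nonneg {t : ℝ} (ht : 0 ≤ t) : extendLeft f t = f t := by
  rw [extendLeft, max_eq_left ht]

lemma extendLeft_of_nonpos (hf0 : f 0 = 0) {t : ℝ} (ht : t ≤ 0) : extendLeft f t = 0 := by
  rw [extendLeft, max_eq_right ht, hf0]

lemma hasDerivAt_primitiveLeft (hfc : ContinuousOn f (Ici 0)) (t : ℝ) :
    HasDerivAt (primitiveLeft f) (extendLeft f t) t :=
  ((continuous_extendLeft hfc).integral_hasStrictDerivAt 0 t).hasDerivAt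

lemma hasDerivAt_primitiveLeft_sub (hfc : ContinuousOn f (Ici 0)) (M t : ℝ) :
    HasDerivAt (fun t => primitiveLeft f t - M * t ^ 2) (extendLeft f t - M * (2 * t)) t := by
  have h : HasDerivAt (fun t : ℝ => M * t ^ 2) (M * (2 * t)) t := by
    simpa using (hasDerivAt_pow 2 t).const_mul M
  exact (hasDerivAt_primitiveLeft hfc t).sub h

lemma primitiveLeft_of_nonpos (hf0 : f 0 = 0) {t : ℝ} (ht : t ≤ 0) : primitiveLeft f t = 0 := by
  refine intervalIntegral.integral_zero_ae (ae_of_all _ fun τ hτ => ?_)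
  rw [uIoc_of_ge ht] at hτ
  exact extendLeft_of_nonpos hf0 hτ.2

lemma powerGrowth_extendLeft (hfc : ContinuousOn f (Ici 0)) (hf0 : f 0 = 0) {m L : ℝ}
    (hlim : Tendsto (fun t => f t / t ^ m) atTop (𝓝 L)) : PowerGrowth (extendLeft f) m := by
  obtain ⟨T, hT⟩ := eventually_atTop.1
    ((hlim.abs.eventually (gt_mem_nhds (lt_add_one |L|))).and (eventually_gt_atTop 0))
  have hT0 : 0 < T := (hT T le_rfl).2
  obtain ⟨B, hB⟩ := (isCompact_Icc (a := (0 : ℝ)) (b := T)).exists_bound_of_continuousOn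
    (continuous_extendLeft hfc).continuousOn
  have hB0 : 0 ≤ B := (norm_nonneg _).trans (hB 0 ⟨le_rfl, hT0.le⟩)
  refine ⟨B + (|L| + 1), by positivity, fun t => ?_⟩
  have hp : 0 ≤ |t| ^ m := by positivity
  have hL : 0 ≤ |L| := abs_nonneg L
  rcases le_total t 0 with ht | ht
  · rw [extendLeft_of_nonpos hf0 ht, abs_zero]
    positivity
  rcases le_total t T with htT | htT
  · have := hB t ⟨ht, htT⟩
    rw [Real.norm_eq_abs] at this
    nlinarith [mul_nonneg hB0 hp, mul_nonneg hL hp]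
  · obtain ⟨h1, h2⟩ := hT t htT
    rw [extendLeft_of_nonneg ht]
    rw [abs_div, abs_of_pos (Real.rpow_pos_of_pos h2 m),
      div_lt_iff₀ (Real.rpow_pos_of_pos h2 m)] at h1
    rw [abs_of_pos h2] at hp ⊢
    nlinarith [mul_nonneg hB0 hp]

/-- On [0, δ/2] the smallness of f(t)/t bounds the primitive by εt². Beyond δ/2 the constant in the
growth bound is absorbed into |t|^γ by the factor (δ/2)^(-γ). -/
lemma exists_primitiveLeft_le (hf0 : f 0 = 0)
    (hzero : Tendsto (fun t => f t / t) (𝓝[>] 0) (𝓝 0)) {γ : ℝ} (hγ : 0 < γ)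
    (hg : PowerGrowth (primitiveLeft f) γ) {ε : ℝ} (hε : 0 < ε) :
    ∃ C ≥ 0, ∀ t, primitiveLeft f t ≤ ε * t ^ 2 + C * |t| ^ γ := by
  have hev : ∀ᶠ t in 𝓝[>] (0 : ℝ), |f t / t| < ε := by
    simpa using hzero.abs.eventually (gt_mem_nhds (by simpa using hε))
  obtain ⟨δ, hδ, hsmall⟩ := mem_nhdsGT_iff_exists_Ioo_subset.1 hev
  rw [mem_Ioi] at hδ
  obtain ⟨C, hC, hbd⟩ := hg
  refine ⟨C * (1 + (δ / 2) ^ (-γ)), by positivity, fun t => ?_⟩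
  have hp : 0 ≤ |t| ^ γ := by positivity
  rcases le_total t 0 with ht | ht
  · rw [primitiveLeft_of_nonpos hf0 ht]
    positivity
  rcases le_total t (δ / 2) with htδ | htδ
  · have h1 : ‖∫ τ in (0 : ℝ)..t, extendLeft f τ‖ ≤ ε * t * |t - 0| := by
      refine intervalIntegral.norm_integral_le_of_norm_le_const fun τ hτ => ?_
      rw [uIoc_of_le ht] at hτ
      have h2 : |f τ / τ| < ε := hsmall ⟨hτ.1, by linarith [hτ.2]⟩
      rw [abs_div, abs_of_pos hτ.1, div_lt_iff₀ hτ.1] at h2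
      rw [extendLeft_of_nonneg hτ.1.le, Real.norm_eq_abs]
      exact h2.le.trans (mul_le_mul_of_nonneg_left hτ.2 hε.le)
    rw [sub_zero, abs_of_nonneg ht, ← primitiveLeft, Real.norm_eq_abs] at h1
    have h3 : 0 ≤ C * (1 + (δ / 2) ^ (-γ)) * |t| ^ γ := by positivity
    nlinarith [le_abs_self (primitiveLeft f t)]
  · have ht0 : 0 < t := by linarith
    have h1 := (le_abs_self _).trans (hbd t)
    have h2 : 1 ≤ (δ / 2) ^ (-γ) * |t| ^ γ := by
      rw [abs_of_pos ht0, Real.rpow_neg (by positivity), ← div_eq_inv_mul,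
        one_le_div (by positivity)]
      exact Real.rpow_le_rpow (by positivity) htδ hγ.le
    have h3 : 0 ≤ ε * t ^ 2 := by positivity
    nlinarith [mul_le_mul_of_nonneg_left h2 hC]

/-- Once f(t) ≥ 2Mt, F(t) - Mt² is nondecreasing; before that it is bounded by compactness. -/
lemma exists_le_primitiveLeft (hfc : ContinuousOn f (Ici 0))
    (htop : Tendsto (fun t => f t / t) atTop atTop) (M : ℝ) :
    ∃ C ≥ 0, ∀ t ≥ 0, M * t ^ 2 - C ≤ primitiveLeft f t := by
  obtain ⟨T, hT⟩ := eventually_atTop.1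
    ((htop.eventually (eventually_ge_atTop (2 * M))).and (eventually_gt_atTop 0))
  have hT0 : 0 < T := (hT T le_rfl).2
  have hd := hasDerivAt_primitiveLeft_sub hfc M
  have hcont : Continuous fun t => primitiveLeft f t - M * t ^ 2 :=
    continuous_iff_continuousAt.2 fun t => (hd t).continuousAt
  have hmono : MonotoneOn (fun t => primitiveLeft f t - M * t ^ 2) (Ici T) := by
    refine monotoneOn_of_hasDerivWithinAt_nonneg (convex_Ici T) hcont.continuousOn
      (fun t _ => (hd t).hasDerivWithinAt) fun t ht => ?_
    rw [interior_Ici, mem_Ioi] at ht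
    obtain ⟨h1, h2⟩ := hT t ht.le
    rw [le_div_iff₀ h2] at h1
    rw [extendLeft_of_nonneg h2.le]
    linarith
  obtain ⟨B, hB⟩ := (isCompact_Icc (a := (0 : ℝ)) (b := T)).exists_bound_of_continuousOn
    hcont.continuousOn
  have hB0 : 0 ≤ B := (norm_nonneg _).trans (hB 0 ⟨le_rfl, hT0.le⟩)
  refine ⟨B, hB0, fun t ht => ?_⟩
  have key : -B ≤ primitiveLeft f t - M * t ^ 2 := by
    rcases le_total t T with h | h
    · exact (abs_le.1 (hB t ⟨ht, h⟩)).1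
    · exact (abs_le.1 (hB T ⟨hT0.le, le_rfl⟩)).1.trans (hmono self_mem_Ici h h)
  linarith

/-- No derivative of f is needed. With k = f(t)/t, integrating f(y) ≤ ky over [x,t] gives F(t) -
F(x) ≤ k(t² - x²)/2, and x f(x) ≤ kx²; the increment of t f(t) - 2F(t) is therefore nonnegative. -/
lemma monotoneOn_mul_sub_primitiveLeft (hfc : ContinuousOn f (Ici 0)) {R : ℝ} (hR : 0 < R)
    (hmono : MonotoneOn (fun t => f t / t) (Ioi R)) :
    MonotoneOn (fun t => t * extendLeft f t - 2 * primitiveLeft f t) (Ioi R) := by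
  intro x hx t ht hxt
  rw [mem_Ioi] at hx ht
  have hx0 : 0 < x := hR.trans hx
  have ht0 : 0 < t := hR.trans ht
  set k := f t / t with hk
  have hd := hasDerivAt_primitiveLeft_sub hfc (k / 2)
  have hanti : AntitoneOn (fun y => primitiveLeft f y - k / 2 * y ^ 2) (Icc x t) := by
    refine antitoneOn_of_hasDerivWithinAt_nonpos (convex_Icc x t)
      (fun y _ => (hd y).continuousAt.continuousWithinAt)
      (fun y _ => (hd y).hasDerivWithinAt) fun y hy => ?_
    rw [interior_Icc, mem_Ioo] at hy
    have hy0 : 0 < y := hx0.trans hy.1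
    have h1 : f y / y ≤ k := hmono (hx.trans hy.1) ht hy.2.le
    rw [div_le_iff₀ hy0] at h1
    rw [extendLeft_of_nonneg hy0.le]
    linarith
  have h1 := hanti ⟨le_rfl, hxt⟩ ⟨hxt, le_rfl⟩ hxt
  have h2 : f x / x ≤ k := hmono hx ht hxt
  rw [div_le_iff₀ hx0] at h2
  have h3 : f t = k * t := by rw [hk]; field_simp
  simp only [extendLeft_of_nonneg hx0.le, extendLeft_of_nonneg ht0.le, h3] at h1 ⊢
  nlinarith [mul_le_mul_of_nonneg_left h2 hx0.le]

lemma exists_quasi_mono (hfc : ContinuousOn f (Ici 0)) (hf0 : f 0 = 0) (hf2 : HypF2 f) :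
    ∃ C ≥ 0, ∀ t θ, 0 ≤ θ → θ ≤ 1 →
      θ * t * extendLeft f (θ * t) - 2 * primitiveLeft f (θ * t) ≤
        t * extendLeft f t - 2 * primitiveLeft f t + C := by
  obtain ⟨R, hR, hmono⟩ := hf2
  have hmono := monotoneOn_mul_sub_primitiveLeft hfc hR hmono
  set H : ℝ → ℝ := fun t => t * extendLeft f t - 2 * primitiveLeft f t with hH
  have hcont : Continuous H :=
    (continuous_id.mul (continuous_extendLeft hfc)).sub (continuous_const.mul
      (continuous_iff_continuousAt.2 fun t => (hasDerivAt_primitiveLeft hfc t).continuousAt))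
  -- Monotonicity holds only on the open ray, so R + 1 serves as an attained starting point.
  -- Failures of monotonicity below it cost at most 2B.
  obtain ⟨B, hB⟩ := (isCompact_Icc (a := (0 : ℝ)) (b := R + 1)).exists_bound_of_continuousOn
    hcont.continuousOn
  have hB0 : 0 ≤ B := (norm_nonneg _).trans (hB 0 ⟨le_rfl, by linarith⟩)
  have hRR : R + 1 ∈ Ioi R := by simp
  refine ⟨2 * B, by positivity, fun t θ hθ hθ1 => ?_⟩
  change H (θ * t) ≤ H t + 2 * B
  rcases le_total t 0 with ht | ht
  · have hz : ∀ y ≤ 0, H y = 0 := fun y hy => by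
      simp only [hH, extendLeft_of_nonpos hf0 hy, primitiveLeft_of_nonpos hf0 hy]
      ring
    rw [hz t ht, hz _ (mul_nonpos_of_nonneg_of_nonpos hθ ht)]
    positivity
  have hx : 0 ≤ θ * t := by positivity
  have hxt : θ * t ≤ t := mul_le_of_le_one_left ht hθ1
  rcases le_total (R + 1) (θ * t) with h | h
  · have := hmono (by rw [mem_Ioi]; linarith) (by rw [mem_Ioi]; linarith) hxt
    linarith
  · have h1 := (abs_le.1 (hB _ ⟨hx, h⟩)).2
    have h2 : -B ≤ H t := by
      rcases le_total t (R + 1) with h' | h'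
      · exact (abs_le.1 (hB t ⟨ht, h'⟩)).1
      · exact (abs_le.1 (hB (R + 1) ⟨by linarith, le_rfl⟩)).1.trans
          (hmono hRR (by rw [mem_Ioi]; linarith) h')
    linarith

lemma isNonlinearity_extendLeft {N : ℕ} {s : ℝ} (hfc : ContinuousOn f (Ici 0)) (hf0 : f 0 = 0)
    (hf1 : HypF1 N s f) (hf2 : HypF2 f) :
    ∃ γ, IsNonlinearity (critExp N s) γ (extendLeft f) (primitiveLeft f) := by
  obtain ⟨hzero, htop, γ, hγ, hγc, -, -, L, -, hlim⟩ := hf1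
  have hg := powerGrowth_extendLeft hfc hf0 hlim
  have hG := hg.primitive (by linarith) (hasDerivAt_primitiveLeft hfc)
    (primitiveLeft_of_nonpos hf0 le_rfl)
  rw [sub_add_cancel] at hG
  exact ⟨γ,
    { two_lt := hγ
      lt_crit := hγc
      cont := continuous_extendLeft hfc
      hasDerivAt := hasDerivAt_primitiveLeft hfc
      zero_of_nonpos := fun t ht => extendLeft_of_nonpos hf0 ht
      prim_zero_of_nonpos := fun t ht => primitiveLeft_of_nonpos hf0 ht
      growth := hg
      prim_le := fun ε hε => exists_primitiveLeft_le hf0 hzero (by linarith) hG hε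
      superlinear := exists_le_primitiveLeft hfc htop
      quasi_mono := exists_quasi_mono hfc hf0 hf2 }⟩

lemma fShift_eq (hf0 : f 0 = 0) (a t : ℝ) : fShift f a t = extendLeft f t - a := by
  rw [fShift]
  split_ifs with h
  · rw [extendLeft_of_nonneg h]
  · rw [extendLeft_of_nonpos hf0 (not_le.1 h).le, zero_sub]

lemma FShift_eq (hfc : ContinuousOn f (Ici 0)) (hf0 : f 0 = 0) (a t : ℝ) :
    FShift f a t = primitiveLeft f t - a * t := by
  rw [FShift, primitiveLeft]
  simp_rw [fShift_eq hf0]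
  rw [intervalIntegral.integral_sub ((continuous_extendLeft hfc).intervalIntegrable _ _)
    intervalIntegrable_const, intervalIntegral.integral_const, smul_eq_mul]
  ring

end ExtendLeft

/-! ## Weights -/

section Weight

variable {α : Type*} [MeasurableSpace α] {ν : Measure α} {g : α → ℝ}

/-- The measure with density `g`. -/
def weightMeasure (ν : Measure α) (g : α → ℝ) : Measure α :=
  ν.withDensity fun x => ENNReal.ofReal (g x)

lemma isFiniteMeasure_weightMeasure (hg : MemLp g 1 ν) : IsFiniteMeasure (weightMeasure ν g) :=
  isFiniteMeasure_withDensity_ofReal (memLp_one_iff_integrable.1 hg).2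

lemma weightMeasure_le : weightMeasure ν g ≤ eLpNorm g ⊤ ν • ν := by
  rw [← withDensity_const]
  refine withDensity_mono ?_
  rw [eLpNorm_exponent_top]
  filter_upwards [ae_le_eLpNormEssSup (f := g) (μ := ν)] with x hx
  exact (Real.ofReal_le_enorm _).trans hx

lemma integral_weightMeasure (hg : MemLp g 1 ν) (h0 : 0 ≤ᵐ[ν] g) (h : α → ℝ) :
    ∫ x, h x ∂weightMeasure ν g = ∫ x, g x * h x ∂ν := by
  rw [weightMeasure, integral_withDensity_eq_integral_toReal_smul₀
    hg.aestronglyMeasurable.aemeasurable.ennreal_ofReal (ae_of_all _ fun x => ENNReal.ofReal_lt_top)]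
  refine integral_congr_ae ?_
  filter_upwards [h0] with x hx
  rw [ENNReal.toReal_ofReal hx, smul_eq_mul]

lemma integrable_weightMeasure (hg : MemLp g 1 ν) (h0 : 0 ≤ᵐ[ν] g) {h : α → ℝ} :
    Integrable h (weightMeasure ν g) ↔ Integrable (fun x => g x * h x) ν := by
  rw [weightMeasure, integrable_withDensity_iff_integrable_smul₀'
    hg.aestronglyMeasurable.aemeasurable.ennreal_ofReal (ae_of_all _ fun x => ENNReal.ofReal_lt_top)]
  refine integrable_congr ?_
  filter_upwards [h0] with x hx
  rw [ENNReal.toReal_ofReal hx, smul_eq_mul]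

lemma weightMeasure_ne_zero (hg : MemLp g 1 ν) (h0 : 0 ≤ᵐ[ν] g) (hne : ¬ g =ᵐ[ν] 0) :
    weightMeasure ν g ≠ 0 := fun h => by
  rw [weightMeasure, withDensity_eq_zero_iff
    hg.aestronglyMeasurable.aemeasurable.ennreal_ofReal] at h
  refine hne ?_
  filter_upwards [h, h0] with x hx hx0
  exact le_antisymm (ENNReal.ofReal_eq_zero.1 hx) hx0

end Weight

/-! ## Mountain pass solutions -/

lemma EnergySpace.exists_norm_bound_of_critical {E : Type*} [NormedAddCommGroup E]
    [NormedSpace ℝ E] {α : Type*} [MeasurableSpace α] {μ : Measure α} [IsFiniteMeasure μ] {p : ℝ}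
    [Fact (1 < p)] (S : EnergySpace E μ p) {γ : ℝ} {f F : ℝ → ℝ} (hf : IsNonlinearity p γ f F)
    (A Λ : ℝ) : ∃ ρ > 0, ∀ a ≥ 0, a ≤ A → ∀ u, |S.action F a u| ≤ Λ → S.dAction hf a u = 0 →
      ‖u‖ ≤ ρ := by
  obtain ⟨ρ, hρ, h⟩ := S.exists_norm_bound hf A Λ
  refine ⟨ρ, hρ, fun a ha haA u hu hu' => h a ha haA u hu ?_⟩
  rw [hu', norm_zero, zero_mul]
  exact (abs_nonneg _).trans hu

/-! ### Transfer from the abstract framework to the weighted problem. -/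

section WeightedEnergy

variable {N : ℕ} {s : ℝ} {hs : 0 < s} {hN : 2 * s < N} {f : ℝ → ℝ}
  {g : EuclideanSpace ℝ (Fin N) → ℝ} [IsFiniteMeasure (weightMeasure volume g)]
  [Fact (1 < critExp N s)]
  {S : EnergySpace (HDot hs hN) (weightMeasure volume g) (critExp N s)}
  {γ : ℝ}

lemma gagliardoSeminorm_nonneg (N : ℕ) (s : ℝ) (u : EuclideanSpace ℝ (Fin N) → ℝ) :
    0 ≤ gagliardoSeminorm N s u := Real.sqrt_nonneg _

lemma integrable_emb (u : HDot hs hN) : Integrable (S.emb u) (weightMeasure volume g) :=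
  (Lp.memLp _).integrable (ENNReal.one_le_ofReal.2 (Fact.out : 1 < critExp N s).le)

lemma integrable_FShift (hg1 : MemLp g 1 volume) (hg0 : 0 ≤ᵐ[volume] g)
    (hfc : ContinuousOn f (Ici 0)) (hf0 : f 0 = 0)
    (hf : IsNonlinearity (critExp N s) γ (extendLeft f) (primitiveLeft f))
    (hemb : ∀ u, S.emb u =ᵐ[weightMeasure volume g] u.fn) (a : ℝ) (u : HDot hs hN) :
    Integrable (fun x => g x * FShift f a (u.fn x)) volume := by
  rw [← integrable_weightMeasure hg1 hg0 (h := fun x => FShift f a (u.fn x))]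
  refine ((S.integrable_pot hf u).sub ((integrable_emb (S := S) u).const_mul a)).congr ?_
  filter_upwards [hemb u] with x hx
  rw [Pi.sub_apply, hx, FShift_eq hfc hf0]

lemma energy_eq_action (hg1 : MemLp g 1 volume) (hg0 : 0 ≤ᵐ[volume] g)
    (hfc : ContinuousOn f (Ici 0)) (hf0 : f 0 = 0)
    (hf : IsNonlinearity (critExp N s) γ (extendLeft f) (primitiveLeft f))
    (hform : ∀ u, S.form u u = gagliardoSeminorm N s u.fn ^ 2)
    (hemb : ∀ u, S.emb u =ᵐ[weightMeasure volume g] u.fn) (a : ℝ) :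
    energy f g a = S.action (primitiveLeft f) a := by
  funext u
  rw [energy, ← integral_weightMeasure hg1 hg0 (fun x => FShift f a (u.fn x)), EnergySpace.action,
    hform, EnergySpace.pot, S.mass_apply]
  have h : ∫ x, FShift f a (u.fn x) ∂weightMeasure volume g =
      ∫ x, (primitiveLeft f (S.emb u x) - a * S.emb u x) ∂weightMeasure volume g := by
    refine integral_congr_ae ?_
    filter_upwards [hemb u] with x hx
    rw [hx, FShift_eq hfc hf0]
  rw [h, integral_sub (S.integrable_pot hf u) ((integrable_emb (S := S) u).const_mul a),
    integral_const_mul]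
  ring

lemma isWeakSolution_of_dAction_eq_zero (hg1 : MemLp g 1 volume) (hg0 : 0 ≤ᵐ[volume] g)
    (hf0 : f 0 = 0)
    (hf : IsNonlinearity (critExp N s) γ (extendLeft f) (primitiveLeft f))
    (hform : ∀ u v, S.form u v = gagliardoForm N s u.fn v.fn)
    (hemb : ∀ u, S.emb u =ᵐ[weightMeasure volume g] u.fn) {a : ℝ} {u : HDot hs hN}
    (hu : S.dAction hf a u = 0) : IsWeakSolution f g a u := by
  intro φ
  have hae : (fun x => extendLeft f (S.emb u x) * S.emb φ x - a * S.emb φ x)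
      =ᵐ[weightMeasure volume g] fun x => fShift f a (u.fn x) * φ.fn x := by
    filter_upwards [hemb u, hemb φ] with x hx hx'
    rw [hx, hx', fShift_eq hf0]
    ring
  have hint := S.integrable_dPot hf u φ
  have hint' := (integrable_emb (S := S) φ).const_mul a
  simp only [mul_assoc]
  rw [← integrable_weightMeasure hg1 hg0 (h := fun x => fShift f a (u.fn x) * φ.fn x),
    ← integral_weightMeasure hg1 hg0 (fun x => fShift f a (u.fn x) * φ.fn x),
    ← integral_congr_ae hae, integral_sub hint hint', integral_const_mul, ← S.dPot_apply hf,
    ← S.mass_apply, ← hform]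
  refine ⟨(hint.sub hint').congr hae, ?_⟩
  have h := S.dAction_apply hf a u φ
  rw [hu, zero_apply] at h
  linarith

lemma satisfiesCerami_action [CompleteSpace (HDot hs hN)]
    (hf : IsNonlinearity (critExp N s) γ (extendLeft f) (primitiveLeft f)) {a : ℝ} (ha : 0 ≤ a) :
    SatisfiesCerami (S.action (primitiveLeft f) a) := by
  intro c
  rw [S.fderiv_action hf]
  refine ⟨fun w hw _ hd => ?_, ?_⟩
  · obtain ⟨M, hM⟩ := hw.exists_norm_le
    exact S.exists_subseq_tendsto hf (fun n => hM _ (mem_range_self n)) hd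
  · obtain ⟨ρ, hρ, h⟩ := S.exists_norm_bound hf a (|c| + 1)
    obtain ⟨C, hC, hle⟩ := GagliardoSpace.exists_norm_le_seminorm hs hN
    -- The a priori bound is used contrapositively: beyond ρ, with energy within 1 of c, the product
    -- ‖I'(v)‖‖v‖ exceeds |c| + 1. The Sobolev constant C converts the norm into the seminorm.
    refine ⟨1, one_pos, (|c| + 1) / C, by positivity, ρ + 1, by positivity, fun v hv hvρ => ?_⟩
    have h1 : gagliardoSeminorm N s v.fn ≤ ‖v‖ :=
      le_add_of_nonneg_right (norm_nonneg (GagliardoSpace.toLp (v : GagliardoSpace hs hN)))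
    have h2 : |S.action (primitiveLeft f) a v| ≤ |c| + 1 := by
      rw [abs_le]
      constructor <;> linarith [hv.1, hv.2, neg_abs_le c, le_abs_self c]
    have h3 : |c| + 1 < ‖S.dAction hf a v‖ * ‖v‖ := by
      by_contra! h4
      linarith [h a ha le_rfl v h2 h4]
    have h5 : ‖v‖ ≤ C * gagliardoSeminorm N s v.fn := hle (v : GagliardoSpace hs hN)
    rw [div_le_iff₀ hC]
    nlinarith [mul_le_mul_of_nonneg_left h5 (norm_nonneg (S.dAction hf a v))]

/-- A bump function equal to 1 on a closed ball of positive weight. It gives a direction in which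
the superlinear term is felt. -/
lemma exists_nonneg_emb_ne_zero (hs1 : s < 1)
    (hemb : ∀ u, S.emb u =ᵐ[weightMeasure volume g] u.fn) (hμ : weightMeasure volume g ≠ 0) :
    ∃ u : HDot hs hN, (∀ᵐ x ∂weightMeasure volume g, 0 ≤ S.emb u x) ∧
      ¬ S.emb u =ᵐ[weightMeasure volume g] 0 := by
  obtain ⟨n, hn⟩ : ∃ n : ℕ, weightMeasure volume g (Metric.closedBall 0 n) ≠ 0 := by
    by_contra! h
    refine hμ (Measure.measure_univ_eq_zero.1 ?_)
    rw [← Metric.iUnion_closedBall_nat (0 : EuclideanSpace ℝ (Fin N))]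
    exact measure_iUnion_null h
  set b : ContDiffBump (0 : EuclideanSpace ℝ (Fin N)) :=
    ⟨(n : ℝ) + 1, (n : ℝ) + 2, by positivity, by linarith⟩ with hb
  obtain ⟨u, -, hu⟩ := exists_testFunction (hs := hs) (hN := hN) hs1 (φ := b) b.contDiff
    b.hasCompactSupport
  have hub : S.emb u =ᵐ[weightMeasure volume g] b :=
    (hemb u).trans ((withDensity_absolutelyContinuous _ _).ae_eq hu)
  refine ⟨u, ?_, fun h0 => hn ?_⟩
  · filter_upwards [hub] with x hx
    rw [hx]
    exact b.nonneg
  · have h : ∀ᵐ x ∂weightMeasure volume g, x ∉ Metric.closedBall 0 (n : ℝ) := by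
      filter_upwards [hub.symm.trans h0] with x hx hxn
      have : b x = 1 := b.one_of_mem_closedBall
        (Metric.closedBall_subset_closedBall (by simp [hb]) hxn)
      rw [hx] at this
      simp at this
    rw [ae_iff] at h
    simpa only [not_not, ofPred_mem_eq] using h

end WeightedEnergy

end

theorem theorem1p1 (N : ℕ) (s : ℝ) (hs0 : 0 < s) (hs1 : s < 1) (hN : 2 * s < N)
    (f : ℝ → ℝ) (hfc : ContinuousOn f (Ici 0)) (hf0 : f 0 = 0)
    (hf1 : HypF1 N s f) (hf2 : HypF2 f)
    (g : EuclideanSpace ℝ (Fin N) → ℝ)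
    (hg1 : MemLp g 1 volume) (hginf : MemLp g ⊤ volume)
    (hgnonneg : 0 ≤ᵐ[volume] g) (hgne : ¬ g =ᵐ[volume] 0) :
    ∃ a₁ > 0, ∃ u : ℝ → HDot hs0 hN,
      (∀ a ∈ Ioo 0 a₁, IsMountainPassSolution f g a (u a)) ∧
      ∃ a₂ ∈ Ioo 0 a₁, ∃ C > 0, ∀ a ∈ Ioo 0 a₂, ‖u a‖ ≤ C := by
  have : IsFiniteMeasure (weightMeasure volume g) := isFiniteMeasure_weightMeasure hg1
  have : Fact (1 < critExp N s) := ⟨one_lt_two.trans (critExp_gt_two hs0 hN)⟩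
  obtain ⟨γ, hf⟩ := isNonlinearity_extendLeft hfc hf0 hf1 hf2
  have hle : weightMeasure volume g ≤ eLpNorm g ⊤ volume • volume := weightMeasure_le
  set S := HDot.energySpace hs0 hN hs1 hginf.2.ne hle
  have hform : ∀ u v, S.form u v = gagliardoForm N s u.fn v.fn := HDot.form_apply
  have hform' : ∀ u, S.form u u = gagliardoSeminorm N s u.fn ^ 2 := HDot.form_self
  have hemb : ∀ u, S.emb u =ᵐ[weightMeasure volume g] u.fn := 
    HDot.embWeight_coe hginf.2.ne hle
  obtain ⟨u₀, hu₀, hne⟩ := exists_nonneg_emb_ne_zero hs1 hemb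
    (weightMeasure_ne_zero hg1 hgnonneg hgne)
  obtain ⟨a₁, ha₁, ρ, hρ, β, hβ, e, Λ, he, h⟩ := S.exists_mountainPass hf hu₀ hne
  choose! hsphere hneg u hβu huΛ hcrit hglb using h
  have hE := energy_eq_action hg1 hgnonneg hfc hf0 hf hform' hemb
  -- The norm bound holds on all of (0, a₁): the critical levels lie in [β, Λ] and the a priori
  -- bound is uniform for a ≤ a₁. The half only makes a₂ strictly smaller.
  refine ⟨a₁, ha₁, u, fun a ha => ?_, a₁ / 2, ⟨by positivity, half_lt_self ha₁⟩, ?_⟩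
  · refine ⟨isWeakSolution_of_dAction_eq_zero hg1 hgnonneg hf0 hf hform hemb (hcrit a ha),
      integrable_FShift hg1 hgnonneg hfc hf0 hf hemb a, ?_⟩
    rw [hE]
    refine ⟨S.contDiff_action hf a, by rw [S.fderiv_action hf, hcrit a ha],
      satisfiesCerami_action hf ha.1.le, ρ, hρ, β, hβ, e, S.action_zero hf a,
      fun v hv => hsphere a ha v (by rw [hform', hv]), ?_, hneg a ha, hβu a ha, hglb a ha⟩
    rw [hform'] at he
    exact lt_of_pow_lt_pow_left₀ 2 (gagliardoSeminorm_nonneg N s _) he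
  · obtain ⟨C, hC, hbd⟩ := S.exists_norm_bound_of_critical hf a₁ Λ
    refine ⟨C, hC, fun a ha => ?_⟩
    have ha' : a ∈ Ioo 0 a₁ := ⟨ha.1, ha.2.trans (half_lt_self ha₁)⟩
    refine hbd a ha'.1.le ha'.2.le (u a) ?_ (hcrit a ha')
    rw [abs_of_pos (hβ.trans_le (hβu a ha'))]
    exact huΛ a ha'
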